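/- Let $k$ be a field of characteristic zero with algebraic closure $\bar k$; for a field $K$ with $k\subset K\subset\bar k$ put $\Gamma_K=\mathrm{Gal}(\bar k/K)$. Let $k^{\mathrm{cyc}}\subset\bar k$ be the extension of $k$ obtained by adjoining all roots of unity. Let $E$ be an elliptic curve over $k$, and choose isomorphisms $E(\bar k)[n]\simeq(\mathbb Z/n)^2$ for all $n\ge 1$ that form a basis of the Tate module $\varprojlim E(\bar k)[n]$ over $\hat{\mathbb Z}=\varprojlim \mathbb Z/n$. Let $\rho:\Gamma_k\to \mathrm{GL}_2(\hat{\mathbb Z})$ and $\rho_n:\Gamma_k\to \mathrm{GL}_2(\mathbb Z/n)$ be the resulting Galois representations in the torsion of $E$ and in $E[n]$. Let $\varepsilon:\mathrm{GL}_2(\mathbb Z/2)\simeq S_3\to\{\pm1\}$ be the signature. Let $\mathrm{SL}_2^+(\hat{\mathbb Z})$ be the kernel of the composition of the reduction $\mathrm{SL}_2(\hat{\mathbb Z})\to\mathrm{GL}_2(\mathbb Z/2)$ with $\varepsilon$. For a positive integer $n$ let $\mathrm{SL}_2^+(\mathbb Z/n)$ be $\mathrm{SL}_2(\mathbb Z/n)$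 if $n$ is odd, and the kernel of the composition $\mathrm{SL}_2(\mathbb Z/n)\to\mathrm{SL}_2(\mathbb Z/2)\to\{\pm1\}$ of reduction and $\varepsilon$ if $n$ is even. **Proposition.** Assume that $\mathrm{SL}_2^+(\hat{\mathbb Z})\subset\rho(\Gamma_k)$. Then for any field $K$ with $k\subset K\subset k^{\mathrm{cyc}}$: (i) $\mathrm{SL}_2^+(\hat{\mathbb Z})\subset\rho(\Gamma_K)$, and $\mathrm{SL}_2^+(\mathbb Z/n)\subset\rho_n(\Gamma_K)$ for any positive integer $n$. (ii) For any point $P\in E(K)$ that cannot be written as $P=mQ$ with an integer $m>1$ and $Q\in E(K)$, and for any integer $n>0$, the scheme $[n]^{-1}(P)$, i.e. the fibre over $P:\mathrm{Spec}\,K\to E_K$ of the multiplication by $n$ map $[n]:E_K\to E_K$ (where $E_K=E\times_kK$), is integral. -/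

import Mathlib

open CategoryTheory CategoryTheory.Limits AlgebraicGeometry

noncomputable section

/-! ## The ring `Ẑ` and the groups `SL₂⁺` -/

/-- `Ẑ = lim ℤ/n`, the ring of compatible families of residue classes. -/
def ZHat : Subring (∀ n : ℕ+, ZMod (n : ℕ)) where
  carrier := {a | ∀ (m n : ℕ+) (h : (n : ℕ) ∣ (m : ℕ)), ZMod.castHom h (ZMod (n : ℕ)) (a m) = a n}
  mul_mem' := by
    intro a b ha hb m n h
    simp only [Pi.mul_apply, map_mul, ha m n h, hb m n h]
  one_mem' := by
    intro m n h
    simp only [Pi.one_apply, map_one]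
  add_mem' := by
    intro a b ha hb m n h
    simp only [Pi.add_apply, map_add, ha m n h, hb m n h]
  zero_mem' := by
    intro m n h
    simp only [Pi.zero_apply, map_zero]
  neg_mem' := by
    intro a ha m n h
    simp only [Pi.neg_apply, map_neg, ha m n h]

/-- Reduction `Ẑ → ℤ/n`. -/
def ZHat.reduce (n : ℕ+) : ZHat →+* ZMod (n : ℕ) :=
  (Pi.evalRingHom (fun n : ℕ+ => ZMod (n : ℕ)) n).comp ZHat.subtype

/-- `ε : GL₂(ℤ/2) → {±1}`, the signature of the permutation of the vectors of `(ℤ/2)²` (the zero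
vector is fixed, so this is the signature of the permutation of the three nonzero vectors). -/
def signTwo : GL (Fin 2) (ZMod 2) →* ℤˣ :=
  (Equiv.Perm.sign (α := Fin 2 → ZMod 2)).comp
    ((MulAction.toPermHom (LinearMap.GeneralLinearGroup (ZMod 2) (Fin 2 → ZMod 2))
        (Fin 2 → ZMod 2)).comp
      (Matrix.GeneralLinearGroup.toLin (n := Fin 2) (R := ZMod 2)).toMonoidHom)

/-- The composite `SL₂(R) → SL₂(ℤ/2) → {±1}` for a ring `R` with a map to `ℤ/2`. -/
def signMod {R : Type*} [CommRing R] (f : R →+* ZMod 2) :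
    Matrix.SpecialLinearGroup (Fin 2) R →* ℤˣ :=
  signTwo.comp (Matrix.SpecialLinearGroup.toGL.comp (Matrix.SpecialLinearGroup.map f))

/-- `SL₂⁺(Ẑ)`, as a subgroup of `GL₂(Ẑ)`. -/
def SLPlusZHat : Subgroup (GL (Fin 2) ZHat) :=
  (signMod (ZHat.reduce 2)).ker.map Matrix.SpecialLinearGroup.toGL

/-- `SL₂⁺(ℤ/n)`, as a subgroup of `GL₂(ℤ/n)`: all of `SL₂(ℤ/n)` if `n` is odd, and the kernel of
`SL₂(ℤ/n) → SL₂(ℤ/2) → {±1}` if `n` is even. -/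
def SLPlusZMod (n : ℕ+) : Subgroup (GL (Fin 2) (ZMod (n : ℕ))) :=
  (if h : 2 ∣ (n : ℕ) then (signMod (ZMod.castHom h (ZMod 2))).ker else ⊤).map
    Matrix.SpecialLinearGroup.toGL

/-! ## Torsion of an elliptic curve and its Galois representations -/

/-- The cyclotomic extension `k^cyc ⊂ Ω`, obtained by adjoining all roots of unity. -/
def cyclotomicExtension (k Ω : Type*) [Field k] [Field Ω] [Algebra k Ω] : IntermediateField k Ω :=
  IntermediateField.adjoin k {ζ : Ω | ∃ n : ℕ, 0 < n ∧ ζ ^ n = 1}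

namespace WeierstrassCurve

/-- The base change of an elliptic curve is an elliptic curve. -/
instance baseChange_isElliptic {k : Type*} [CommRing k] (W : WeierstrassCurve k) [W.IsElliptic]
    (K : Type*) [CommRing K] [Algebra k K] : (W⁄K).IsElliptic :=
  inferInstanceAs (W.map (algebraMap k K)).IsElliptic

section Torsion

variable {k : Type*} [Field k] (W : WeierstrassCurve k) (Ω : Type*) [Field Ω] [Algebra k Ω]

open scoped Classical in
/-- The subgroup `E[n]` of `E(Ω)`. -/
def torsionPoints (n : ℕ+) : AddSubgroup (W⁄Ω).toAffine.Point :=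
  (nsmulAddMonoidHom (n : ℕ)).ker

variable {Ω} in
open scoped Classical in
/-- The action of `σ ∈ Gal(Ω/k)` on `E(Ω)`, coordinate by coordinate. -/
def galPoint (σ : Gal(Ω/k)) : (W⁄Ω).toAffine.Point →+ (W⁄Ω).toAffine.Point :=
  Affine.Point.map (W' := W.toAffine) (σ : Ω →ₐ[k] Ω)

variable {Ω} in
open scoped Classical in
/-- The action of `Gal(Ω/k)` on `E[n]`. -/
def galTorsion (n : ℕ+) (σ : Gal(Ω/k)) : W.torsionPoints Ω n →+ W.torsionPoints Ω n :=
  ((W.galPoint σ).comp (W.torsionPoints Ω n).subtype).codRestrict (W.torsionPoints Ω n) (by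
    rintro ⟨x, hx⟩
    have hx' : (n : ℕ) • x = 0 := hx
    change (n : ℕ) • W.galPoint σ x = 0
    rw [← map_nsmul, hx', map_zero])

open scoped Classical in
/-- A choice of coordinates on the torsion of `E`: isomorphisms `E[n] ≃ (ℤ/n)²` for all `n ≥ 1`,
compatible with the maps `d : E[nd] → E[n]` and the reductions `ℤ/nd → ℤ/n`. (This is the same as a
`Ẑ`-basis of the Tate module `lim E[n]`.) -/
structure TorsionBasis where
  /-- The isomorphism `E[n] ≃ (ℤ/n)²`. -/
  coord : ∀ n : ℕ+, W.torsionPoints Ω n ≃+ (Fin 2 → ZMod (n : ℕ))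
  coord_nsmul : ∀ (n d : ℕ+) (x : W.torsionPoints Ω (n * d)) (y : W.torsionPoints Ω n),
    (y : (W⁄Ω).toAffine.Point) = (d : ℕ) • (x : (W⁄Ω).toAffine.Point) →
    ∀ i, coord n y i =
      ZMod.castHom (show (n : ℕ) ∣ ((n * d : ℕ+) : ℕ) by simp) (ZMod (n : ℕ)) (coord (n * d) x i)

variable {W Ω}

lemma galTorsion_one (n : ℕ+) (x : W.torsionPoints Ω n) :
    W.galTorsion n (1 : Gal(Ω/k)) x = x := by
  obtain ⟨x, hx⟩ := x
  apply Subtype.ext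
  change W.galPoint 1 x = x
  cases x <;> rfl

lemma galTorsion_mul (n : ℕ+) (σ τ : Gal(Ω/k)) (x : W.torsionPoints Ω n) :
    W.galTorsion n (σ * τ) x = W.galTorsion n σ (W.galTorsion n τ x) := by
  obtain ⟨x, hx⟩ := x
  apply Subtype.ext
  change W.galPoint (σ * τ) x = W.galPoint σ (W.galPoint τ x)
  cases x <;> rfl

namespace TorsionBasis

variable (b : TorsionBasis W Ω)

/-- The `ℤ/n`-linear endomorphism of `(ℤ/n)²` given by `σ` acting on `E[n]`. -/
def lin (n : ℕ+) (σ : Gal(Ω/k)) : (Fin 2 → ZMod (n : ℕ)) →ₗ[ZMod (n : ℕ)] (Fin 2 → ZMod (n : ℕ)) :=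
  AddMonoidHom.toZModLinearMap (n : ℕ)
    ((b.coord n).toAddMonoidHom.comp
      ((W.galTorsion n σ).comp (b.coord n).symm.toAddMonoidHom))

lemma lin_apply (n : ℕ+) (σ : Gal(Ω/k)) (v : Fin 2 → ZMod (n : ℕ)) :
    b.lin n σ v = b.coord n (W.galTorsion n σ ((b.coord n).symm v)) := rfl

/-- The representation `ρₙ : Gal(Ω/k) → GL₂(ℤ/n)` in `E[n]`: the matrix `ρₙ(σ)` satisfies
`coord (σ x) = ρₙ(σ) (coord x)` for `x ∈ E[n]`. -/
def rhoMod (n : ℕ+) : Gal(Ω/k) →* GL (Fin 2) (ZMod (n : ℕ)) :=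
  MonoidHom.toHomUnits
    { toFun := fun σ => LinearMap.toMatrix' (b.lin n σ)
      map_one' := by
        rw [← LinearMap.toMatrix'_one]
        congr 1
        ext1 i
        ext1
        simp [lin_apply, galTorsion_one]
      map_mul' := by
        intro σ τ
        rw [← LinearMap.toMatrix'_mul]
        congr 1
        refine LinearMap.ext fun v => ?_
        simp [lin_apply, galTorsion_mul] }

lemma coe_rhoMod (n : ℕ+) (σ : Gal(Ω/k)) :
    (b.rhoMod n σ : Matrix (Fin 2) (Fin 2) (ZMod (n : ℕ))) = LinearMap.toMatrix' (b.lin n σ) := rfl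

lemma rhoMod_mulVec (n : ℕ+) (σ : Gal(Ω/k)) (x : W.torsionPoints Ω n) :
    Matrix.mulVec (b.rhoMod n σ : Matrix (Fin 2) (Fin 2) (ZMod (n : ℕ))) (b.coord n x) =
      b.coord n (W.galTorsion n σ x) := by
  rw [coe_rhoMod, LinearMap.toMatrix'_mulVec, lin_apply, AddEquiv.symm_apply_apply]

lemma rhoMod_reduce (m n : ℕ+) (h : (n : ℕ) ∣ (m : ℕ)) (σ : Gal(Ω/k)) (i j : Fin 2) :
    ZMod.castHom h (ZMod (n : ℕ)) ((b.rhoMod m σ : Matrix _ _ _) i j) =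
      (b.rhoMod n σ : Matrix _ _ _) i j := by
  classical
  obtain ⟨d, rfl⟩ : ∃ d, m = n * d := PNat.dvd_iff.mpr h
  set x : W.torsionPoints Ω (n * d) := (b.coord (n * d)).symm (Pi.single j 1) with hx
  have hxm : ((n * d : ℕ+) : ℕ) • (x : (W⁄Ω).toAffine.Point) = 0 := x.2
  let y : W.torsionPoints Ω n := ⟨(d : ℕ) • (x : (W⁄Ω).toAffine.Point), by
    change (n : ℕ) • ((d : ℕ) • (x : (W⁄Ω).toAffine.Point)) = 0
    rw [← mul_nsmul', ← PNat.mul_coe]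
    exact hxm⟩
  have hy : b.coord n y = Pi.single j 1 := by
    funext l
    rw [b.coord_nsmul n d x y rfl l, hx, AddEquiv.apply_symm_apply]
    by_cases hl : l = j
    · subst hl; rw [Pi.single_eq_same, Pi.single_eq_same, map_one]
    · rw [Pi.single_eq_of_ne hl, Pi.single_eq_of_ne hl, map_zero]
  have hσ : ((W.galTorsion n σ y : W.torsionPoints Ω n) : (W⁄Ω).toAffine.Point) =
      (d : ℕ) • ((W.galTorsion (n * d) σ x : W.torsionPoints Ω (n * d)) :
        (W⁄Ω).toAffine.Point) := by
    change W.galPoint σ ((d : ℕ) • (x : (W⁄Ω).toAffine.Point)) = (d : ℕ) • W.galPoint σ x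
    rw [map_nsmul]
  have key := b.coord_nsmul n d _ _ hσ i
  rw [← rhoMod_mulVec, ← rhoMod_mulVec, hy, hx, AddEquiv.apply_symm_apply,
    Matrix.mulVec_single_one, Matrix.mulVec_single_one] at key
  exact key.symm

/-- The representation `ρ : Gal(Ω/k) → GL₂(Ẑ)` in the torsion of `E`: the reduction of `ρ(σ)` modulo
`n` is `ρₙ(σ)`. -/
def rho : Gal(Ω/k) →* GL (Fin 2) ZHat :=
  MonoidHom.toHomUnits
    { toFun := fun σ => Matrix.of fun i j =>
        ⟨fun n => (b.rhoMod n σ : Matrix _ _ _) i j, fun m n h => b.rhoMod_reduce m n h σ i j⟩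
      map_one' := by
        refine Matrix.ext fun i j => Subtype.ext (funext fun n => ?_)
        simp only [Matrix.of_apply, map_one, Units.val_one, Matrix.one_apply]
        split_ifs <;> rfl
      map_mul' := by
        intro σ τ
        refine Matrix.ext fun i j => Subtype.ext (funext fun n => ?_)
        simp only [Matrix.of_apply, map_mul, Units.val_mul, Matrix.mul_apply, Fin.sum_univ_two]
        rfl }

end TorsionBasis

end Torsion

/-! ## The scheme `[n]⁻¹(P)` -/

section Multiplication

universe u

/-- The field of fractions of a domain `R` is the function field of `Spec R`. -/
def fractionRingEquiv (R : CommRingCat.{u}) [IsDomain R] :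
    FractionRing R ≃+* (Spec R).functionField :=
  (IsLocalization.algEquiv (nonZeroDivisors R) (FractionRing R)
    (Spec R).functionField).toRingEquiv

lemma fractionRingEquiv_algebraMap (R : CommRingCat.{u}) [IsDomain R] (a : R) :
    fractionRingEquiv R (algebraMap R (FractionRing R) a) =
      (StructureSheaf.toStalk R (genericPoint (Spec R))).hom a :=
  AlgEquiv.commutes (IsLocalization.algEquiv (nonZeroDivisors R) (FractionRing R)
    (Spec R).functionField) a

variable {F : Type u} [Field F] (W : WeierstrassCurve F)

/-- The `F`-algebra map `F[W] → L` given by an `L`-point `(x, y)` of the affine curve. -/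
def evalCoord {L : Type*} [CommRing L] [Algebra F L] (x y : L)
    (h : (W⁄L).toAffine.Equation x y) : W.toAffine.CoordinateRing →ₐ[F] L :=
  AdjoinRoot.liftAlgHom W.toAffine.polynomial (Polynomial.aeval x) y (by
    have h' := (Affine.equation_iff' _ _).mp h
    simp only [baseChange, map_a₁, map_a₂, map_a₃, map_a₄, map_a₆] at h'
    rw [← h', Affine.polynomial]
    simp only [Polynomial.eval₂_add, Polynomial.eval₂_sub, Polynomial.eval₂_mul,
      Polynomial.eval₂_pow, Polynomial.eval₂_X, Polynomial.eval₂_C, RingHom.coe_coe, map_add,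
      map_mul, map_pow, Polynomial.aeval_X, Polynomial.aeval_C]
    simp only [toAffine]
    ring)

/-- The functions `x` and `y` in the function field `F(W)` satisfy the Weierstrass equation. -/
lemma generic_equation :
    (W⁄W.toAffine.FunctionField).toAffine.Equation
      (algebraMap W.toAffine.CoordinateRing W.toAffine.FunctionField
        (Affine.CoordinateRing.mk W.toAffine (Polynomial.C Polynomial.X)))
      (algebraMap W.toAffine.CoordinateRing W.toAffine.FunctionField
        (Affine.CoordinateRing.mk W.toAffine Polynomial.X)) := by
  have h : Affine.CoordinateRing.mk W.toAffine W.toAffine.polynomial = 0 := AdjoinRoot.mk_self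
  have h' := congrArg (algebraMap W.toAffine.CoordinateRing W.toAffine.FunctionField) h
  rw [Affine.equation_iff']
  simp only [baseChange, map_a₁, map_a₂, map_a₃, map_a₄, map_a₆]
  simp only [Affine.polynomial, map_zero, map_add, map_sub, map_mul, map_pow] at h'
  have e : ∀ a : F, algebraMap F W.toAffine.FunctionField a =
      algebraMap W.toAffine.CoordinateRing W.toAffine.FunctionField
        (Affine.CoordinateRing.mk W.toAffine (Polynomial.C (Polynomial.C a))) := fun a => rfl
  simp only [e]
  linear_combination h'

/-- The affine curve `E ∖ {O} = Spec F[W]`. -/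
abbrev affineScheme : Scheme.{u} := Spec (.of W.toAffine.CoordinateRing)

/-- The structure morphism `E ∖ {O} → Spec F`. -/
abbrev affineStructure : W.affineScheme ⟶ Spec (.of F) :=
  Spec.map (CommRingCat.ofHom (algebraMap F W.toAffine.CoordinateRing))

/-- The point `P ≠ O` of `E(F)` as a morphism `Spec F → E ∖ {O}`. -/
def pointHom : (P : W.toAffine.Point) → P ≠ 0 → (Spec (.of F) ⟶ W.affineScheme)
  | 0, hP => absurd rfl hP
  | .some x y h, _ => Spec.map (CommRingCat.ofHom (W.evalCoord (L := F) x y (by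
      rw [show W⁄F = W from W.map_id]; exact h.1)).toRingHom)

instance : Algebra.FiniteType F W.toAffine.CoordinateRing := by
  have : Module.Finite (Polynomial F) W.toAffine.CoordinateRing :=
    Module.Finite.of_basis (Affine.CoordinateRing.basis W.toAffine)
  exact Algebra.FiniteType.trans (S := Polynomial F) inferInstance inferInstance

instance : LocallyOfFiniteType W.affineStructure := by
  rw [HasRingHomProperty.Spec_iff (P := @LocallyOfFiniteType), CommRingCat.hom_ofHom,
    RingHom.finiteType_algebraMap]
  infer_instance

/-- The identification of the field of fractions `F(W)` of `F[W]` with the function field of the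
scheme `E ∖ {O} = Spec F[W]`. -/
def functionFieldEquiv : W.toAffine.FunctionField ≃+* W.affineScheme.functionField :=
  fractionRingEquiv (.of W.toAffine.CoordinateRing)

lemma functionFieldEquiv_algebraMap (a : W.toAffine.CoordinateRing) :
    W.functionFieldEquiv (algebraMap _ W.toAffine.FunctionField a) =
      (StructureSheaf.toStalk (CommRingCat.of W.toAffine.CoordinateRing) _).hom a :=
  fractionRingEquiv_algebraMap (.of W.toAffine.CoordinateRing) a

/-- An affine point of `E(F(W))`, viewed as a rational map `E ∖ {O} ⇢ E ∖ {O}` over `F`. -/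
def rationalMapOfPoint : (R : (W⁄W.toAffine.FunctionField).toAffine.Point) → R ≠ 0 →
    (W.affineScheme ⤏ W.affineScheme)
  | 0, hR => absurd rfl hR
  | .some x y h, _ =>
    Scheme.RationalMap.ofFunctionField W.affineStructure W.affineStructure
      (Spec.map (CommRingCat.ofHom
        (W.functionFieldEquiv.toRingHom.comp (W.evalCoord x y h.1).toRingHom)))
      (by
        rw [Spec.fromSpecStalk_eq', affineStructure]
        refine (Spec.map_comp _ _).symm.trans (Eq.trans (congrArg Spec.map ?_) (Spec.map_comp _ _))
        ext a
        have h1 : W.evalCoord x y h.1 (algebraMap F W.toAffine.CoordinateRing a) =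
            algebraMap W.toAffine.CoordinateRing W.toAffine.FunctionField
              (algebraMap F W.toAffine.CoordinateRing a) := by
          rw [AlgHom.commutes]
          rfl
        have h2 := W.functionFieldEquiv_algebraMap (algebraMap F W.toAffine.CoordinateRing a)
        rw [← h1] at h2
        exact h2)

variable [W.IsElliptic]

/-- The generic point `(x, y)` of `E`, a point over the function field `F(W)`. -/
def genericPt : (W⁄W.toAffine.FunctionField).toAffine.Point :=
  haveI : (W⁄W.toAffine.FunctionField).toAffine.IsElliptic :=
    W.baseChange_isElliptic W.toAffine.FunctionField
  .some _ _ (Affine.equation_iff_nonsingular.mp W.generic_equation)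

open scoped Classical in
/-- Multiplication by `n` as a rational map from `E ∖ {O}` to `E ∖ {O}`: it is given by the multiple
`n • (x, y)` of the generic point in the group `E(F(W))`. For `n ≠ 0` this multiple is not `O`; in
the case that it is `O` (so for `n = 0`) the value is a placeholder. -/
def mulRational (n : ℕ) : W.affineScheme ⤏ W.affineScheme :=
  if h : n • W.genericPt = 0 then Scheme.RationalMap.id _ else W.rationalMapOfPoint _ h

/-- The scheme `[n]⁻¹(P)` for `n ≥ 1` and `P ∈ E(F)`, `P ≠ O`: the fibre product of `[n]` and
`P : Spec F → E`. As `P ≠ O`, the scheme `[n]⁻¹(P)` lies in the open set `E ∖ E[n]`, on which `[n]`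
is the morphism to `E ∖ {O}` that extends the rational map above to its domain of definition. -/
def mulFibre (n : ℕ) (P : W.toAffine.Point) (hP : P ≠ 0) : Scheme.{u} :=
  pullback (W.mulRational n).toPartialMap.hom (W.pointHom P hP)

open scoped Classical in
/-- `P ∈ E(F)` is not divisible: it is not `m Q` with `m > 1` and `Q ∈ E(F)`. -/
def IsIndivisible {F : Type*} [Field F] (W : WeierstrassCurve F) (P : W.toAffine.Point) : Prop :=
  ∀ m : ℕ, 1 < m → ∀ Q : W.toAffine.Point, P ≠ m • Q

lemma IsIndivisible.ne_zero {F : Type*} [Field F] {W : WeierstrassCurve F} {P : W.toAffine.Point}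
    (hP : W.IsIndivisible P) : P ≠ 0 := by
  classical
  intro h
  refine hP 2 one_lt_two 0 ?_
  rw [h, smul_zero]

end Multiplication

end WeierstrassCurve

end

noncomputable section

/-! ## Places of a field and specialization of points -/

/-! Part (i). If ρ(σ) lies in SL₂⁺(Ẑ), then det ρₙ(σ) = 1 for all n. The Weil pairing shows that σ
acts on n-th roots of unity through det ρₙ(σ), so σ fixes k^cyc and hence K. Thus the image of Γ_K
still contains SL₂⁺(Ẑ) (`SLPlusZHat_le_map_rho`). The statement modulo n follows because SL₂(ℤ) →
SL₂(ℤ/n) is surjective (`SLPlusZMod_le_map_rhoMod`).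

The Weil pairing is built as a commutator. For T in E[n] let h_T be a function with divisor n(-T) -
n(0). The operators f ↦ h_T · f(· + T) preserve the Riemann–Roch space L(n·0) and are multiplicative
in T up to scalars, and the commutator of two of them is a scalar. If the pairing of a basis S, T of
E[n] had order m < n, the operators of S and mT would have a common eigenvector in L(n·0). Its zeros
as a section of O(n·0) would be stable under a group with n·(n/m) > n elements, which is too many
(`IsWeilPairing.isPrimitiveRoot`). This needs a valuation of the function field at each point,
infinity included, and specialization of points as a homomorphism (`spHom`).

Part (ii) has an arithmetic and a geometric half. Arithmetic: Γ_K permutes transitively the Q with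
nQ = P (`exists_smul_eq_of_nsmul_eq`). The differences σQ - Q, for σ trivial on E[n], form a
subgroup of E[n] stable under SL₂⁺, so it is E[m] with n = dm. Let τ act as -1 on E[n] and put S = Q
+ τQ. Then σS - S lies in E[m] for every σ, so mS is rational, and d·(mS) = 2P. As E has no rational
point of order two and P is not divisible, d is 1 or 2. If d = 1 the action is transitive already.
If d = 2, the case n = 2 is settled separately: were the subgroup trivial there, an element of order
three in the image on E[2] would single out a rational half of P. Combining this with E[m] gives
transitivity for n.

Geometric: the fibre over P is Spec B/I, where B is a localization of the coordinate ring and I is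
generated by x∘[n] - x(P) and y∘[n] - y(P). Closed points of the fibre are Galois orbits of the Q
with nQ = P, so exactly one prime p contains I (`existsUnique_prime`). The map [n] multiplies the
invariant differential by n ≠ 0, so it is unramified and I is not contained in p². In a Dedekind
domain this makes I prime (`isPrime_map_ker`), and the fibre is integral (`isIntegral_mulFibre`). -/

/-- A place of the field `L` over `F` with values in `κ`: the relation `rel x a` says that `x` is
finite at the place and has the value `a`. -/
structure FieldPlace (F L κ : Type*) [Field F] [Field L] [Field κ] [Algebra F L] [Algebra F κ] where
  /-- `x` has the value `a`. -/
  rel : L → κ → Prop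
  add : ∀ {x y a b}, rel x a → rel y b → rel (x + y) (a + b)
  mul : ∀ {x y a b}, rel x a → rel y b → rel (x * y) (a * b)
  const : ∀ c : F, rel (algebraMap F L c) (algebraMap F κ c)
  unique : ∀ {x a b}, rel x a → rel x b → a = b
  total : ∀ x, (∃ a, rel x a) ∨ rel x⁻¹ 0

namespace FieldPlace

variable {F L κ : Type*} [Field F] [Field L] [Field κ] [Algebra F L] [Algebra F κ]
  (p : FieldPlace F L κ)

include p in
lemma zero : p.rel 0 0 := by simpa using p.const 0

lemma one : p.rel 1 1 := by simpa using p.const 1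

variable {p}

lemma neg {x : L} {a : κ} (h : p.rel x a) : p.rel (-x) (-a) := by
  have h1 : p.rel (-1) (-1) := by simpa using p.const (-1)
  simpa using p.mul h1 h

lemma sub {x y : L} {a b : κ} (h : p.rel x a) (h' : p.rel y b) : p.rel (x - y) (a - b) := by
  simpa [sub_eq_add_neg] using p.add h (neg h')

lemma pow {x : L} {a : κ} (h : p.rel x a) (n : ℕ) : p.rel (x ^ n) (a ^ n) := by
  induction n with
  | zero => simpa using p.one
  | succ n ih => simpa [pow_succ] using p.mul ih h

lemma ne_zero_of_rel {x : L} {a : κ} (h : p.rel x a) (ha : a ≠ 0) : x ≠ 0 := by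
  rintro rfl
  exact ha (p.unique h p.zero)

lemma inv {x : L} {a : κ} (h : p.rel x a) (ha : a ≠ 0) : p.rel x⁻¹ a⁻¹ := by
  have hx := ne_zero_of_rel h ha
  rcases p.total x⁻¹ with ⟨b, hb⟩ | hb
  · have h1 := p.mul h hb
    rw [mul_inv_cancel₀ hx] at h1
    rwa [← eq_inv_of_mul_eq_one_right (p.unique h1 p.one)] 
  · rw [inv_inv] at hb
    exact absurd (p.unique h hb) ha

lemma div {x y : L} {a b : κ} (h : p.rel x a) (h' : p.rel y b) (hb : b ≠ 0) :
    p.rel (x / y) (a / b) := by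
  simpa [div_eq_mul_inv] using p.mul h (inv h' hb)

variable (p) in
lemma ofNat (n : ℕ) : p.rel n n := by simpa using p.const n

/-- Restriction of a place along a homomorphism of fields. -/
def comap {L' : Type*} [Field L'] [Algebra F L'] (p : FieldPlace F L κ) (φ : L' →ₐ[F] L) :
    FieldPlace F L' κ where
  rel x a := p.rel (φ x) a
  add h h' := by rw [_root_.map_add]; exact p.add h h'
  mul h h' := by rw [_root_.map_mul]; exact p.mul h h'
  const c := by rw [AlgHom.commutes]; exact p.const c
  unique h h' := p.unique h h'
  total x := by rw [map_inv₀]; exact p.total (φ x)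

end FieldPlace

namespace WeierstrassCurve

set_option linter.unusedSectionVars false

section Specialization

variable {k : Type*} [Field k] (W : WeierstrassCurve k) [W.IsElliptic]
  {F L κ : Type*} [Field F] [Field L] [Field κ] [Algebra k F] [Algebra k L] [Algebra k κ]
  [Algebra F L] [Algebra F κ] [IsScalarTower k F L] [IsScalarTower k F κ]
  (p : FieldPlace F L κ)

lemma nonsingular_of_equation {x y : L} (h : (W⁄L).toAffine.Equation x y) :
    (W⁄L).toAffine.Nonsingular x y :=
  haveI : (W⁄L).toAffine.IsElliptic := W.baseChange_isElliptic L
  Affine.equation_iff_nonsingular.mp h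

lemma equation_baseChange_iff {x y : L} : (W⁄L).toAffine.Equation x y ↔
    y ^ 2 + algebraMap k L W.a₁ * x * y + algebraMap k L W.a₃ * y =
      x ^ 3 + algebraMap k L W.a₂ * x ^ 2 + algebraMap k L W.a₄ * x + algebraMap k L W.a₆ := by
  rw [Affine.equation_iff]; rfl

lemma rel_coeff (c : k) : p.rel (algebraMap k L c) (algebraMap k κ c) := by
  rw [IsScalarTower.algebraMap_apply k F L, IsScalarTower.algebraMap_apply k F κ]
  exact p.const _

open FieldPlace

variable {W p} in
lemma equation_of_rel {x y : L} {a b : κ} (h : (W⁄L).toAffine.Equation x y) (ha : p.rel x a)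
    (hb : p.rel y b) : (W⁄κ).toAffine.Equation a b := by
  rw [equation_baseChange_iff] at h ⊢
  have hc := rel_coeff (k := k) p
  have h1 := p.add (p.add (pow hb 2) (p.mul (p.mul (hc W.a₁) ha) hb)) (p.mul (hc W.a₃) hb)
  have h2 := p.add (p.add (p.add (pow ha 3) (p.mul (hc W.a₂) (pow ha 2))) (p.mul (hc W.a₄) ha))
    (hc W.a₆)
  rw [h] at h1
  exact p.unique h1 h2

-- The Weierstrass equation is monic in y, so y is integral over x: if y⁻¹ had the value 0, the
-- equation divided by y² would specialize to 1 = 0.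
variable {W p} in
lemma exists_rel_Y {x y : L} {a : κ} (h : (W⁄L).toAffine.Equation x y) (ha : p.rel x a) :
    ∃ b, p.rel y b := by
  rcases p.total y with hb | hb
  · exact hb
  · by_cases hy : y = 0
    · exact ⟨0, hy ▸ p.zero⟩
    exfalso
    rw [equation_baseChange_iff] at h
    have hc := rel_coeff (k := k) p
    have h1 := p.add p.one (p.add (p.mul (p.mul (hc W.a₁) ha) hb) (p.mul (hc W.a₃) hb))
    have h2 := p.mul (p.add (p.add (p.add (pow ha 3) (p.mul (hc W.a₂) (pow ha 2)))
      (p.mul (hc W.a₄) ha)) (hc W.a₆)) (pow hb 2)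
    rw [← h] at h2
    have e : (y ^ 2 + algebraMap k L W.a₁ * x * y + algebraMap k L W.a₃ * y) * y⁻¹ ^ 2 =
        1 + (algebraMap k L W.a₁ * x * y⁻¹ + algebraMap k L W.a₃ * y⁻¹) := by
      field_simp
      ring
    rw [e] at h2
    have := p.unique h1 h2
    simp at this

open scoped Classical in
/-- Specialization of the points of a Weierstrass curve at a place. -/
def sp : (W⁄L).toAffine.Point → (W⁄κ).toAffine.Point
  | 0 => 0
  -- By `exists_rel_Y` finiteness of x suffices for the first case, so the default 0 is taken
  -- exactly where x has a pole, that is, where the point reduces to infinity.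
  | .some x y h => if hx : ∃ a b, p.rel x a ∧ p.rel y b then
      .some hx.choose hx.choose_spec.choose (W.nonsingular_of_equation
        (equation_of_rel h.1 hx.choose_spec.choose_spec.1 hx.choose_spec.choose_spec.2)) else 0

variable {W p}

lemma sp_some {x y : L} {a b : κ} (h : (W⁄L).toAffine.Nonsingular x y) (ha : p.rel x a)
    (hb : p.rel y b) : W.sp p (.some x y h) = .some a b
      (W.nonsingular_of_equation (equation_of_rel h.1 ha hb)) := by
  have hx : ∃ a b, p.rel x a ∧ p.rel y b := ⟨a, b, ha, hb⟩
  rw [sp, dif_pos hx, Affine.Point.some.injEq]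
  exact ⟨p.unique hx.choose_spec.choose_spec.1 ha, p.unique hx.choose_spec.choose_spec.2 hb⟩

lemma sp_some_eq_zero {x y : L} (h : (W⁄L).toAffine.Nonsingular x y) (hx : ¬ ∃ a, p.rel x a) :
    W.sp p (.some x y h) = 0 := by
  rw [sp, dif_neg]
  rintro ⟨a, b, ha, -⟩
  exact hx ⟨a, ha⟩

lemma exists_of_sp_eq_some {P : (W⁄L).toAffine.Point} {a b : κ} {h}
    (hP : W.sp p P = .some a b h) : ∃ x y h', P = .some x y h' ∧ p.rel x a ∧ p.rel y b := by
  rcases P with _ | ⟨x, y, h'⟩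
  · exact absurd hP.symm (Affine.Point.some_ne_zero _)
  · by_cases hx : ∃ a, p.rel x a
    · obtain ⟨a', ha'⟩ := hx
      obtain ⟨b', hb'⟩ := exists_rel_Y h'.1 ha'
      rw [sp_some h' ha' hb', Affine.Point.some.injEq] at hP
      obtain ⟨rfl, rfl⟩ := hP
      exact ⟨x, y, h', rfl, ha', hb'⟩
    · rw [sp_some_eq_zero h' hx] at hP
      exact absurd hP.symm (Affine.Point.some_ne_zero _)

lemma exists_of_sp_ne_zero {P : (W⁄L).toAffine.Point}
    (hP : W.sp p P ≠ 0) : ∃ x y h' a b h, P = .some x y h' ∧ p.rel x a ∧ p.rel y b ∧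
      W.sp p P = .some a b h := by
  rcases hQ : W.sp p P with _ | ⟨a, b, h⟩
  · exact absurd hQ hP
  · obtain ⟨x, y, h', h1, h2, h3⟩ := exists_of_sp_eq_some hQ
    exact ⟨x, y, h', a, b, h, h1, h2, h3, rfl⟩

-- The reductions have distinct x-coordinates, so the denominator of the chord formula has a nonzero
-- value and the formula specializes term by term. The remaining cases are recovered by
-- `map_add_of_generic`.
open scoped Classical in
lemma sp_add_of_ne {P Q : (W⁄L).toAffine.Point} (hP : W.sp p P ≠ 0) (hQ : W.sp p Q ≠ 0)
    (h : W.sp p P ≠ W.sp p Q) (h' : W.sp p P ≠ -W.sp p Q) :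
    W.sp p (P + Q) = W.sp p P + W.sp p Q := by
  obtain ⟨x₁, y₁, h₁, a₁, b₁, k₁, rfl, hx₁, hy₁, e₁⟩ := exists_of_sp_ne_zero hP
  obtain ⟨x₂, y₂, h₂, a₂, b₂, k₂, rfl, hx₂, hy₂, e₂⟩ := exists_of_sp_ne_zero hQ
  rw [e₁, e₂] at h h' ⊢
  have ha : a₁ ≠ a₂ := by
    intro e
    rcases Affine.Point.X_eq_iff.mp e with h3 | h3
    exacts [h h3, h' h3]
  have hx : x₁ ≠ x₂ := by
    rintro rfl
    exact ha (p.unique hx₁ hx₂)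
  rw [Affine.Point.add_of_X_ne hx, Affine.Point.add_of_X_ne ha]
  have hc := rel_coeff (k := k) p
  have hl : p.rel ((W⁄L).toAffine.slope x₁ x₂ y₁ y₂) ((W⁄κ).toAffine.slope a₁ a₂ b₁ b₂) := by
    rw [Affine.slope_of_X_ne hx, Affine.slope_of_X_ne ha]
    exact div (sub hy₁ hy₂) (sub hx₁ hx₂) (sub_ne_zero.mpr ha)
  have hX := sub (sub (sub (p.add (pow hl 2) (p.mul (hc W.a₁) hl)) (hc W.a₂)) hx₁) hx₂
  have hY := p.add (p.mul hl (sub hX hx₁)) hy₁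
  exact sp_some _ hX (sub (sub (neg hY) (p.mul (hc W.a₁) hX)) (hc W.a₃))

variable (W) in
/-- The points of the curve over `F` as points over an extension `L`. -/
abbrev constPt [DecidableEq F] [DecidableEq L] :
    (W⁄F).toAffine.Point →+ (W⁄L).toAffine.Point :=
  Affine.Point.map (W' := W.toAffine) (Algebra.ofId F L)

/-- In the coordinates t = 1/x and s = y/x² the curve is s² + a₁st + a₃st² = t + a₂t² + a₄t³ + a₆t⁴.
This is monic in s, so s is finite, and t = 0 forces s² = 0. -/
lemma exists_rel_of_not_rel {x y : L} (h : (W⁄L).toAffine.Equation x y)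
    (hx : ¬ ∃ a, p.rel x a) : x ≠ 0 ∧ p.rel x⁻¹ 0 ∧ p.rel (y * x⁻¹ ^ 2) 0 := by
  have hx0 : x ≠ 0 := by
    rintro rfl
    exact hx ⟨0, p.zero⟩
  have ht : p.rel x⁻¹ 0 := (p.total x).resolve_left hx
  refine ⟨hx0, ht, ?_⟩
  rw [equation_baseChange_iff] at h
  have hc := rel_coeff (k := k) p
  set t := x⁻¹ with htdef
  set s := y * t ^ 2 with hs
  have hxt : x * t = 1 := mul_inv_cancel₀ hx0
  have e : s ^ 2 + algebraMap k L W.a₁ * s * t + algebraMap k L W.a₃ * s * t ^ 2 =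
      t + algebraMap k L W.a₂ * t ^ 2 + algebraMap k L W.a₄ * t ^ 3 +
        algebraMap k L W.a₆ * t ^ 4 := by
    have hx1 : x = 1 / t := by rw [htdef]; field_simp
    have ht0 : t ≠ 0 := inv_ne_zero hx0
    rw [hx1] at h
    field_simp at h
    rw [hs]
    linear_combination t * h
  have hR := p.add (p.add (p.add ht (p.mul (hc W.a₂) (pow ht 2))) (p.mul (hc W.a₄) (pow ht 3)))
    (p.mul (hc W.a₆) (pow ht 4))
  rw [← e] at hR
  rcases p.total s with ⟨b, hb⟩ | hb
  · have hL := p.add (p.add (pow hb 2) (p.mul (p.mul (hc W.a₁) hb) ht))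
      (p.mul (p.mul (hc W.a₃) hb) (pow ht 2))
    have := p.unique hL hR
    have hb0 : b = 0 := by
      simpa using this
    rwa [hb0] at hb
  · by_cases hs0 : s = 0
    · rw [hs0]; exact p.zero
    exfalso
    have hL := p.add p.one (p.add (p.mul (p.mul (hc W.a₁) ht) hb)
      (p.mul (p.mul (hc W.a₃) (pow ht 2)) hb))
    have hR' := p.mul hR (pow hb 2)
    have e' : (s ^ 2 + algebraMap k L W.a₁ * s * t + algebraMap k L W.a₃ * s * t ^ 2) * s⁻¹ ^ 2 =
        1 + (algebraMap k L W.a₁ * t * s⁻¹ + algebraMap k L W.a₃ * t ^ 2 * s⁻¹) := by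
      generalize s = s at *
      field_simp
      ring
    rw [e'] at hR'
    have := p.unique hL hR'
    simp at this

open scoped Classical in
lemma sp_constPt (C : (W⁄F).toAffine.Point) : W.sp p (W.constPt C) = W.constPt C := by
  rcases C with _ | ⟨c, d, h⟩
  · rfl
  · exact sp_some _ (p.const c) (p.const d)

-- In terms of t = 1/x and s = y/x², the x-coordinate of P + C is a fraction whose denominator (1 -
-- ct)² has value 1 and whose numerator has value c. This fixes the point only up to sign;
-- `map_add_of_generic` settles the sign.
open scoped Classical in
lemma sp_add_constPt_of_sp_eq_zero {P : (W⁄L).toAffine.Point} (hP : W.sp p P = 0)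
    (C : (W⁄F).toAffine.Point) :
    W.sp p (P + W.constPt C) = W.constPt C ∨ W.sp p (P + W.constPt C) = -W.constPt C := by
  rcases P with _ | ⟨x, y, h⟩
  · left
    rw [← Affine.Point.zero_def, zero_add, sp_constPt]
  rcases C with _ | ⟨c, d, hC⟩
  · left
    rw [← Affine.Point.zero_def, _root_.map_zero, _root_.map_zero, add_zero, hP]
  have hx : ¬ ∃ a, p.rel x a := by
    rintro ⟨a, ha⟩
    obtain ⟨b, hb⟩ := exists_rel_Y h.1 ha
    rw [sp_some h ha hb] at hP
    exact Affine.Point.some_ne_zero _ hP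
  obtain ⟨hx0, ht, hs⟩ := exists_rel_of_not_rel h.1 hx
  have hne : x ≠ algebraMap F L c := by
    rintro rfl
    exact hx ⟨_, p.const c⟩
  have hC' : (W⁄L).toAffine.Nonsingular (algebraMap F L c) (algebraMap F L d) := ((W.toAffine.baseChange_nonsingular (Algebra.ofId F L).injective c d).mpr hC)
  have hCL : W.constPt (F := F) (L := L) (.some c d hC) =
      .some (algebraMap F L c) (algebraMap F L d) hC' := rfl
  rw [hCL, Affine.Point.add_of_X_ne hne]
  have hc := rel_coeff (k := k) p
  have h1 := h.1
  rw [equation_baseChange_iff] at h1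
  have key : p.rel ((W⁄L).toAffine.addX x (algebraMap F L c)
      ((W⁄L).toAffine.slope x (algebraMap F L c) y (algebraMap F L d))) (algebraMap F κ c) := by
    rw [Affine.slope_of_X_ne hne]
    have hcL := p.const c
    have hdL := p.const d
    set c' := algebraMap F L c
    set d' := algebraMap F L d
    set t := x⁻¹ with htdef
    set A₁ := algebraMap k L W.a₁
    set A₂ := algebraMap k L W.a₂
    set A₃ := algebraMap k L W.a₃
    set A₄ := algebraMap k L W.a₄
    set A₆ := algebraMap k L W.a₆
    -- The coefficients of t, t² and s in the numerator, after y² has been eliminated by the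
    -- Weierstrass equation.
    have hA := p.add (sub (sub (hc W.a₄) (p.mul (hc W.a₁) hdL)) (pow hcL 2))
      (p.mul (p.mul (p.ofNat 2) hcL) (p.add (hc W.a₂) hcL))
    have hB := sub (p.add (p.add (hc W.a₆) (pow hdL 2)) (p.mul (p.mul (hc W.a₁) hcL) hdL))
      (p.mul (pow hcL 2) (p.add (hc W.a₂) hcL))
    have hD := sub (sub (neg (hc W.a₃)) (p.mul (p.ofNat 2) hdL)) (p.mul (hc W.a₁) hcL)
    have hN := p.add (p.add (p.add hcL (p.mul hA ht)) (p.mul hB (pow ht 2))) (p.mul hD hs)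
    have hM := pow (sub p.one (p.mul hcL ht)) 2
    have hq := div hN hM (by simp)
    simp only [mul_zero, zero_pow two_ne_zero, add_zero, sub_zero, one_pow, div_one] at hq
    convert hq using 1
    have h2 : x - c' ≠ 0 := sub_ne_zero.mpr hne
    have hxt : t = 1 / x := by rw [htdef]; field_simp
    have e3 : 1 - c' * t = (x - c') / x := by rw [hxt]; field_simp
    change ((y - d') / (x - c')) ^ 2 + A₁ * ((y - d') / (x - c')) - A₂ - x - c' = _
    rw [e3, hxt]
    field_simp
    push_cast
    linear_combination h1
  obtain ⟨b, hb⟩ := exists_rel_Y (Affine.equation_add h.1 hC'.1 (fun h => hne h.1)) key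
  rw [sp_some _ key hb]
  exact Affine.Point.X_eq_iff.mp rfl

end Specialization

end WeierstrassCurve

/-- A map of abelian groups that is additive on generic pairs and compatible with sufficiently many
constants is additive. -/
theorem map_add_of_generic {C G H : Type*} [AddCommGroup C] [AddCommGroup G] [AddCommGroup H]
    (i : C →+ G) (j : C →+ H) (hj : Function.Injective j) [Infinite C]
    (h2 : {c : C | c + c = 0}.Finite) (f : G → H) (fconst : ∀ c, f (i c) = j c)
    (fgen : ∀ P Q, f P ≠ 0 → f Q ≠ 0 → f P ≠ f Q → f P ≠ -f Q → f (P + Q) = f P + f Q)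
    (fker : ∀ P c, f P = 0 → f (P + i c) = j c ∨ f (P + i c) = -j c) (P Q : G) :
    f (P + Q) = f P + f Q := by
  have pick : ∀ S : Set H, S.Finite → ∃ c, j c ∉ S ∧ c + c ≠ 0 := by
    intro S hS
    obtain ⟨c, hc⟩ := ((hS.preimage hj.injOn).union h2).infinite_compl.nonempty
    exact ⟨c, fun h => hc (Or.inl h), fun h => hc (Or.inr h)⟩
  -- If f(P + c) = -c with 2c ≠ 0, add a generic c' with 2c' ≠ 0. Then f(P + c + c') = c' - c must
  -- be ±(c + c'), so 2c = 0 or 2c' = 0.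
  have ker : ∀ P c, f P = 0 → f (P + i c) = j c := by
    intro P c hP
    rcases fker P c hP with h | h
    · exact h
    by_cases hc2 : c + c = 0
    · rw [h, ← map_neg, ← eq_neg_of_add_eq_zero_left hc2]
    exfalso
    obtain ⟨c', hc', h2'⟩ := pick {0, j c, -j c} (by simp)
    simp only [Set.mem_insert_iff, Set.mem_singleton_iff, not_or] at hc'
    have hc0 : j c ≠ 0 := fun h0 => hc2 (hj (by simp [h0]))
    have e := fgen (P + i c) (i c') (by rw [h]; simpa using hc0) (by rw [fconst]; exact hc'.1)
      (by rw [h, fconst]; exact fun h => hc'.2.2 h.symm)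
      (by rw [h, fconst]; exact fun h => hc'.2.1 (neg_injective h.symm))
    rw [h, fconst] at e
    have e' : P + i c + i c' = P + i (c + c') := by rw [map_add]; abel
    rw [e'] at e
    rcases fker P (c + c') hP with h3 | h3
    · rw [e, map_add, add_left_inj] at h3
      exact hc2 (hj (by rw [map_add, map_zero]; nth_rewrite 1 [← h3]; simp))
    · rw [e, map_add, neg_add, add_right_inj] at h3
      exact h2' (hj (by rw [map_add, map_zero]; nth_rewrite 1 [h3]; simp))
  -- The sum P + c + c' is evaluated in both orders, with c' outside the finite set of constants
  -- that make one of the sums non-generic; then c' cancels.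
  have step : ∀ P c, f (P + i c) = f P + j c := by
    intro P c
    by_cases hP : f P = 0
    · rw [ker P c hP, hP, zero_add]
    by_cases hc : j c = 0
    · rw [hc, add_zero, (map_eq_zero_iff j hj).mp hc, map_zero, add_zero]
    obtain ⟨c', hc', -⟩ := pick {0, f P, -f P, j c - f P, -j c - f P, f (P + i c), -f (P + i c)}
      (by simp)
    simp only [Set.mem_insert_iff, Set.mem_singleton_iff, not_or] at hc'
    obtain ⟨n1, n2, n3, n4, n5, n6, n7⟩ := hc'
    have e1 : f (P + i c') = f P + j c' := by
      rw [fgen P (i c') hP (by rwa [fconst]) (by rw [fconst]; exact fun h => n2 h.symm)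
        (by rw [fconst]; exact fun h => n3 (by rw [h, neg_neg])), fconst]
    have e2 : f (P + i c' + i c) = f P + j c' + j c := by
      rw [fgen _ _ (by rw [e1]; exact fun h => n3 (eq_neg_of_add_eq_zero_right h))
        (by rwa [fconst]) (by rw [e1, fconst]; exact fun h => n4 (by rw [← h]; abel))
        (by rw [e1, fconst]; exact fun h => n5 (by rw [← h]; abel)), e1, fconst]
    have e3 : f (P + i c + i c') = f (P + i c) + j c' := by
      by_cases hX : f (P + i c) = 0
      · rw [ker _ _ hX, hX, zero_add]
      · rw [fgen _ _ hX (by rwa [fconst]) (by rw [fconst]; exact fun h => n6 h.symm)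
          (by rw [fconst]; exact fun h => n7 (by rw [h, neg_neg])), fconst]
    rw [add_right_comm, e2] at e3
    have := add_right_cancel (b := j c') (a := f P + j c) (c := f (P + i c)) (by rw [← e3]; abel)
    exact this.symm
  -- Constants c and d move P and Q to a generic pair; `fgen` applies there, and `step` removes the
  -- constants again.
  obtain ⟨c, hc, -⟩ := pick {-f P} (by simp)
  obtain ⟨d, hd, -⟩ := pick {-f Q, f P + j c - f Q, -(f P + j c) - f Q} (by simp)
  simp only [Set.mem_insert_iff, Set.mem_singleton_iff, not_or] at hc hd
  have e := fgen (P + i c) (Q + i d) (by rw [step]; exact fun h => hc (eq_neg_of_add_eq_zero_right h))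
    (by rw [step]; exact fun h => hd.1 (eq_neg_of_add_eq_zero_right h))
    (by rw [step, step]; exact fun h => hd.2.1 (by rw [h]; abel))
    (by rw [step, step]; exact fun h => hd.2.2 (by rw [h]; abel))
  have e' : P + i c + (Q + i d) = P + Q + i (c + d) := by rw [map_add]; abel
  rw [e', step, step, step, map_add] at e
  have := add_right_cancel (b := j c + j d) (a := f (P + Q)) (c := f P + f Q) (by rw [e]; abel)
  exact this

namespace WeierstrassCurve

section SpecializationHom

variable {k : Type*} [Field k] (W : WeierstrassCurve k) [W.IsElliptic]
  {F L κ : Type*} [Field F] [Field L] [Field κ] [Algebra k F] [Algebra k L] [Algebra k κ]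
  [Algebra F L] [Algebra F κ] [IsScalarTower k F L] [IsScalarTower k F κ]
  (p : FieldPlace F L κ)

open scoped Classical in
/-- Specialization at a place is a homomorphism of groups. -/
def spHom [Infinite (W⁄F).toAffine.Point]
    (h2 : {C : (W⁄F).toAffine.Point | C + C = 0}.Finite) :
    (W⁄L).toAffine.Point →+ (W⁄κ).toAffine.Point :=
  AddMonoidHom.mk' (W.sp p) (map_add_of_generic W.constPt W.constPt
    (Affine.Point.map_injective _) h2 _ sp_constPt (fun _ _ => sp_add_of_ne)
    (fun _ C h => sp_add_constPt_of_sp_eq_zero h C))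

end SpecializationHom

end WeierstrassCurve
end

/-! ### The function field, its points, and translations. -/

noncomputable section

namespace WeierstrassCurve

set_option linter.unusedSectionVars false

open scoped Classical
open Polynomial

instance {F : Type*} [Field F] (E : WeierstrassCurve F) : DecidableEq E.toAffine.FunctionField :=
  fun a b => Classical.propDecidable (a = b)

section FunctionField

variable {F : Type*} [Field F] (E : WeierstrassCurve F)

/-- The coordinate function `x`. -/
def xCoord : E.toAffine.CoordinateRing := Affine.CoordinateRing.mk E.toAffine (C X)

/-- The coordinate function `y`. -/
def yCoord : E.toAffine.CoordinateRing := Affine.CoordinateRing.mk E.toAffine X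

variable {E}

lemma exists_eq_add_mul (a : E.toAffine.CoordinateRing) : ∃ p q : F[X],
    a = aeval E.xCoord p + aeval E.xCoord q * E.yCoord := by
  obtain ⟨p, q, rfl⟩ := Affine.CoordinateRing.exists_smul_basis_eq a
  have h : ∀ p : F[X], Affine.CoordinateRing.mk E.toAffine (C p) = aeval E.xCoord p := by
    intro p
    induction p using Polynomial.induction_on' with
    | add p q hp hq => simp only [map_add, hp, hq]
    | monomial n c =>
      rw [aeval_monomial, ← C_mul_X_pow_eq_monomial, C_mul, C_pow, map_mul, map_pow]
      rfl
  refine ⟨p, q, ?_⟩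
  rw [Affine.CoordinateRing.smul, Affine.CoordinateRing.smul, mul_one, h, h]
  rfl

lemma algebraMap_polynomial (p : F[X]) :
    algebraMap F[X] E.toAffine.CoordinateRing p = aeval E.xCoord p := by
  induction p using Polynomial.induction_on' with
  | add p q hp hq => simp only [map_add, hp, hq]
  | monomial n c =>
    rw [aeval_monomial, ← C_mul_X_pow_eq_monomial, map_mul, map_pow]
    rfl

lemma coordinateRing_algHom_ext {B : Type*} [CommRing B] [Algebra F B]
    {φ ψ : E.toAffine.CoordinateRing →ₐ[F] B} (hx : φ E.xCoord = ψ E.xCoord)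
    (hy : φ E.yCoord = ψ E.yCoord) : φ = ψ := by
  refine AlgHom.ext fun a => ?_
  obtain ⟨p, q, rfl⟩ := exists_eq_add_mul a
  simp only [map_add, map_mul, ← aeval_algHom_apply, hx, hy]

lemma yCoord_sq : E.yCoord ^ 2 + algebraMap F _ E.a₁ * E.xCoord * E.yCoord +
    algebraMap F _ E.a₃ * E.yCoord = E.xCoord ^ 3 + algebraMap F _ E.a₂ * E.xCoord ^ 2 +
      algebraMap F _ E.a₄ * E.xCoord + algebraMap F _ E.a₆ := by
  have h : Affine.CoordinateRing.mk E.toAffine E.toAffine.polynomial = 0 := AdjoinRoot.mk_self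
  simp only [Affine.polynomial, map_add, map_sub, map_mul, map_pow] at h
  have e : ∀ a : F, algebraMap F E.toAffine.CoordinateRing a =
      Affine.CoordinateRing.mk E.toAffine (C (C a)) := fun a => rfl
  simp only [e, xCoord, yCoord]
  linear_combination h

section Eval

variable {B : Type*} [CommRing B] [Algebra F B] {x y : B} (h : (E⁄B).toAffine.Equation x y)

lemma evalCoord_xCoord : E.evalCoord x y h E.xCoord = x := by
  change Polynomial.eval₂ _ _ _ = x
  simp

lemma evalCoord_yCoord : E.evalCoord x y h E.yCoord = y := by
  change Polynomial.eval₂ _ _ _ = y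
  simp

lemma evalCoord_unique (φ : E.toAffine.CoordinateRing →ₐ[F] B) (hx : φ E.xCoord = x)
    (hy : φ E.yCoord = y) : E.evalCoord x y h = φ :=
  coordinateRing_algHom_ext ((evalCoord_xCoord h).trans hx.symm) ((evalCoord_yCoord h).trans hy.symm)

lemma equation_of_algHom (φ : E.toAffine.CoordinateRing →ₐ[F] B) :
    (E⁄B).toAffine.Equation (φ E.xCoord) (φ E.yCoord) := by
  rw [Affine.equation_iff]
  have := congrArg φ (E.yCoord_sq)
  simp only [map_add, map_mul, map_pow, AlgHom.commutes] at this
  exact this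

end Eval

/-- The norm of a is the product of a and its conjugate. With `norm_ne_zero`, every nonzero ideal
thus contains a nonzero polynomial in x. -/
lemma norm_mem_of_mem {I : Ideal E.toAffine.CoordinateRing} {a : E.toAffine.CoordinateRing}
    (ha : a ∈ I) : algebraMap F[X] _ (Algebra.norm F[X] a) ∈ I := by
  obtain ⟨p, q, rfl⟩ := Affine.CoordinateRing.exists_smul_basis_eq a
  have := Affine.CoordinateRing.coe_norm_smul_basis (W' := E.toAffine) p q
  have e : algebraMap F[X] E.toAffine.CoordinateRing (Algebra.norm F[X]
      (p • (1 : E.toAffine.CoordinateRing) + q • Affine.CoordinateRing.mk E.toAffine X)) =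
      (p • (1 : E.toAffine.CoordinateRing) + q • Affine.CoordinateRing.mk E.toAffine X) *
        Affine.CoordinateRing.mk E.toAffine (C p + C q * (-X - C (C E.a₁ * X + C E.a₃))) := by
    refine this.trans ?_
    rw [map_mul]
    congr 1
    rw [Affine.CoordinateRing.smul, Affine.CoordinateRing.smul, mul_one, map_add, map_mul]
  rw [e]
  exact I.mul_mem_right _ ha

instance : Module.Finite F[X] E.toAffine.CoordinateRing :=
  Module.Finite.of_basis (Affine.CoordinateRing.basis E.toAffine)

lemma norm_ne_zero {a : E.toAffine.CoordinateRing} (ha : a ≠ 0) : Algebra.norm F[X] a ≠ 0 :=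
  Algebra.norm_ne_zero_iff.mpr ha

end FunctionField

section AlgClosed

variable {F : Type*} [Field F] {E : WeierstrassCurve F} {L : Type*} [Field L] [Algebra F L]

lemma exists_algebraMap_of_aeval_eq_zero [IsAlgClosed F] {p : F[X]} (hp : p ≠ 0) {x : L}
    (hx : aeval x p = 0) : ∃ c, algebraMap F L c = x := by
  have hi : _root_.IsIntegral F x := IsAlgebraic.isIntegral ⟨p, hp, hx⟩
  exact minpoly.mem_range_of_degree_eq_one F x
    (IsAlgClosed.degree_eq_one_of_irreducible F (minpoly.irreducible hi))

lemma exists_algebraMap_Y [IsAlgClosed F] {c : F} {y : L}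
    (h : (E⁄L).toAffine.Equation (algebraMap F L c) y) : ∃ d, algebraMap F L d = y := by
  rw [Affine.equation_iff] at h
  refine exists_algebraMap_of_aeval_eq_zero
    (p := C 1 * X ^ 2 + C (E.a₁ * c + E.a₃) * X + C (-(c ^ 3 + E.a₂ * c ^ 2 + E.a₄ * c + E.a₆)))
    (fun h0 => ?_) ?_
  · have := congrArg (coeff · 2) h0
    simp only [coeff_add, coeff_C_mul, coeff_X_pow, coeff_X, coeff_C] at this
    norm_num at this
  · simp only [map_add, map_mul, aeval_C, aeval_X, map_pow, map_neg, map_one]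
    simp only [baseChange, map_a₁, map_a₂, map_a₃, map_a₄, map_a₆] at h
    linear_combination h

/-- A nonzero element of the kernel has a nonzero norm in F[x] that is killed too, so φ(x) is
algebraic over F, hence constant; then the Weierstrass equation makes φ(y) constant. -/
lemma exists_algebraMap_of_not_injective [IsAlgClosed F] (φ : E.toAffine.CoordinateRing →ₐ[F] L)
    (hφ : ¬ Function.Injective φ) :
    ∃ c d : F, algebraMap F L c = φ E.xCoord ∧ algebraMap F L d = φ E.yCoord := by
  have hx : ∃ c, algebraMap F L c = φ E.xCoord := by
    rw [injective_iff_map_eq_zero] at hφ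
    push Not at hφ
    obtain ⟨a, ha, ha0⟩ := hφ
    have h1 : algebraMap F[X] _ (Algebra.norm F[X] a) ∈ RingHom.ker φ := norm_mem_of_mem ha
    rw [RingHom.mem_ker, algebraMap_polynomial, ← aeval_algHom_apply] at h1
    exact exists_algebraMap_of_aeval_eq_zero (norm_ne_zero ha0) h1
  obtain ⟨c, hc⟩ := hx
  have h := equation_of_algHom φ
  rw [← hc] at h
  obtain ⟨d, hd⟩ := exists_algebraMap_Y h
  exact ⟨c, d, hc, hd⟩

variable [E.IsElliptic]

lemma equation_of_algebraMap {c d : F}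
    (h : (E⁄L).toAffine.Equation (algebraMap F L c) (algebraMap F L d)) :
    (E⁄F).toAffine.Equation c d :=
  (E.toAffine.baseChange_equation (f := Algebra.ofId F L) (Algebra.ofId F L).injective c d).mp h

end AlgClosed

section Pullback

variable {F : Type*} [Field F] {E : WeierstrassCurve F} [E.IsElliptic] {L : Type*} [Field L]
  [Algebra F L]

/-- The inclusion of the coordinate ring in the function field. -/
abbrev toFF (E : WeierstrassCurve F) : E.toAffine.CoordinateRing →ₐ[F] E.toAffine.FunctionField :=
  IsScalarTower.toAlgHom F _ _

lemma genericPt_eq : E.genericPt = .some (E.toFF E.xCoord) (E.toFF E.yCoord)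
    (E.nonsingular_of_equation (equation_of_algHom E.toFF)) := rfl

/-- A homomorphism from the function field is determined by the image of the generic point. Together
with `exists_pullback` this turns identities between such homomorphisms into identities in the group
E(L). -/
lemma functionField_algHom_ext {φ ψ : E.toAffine.FunctionField →ₐ[F] L}
    (h : Affine.Point.map (W' := E.toAffine) φ E.genericPt = Affine.Point.map ψ E.genericPt) :
    φ = ψ := by
  rw [genericPt_eq, Affine.Point.map_some, Affine.Point.map_some, Affine.Point.some.injEq] at h
  apply AlgHom.coe_ringHom_injective
  apply IsLocalization.ringHom_ext (nonZeroDivisors E.toAffine.CoordinateRing)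
  exact congrArg AlgHom.toRingHom (coordinateRing_algHom_ext (φ := φ.comp E.toFF)
    (ψ := ψ.comp E.toFF) h.1 h.2)

lemma map_constPt {M : Type*} [Field M] [Algebra F M] (φ : L →ₐ[F] M)
    (P : (E⁄F).toAffine.Point) :
    Affine.Point.map (W' := E.toAffine) φ (E.constPt P) = E.constPt P := by
  cases P
  · rfl
  · rw [Affine.Point.map_some, Affine.Point.map_some, Affine.Point.map_some,
      Affine.Point.some.injEq]
    exact ⟨φ.commutes _, φ.commutes _⟩

lemma exists_pullback_of_injective {x y : L} (h : (E⁄L).toAffine.Nonsingular x y)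
    (hinj : Function.Injective (E.evalCoord x y h.1)) :
    ∃ φ : E.toAffine.FunctionField →ₐ[F] L,
      Affine.Point.map (W' := E.toAffine) φ E.genericPt = .some x y h := by
  refine ⟨IsFractionRing.liftAlgHom (g := E.evalCoord x y h.1) hinj, ?_⟩
  rw [genericPt_eq, Affine.Point.map_some, Affine.Point.some.injEq]
  constructor
  · exact (IsFractionRing.lift_algebraMap (g := (E.evalCoord x y h.1).toRingHom) hinj _).trans
      (evalCoord_xCoord _)
  · exact (IsFractionRing.lift_algebraMap (g := (E.evalCoord x y h.1).toRingHom) hinj _).trans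
      (evalCoord_yCoord _)

variable [IsAlgClosed F]

lemma evalCoord_injective {x y : L} (h : (E⁄L).toAffine.Nonsingular x y)
    (hR : Affine.Point.some x y h ∉ Set.range (E.constPt (F := F) (L := L))) :
    Function.Injective (E.evalCoord x y h.1) := by
  by_contra hinj
  obtain ⟨c, d, hc, hd⟩ := exists_algebraMap_of_not_injective _ hinj
  rw [evalCoord_xCoord] at hc
  rw [evalCoord_yCoord] at hd
  subst hc hd
  exact hR ⟨.some c d (E.nonsingular_of_equation (equation_of_algebraMap h.1)), rfl⟩

lemma exists_pullback {R : (E⁄L).toAffine.Point} (hR : R ∉ Set.range (E.constPt (F := F))) :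
    ∃ φ : E.toAffine.FunctionField →ₐ[F] L,
      Affine.Point.map (W' := E.toAffine) φ E.genericPt = R := by
  rcases R with _ | ⟨x, y, h⟩
  · exact absurd ⟨0, rfl⟩ hR
  · exact exists_pullback_of_injective h (evalCoord_injective h hR)

lemma genericPt_not_mem_range : E.genericPt ∉ Set.range (E.constPt (F := F)) := by
  rintro ⟨P, hP⟩
  rcases P with _ | ⟨c, d, h⟩
  · exact Affine.Point.some_ne_zero _ hP.symm
  · rw [genericPt_eq, Affine.Point.map_some, Affine.Point.some.injEq] at hP
    have h1 : E.toFF (algebraMap F _ c) = E.toFF E.xCoord := (E.toFF.commutes c).trans hP.1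
    have h2 := (IsFractionRing.injective E.toAffine.CoordinateRing E.toAffine.FunctionField) h1
    have h3 : algebraMap F[X] E.toAffine.CoordinateRing (C c - X) = 0 := by
      rw [algebraMap_polynomial, map_sub, aeval_C, aeval_X, h2, sub_self]
    have h4 := (FaithfulSMul.algebraMap_injective F[X] E.toAffine.CoordinateRing)
      (h3.trans (map_zero _).symm)
    exact X_sub_C_ne_zero c (by rw [← neg_sub, h4, neg_zero])

lemma genericPt_add_not_mem_range (P : (E⁄F).toAffine.Point) :
    E.genericPt + E.constPt P ∉ Set.range (E.constPt (F := F)) := by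
  rintro ⟨Q, hQ⟩
  exact genericPt_not_mem_range ⟨Q - P, by rw [map_sub, hQ, add_sub_cancel_right]⟩

/-- The automorphism of the function field induced by translation by a point: `f ↦ f(· + P)`. -/
def translate (P : (E⁄F).toAffine.Point) : E.toAffine.FunctionField →ₐ[F] E.toAffine.FunctionField :=
  (exists_pullback (genericPt_add_not_mem_range P)).choose

lemma map_translate (P : (E⁄F).toAffine.Point) :
    Affine.Point.map (W' := E.toAffine) (translate P) E.genericPt = E.genericPt + E.constPt P :=
  (exists_pullback (genericPt_add_not_mem_range P)).choose_spec

lemma translate_zero : translate (0 : (E⁄F).toAffine.Point) = AlgHom.id F _ := by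
  apply functionField_algHom_ext
  rw [map_translate, map_zero, add_zero]
  rfl

lemma translate_comp (P Q : (E⁄F).toAffine.Point) :
    (translate P).comp (translate Q) = translate (P + Q) := by
  apply functionField_algHom_ext
  rw [← Affine.Point.map_map, map_translate, map_add, map_translate, map_constPt, map_translate,
    map_add, add_assoc]

lemma translate_translate (P Q : (E⁄F).toAffine.Point) (f : E.toAffine.FunctionField) :
    translate P (translate Q f) = translate (P + Q) f := by
  rw [← translate_comp]; rfl

end Pullback

end WeierstrassCurve
end

/-! ### The coordinate ring is a Dedekind domain. -/

noncomputable section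

namespace WeierstrassCurve

set_option linter.unusedSectionVars false

open scoped Classical
open Polynomial

section Dedekind

variable {F : Type*} [Field F] (E : WeierstrassCurve F) 

lemma aeval_Ψ₂Sq_coordinateRing {B : Type*} [CommRing B] [Algebra F B] {x y : B}
    (h : (E⁄B).toAffine.Equation x y) : aeval x E.Ψ₂Sq =
      (2 * y + algebraMap F B E.a₁ * x + algebraMap F B E.a₃) ^ 2 := by
  rw [Affine.equation_iff] at h
  simp only [baseChange, map_a₁, map_a₂, map_a₃, map_a₄, map_a₆] at h
  simp only [Ψ₂Sq, map_add, map_mul, map_pow, aeval_X, aeval_C, b₂, b₄, b₆, map_ofNat]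
  linear_combination -4 * h

variable [E.IsElliptic]

lemma derivative_Ψ₂Sq : derivative E.Ψ₂Sq = C 12 * X ^ 2 + C (2 * E.b₂) * X + C (2 * E.b₄) := by
  simp only [Ψ₂Sq, derivative_add, derivative_mul, derivative_C, derivative_X_pow, derivative_X]
  have : (C 12 : F[X]) = C 4 * C 3 := by rw [← C_mul]; norm_num
  simp only [this, C_mul, Nat.cast_ofNat, map_ofNat]
  ring

/-- If t were a common zero, the solution y of 2y + a₁t + a₃ = 0 would give a singular point (t, y)
of the curve. -/
lemma aeval_Ψ₂Sq_ne_zero {K : Type*} [Field K] [Algebra F K] (h2 : (2 : K) ≠ 0) (t : K) :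
    aeval t E.Ψ₂Sq ≠ 0 ∨ aeval t (derivative E.Ψ₂Sq) ≠ 0 := by
  by_contra! h
  obtain ⟨hf, hd⟩ := h
  set a₁ := algebraMap F K E.a₁ with ha₁
  set a₃ := algebraMap F K E.a₃ with ha₃
  obtain ⟨y, hy⟩ : ∃ y : K, 2 * y + a₁ * t + a₃ = 0 :=
    ⟨-(a₁ * t + a₃) / 2, by rw [mul_div_cancel₀ _ h2]; ring⟩
  have h4 : (4 : K) ≠ 0 := by
    have : (4 : K) = 2 * 2 := by norm_num
    rw [this]; exact mul_ne_zero h2 h2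
  have heq : (E⁄K).toAffine.Equation t y := by
    rw [Affine.equation_iff]
    simp only [baseChange, map_a₁, map_a₂, map_a₃, map_a₄, map_a₆]
    simp only [Ψ₂Sq, map_add, map_mul, map_pow, aeval_X, aeval_C, b₂, b₄, b₆, map_ofNat] at hf
    apply mul_left_cancel₀ h4
    linear_combination (2 * y + a₁ * t + a₃) * hy - hf
  have hns := E.nonsingular_of_equation heq
  rw [Affine.nonsingular_iff'] at hns
  simp only [baseChange, map_a₁, map_a₂, map_a₃, map_a₄] at hns
  rcases hns.2 with h | h
  · apply h
    simp only [derivative_Ψ₂Sq, map_add, map_mul, map_pow, aeval_X, aeval_C, b₂, b₄, map_ofNat] at hd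
    apply mul_left_cancel₀ h4
    linear_combination 2 * a₁ * hy - hd
  · exact h hy

lemma separable_Ψ₂Sq (h2 : (2 : F) ≠ 0) : E.Ψ₂Sq.Separable := by
  rw [separable_def, isCoprime_iff_aeval_ne_zero_of_isAlgClosed F (AlgebraicClosure F)]
  refine E.aeval_Ψ₂Sq_ne_zero ?_
  rw [← map_ofNat (algebraMap F (AlgebraicClosure F)) 2]
  exact (_root_.map_ne_zero _).mpr h2

variable {E}

/-- Elements integral over `F[x]` and rational over `F(x)` are polynomials. -/
lemma exists_polynomial_of_isIntegral {z : E.toAffine.FunctionField} {r d : F[X]} (hd : d ≠ 0)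
    (hz : _root_.IsIntegral F[X] z)
    (h : algebraMap F[X] _ d * z = algebraMap F[X] E.toAffine.FunctionField r) :
    ∃ s : F[X], z = algebraMap F[X] _ s ∧ d * s = r := by
  have hinj : Function.Injective (algebraMap F[X] E.toAffine.FunctionField) := by
    rw [IsScalarTower.algebraMap_eq F[X] E.toAffine.CoordinateRing]
    exact (IsFractionRing.injective E.toAffine.CoordinateRing _).comp (FaithfulSMul.algebraMap_injective _ _)
  let φ : FractionRing F[X] →ₐ[F[X]] E.toAffine.FunctionField :=
    IsFractionRing.liftAlgHom (g := Algebra.ofId F[X] _) hinj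
  let w : FractionRing F[X] := algebraMap _ _ r / algebraMap _ _ d
  have hd' : algebraMap F[X] E.toAffine.FunctionField d ≠ 0 := fun h0 =>
    hd (hinj (h0.trans (map_zero _).symm))
  have hw : φ w = z := by
    simp only [w, map_div₀, AlgHom.commutes]
    rw [← h, mul_div_cancel_left₀ _ hd']
  rw [← hw] at hz
  have hw' : _root_.IsIntegral F[X] w := (isIntegral_algHom_iff φ φ.injective).mp hz
  obtain ⟨s, hs⟩ := IsIntegrallyClosed.isIntegral_iff.mp hw'
  have hzs : z = algebraMap F[X] _ s := by rw [← hw, ← hs, AlgHom.commutes]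
  refine ⟨s, hzs, hinj ?_⟩
  rw [map_mul, ← hzs, h]

/-- After division by the gcd, d is prime to q, so d² divides the squarefree f and d is a unit. -/
lemma dvd_of_sq_dvd_sq_mul {q d f : F[X]} (hf : Squarefree f) (hd : d ≠ 0)
    (h : d ^ 2 ∣ q ^ 2 * f) : d ∣ q := by
  obtain ⟨g, q', d', hg, hcop, rfl, rfl⟩ : ∃ g q' d' : F[X], g ≠ 0 ∧ IsCoprime q' d' ∧
      q = g * q' ∧ d = g * d' := by
    obtain ⟨q', hq⟩ := EuclideanDomain.gcd_dvd_left q d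
    obtain ⟨d', hd'⟩ := EuclideanDomain.gcd_dvd_right q d
    have hg : EuclideanDomain.gcd q d ≠ 0 := fun h0 => hd (by rw [hd', h0, zero_mul])
    refine ⟨_, q', d', hg, ?_, hq, hd'⟩
    have := EuclideanDomain.gcd_eq_gcd_ab q d
    refine ⟨EuclideanDomain.gcdA q d, EuclideanDomain.gcdB q d, mul_left_cancel₀ hg ?_⟩
    linear_combination -EuclideanDomain.gcdA q d * hq - EuclideanDomain.gcdB q d * hd' - this
  rw [mul_pow, mul_pow, mul_assoc, mul_dvd_mul_iff_left (pow_ne_zero 2 hg)] at h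
  have h1 := (hcop.pow.symm : IsCoprime (d' ^ 2) (q' ^ 2)).dvd_of_dvd_mul_left h
  have h2 : IsUnit d' := hf d' (by rwa [← sq])
  exact mul_dvd_mul_left g h2.dvd

variable (E) in
/-- Negation on the curve as an automorphism of the coordinate ring. -/
def negHom : E.toAffine.CoordinateRing →ₐ[F] E.toAffine.CoordinateRing :=
  E.evalCoord E.xCoord (-E.yCoord - algebraMap F _ E.a₁ * E.xCoord - algebraMap F _ E.a₃) (by
    rw [Affine.equation_iff]
    simp only [baseChange, map_a₁, map_a₂, map_a₃, map_a₄, map_a₆]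
    linear_combination E.yCoord_sq)

lemma negHom_xCoord : E.negHom E.xCoord = E.xCoord := evalCoord_xCoord _

lemma negHom_yCoord : E.negHom E.yCoord =
    -E.yCoord - algebraMap F _ E.a₁ * E.xCoord - algebraMap F _ E.a₃ := evalCoord_yCoord _

lemma negHom_algebraMap (p : F[X]) : E.negHom (algebraMap F[X] _ p) = algebraMap F[X] _ p := by
  rw [algebraMap_polynomial, ← aeval_algHom_apply, negHom_xCoord]

lemma negHom_negHom (a : E.toAffine.CoordinateRing) : E.negHom (E.negHom a) = a := by
  have : E.negHom.comp E.negHom = AlgHom.id F _ := by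
    apply coordinateRing_algHom_ext
    · simp [negHom_xCoord]
    · simp only [AlgHom.comp_apply, negHom_yCoord, map_sub, map_neg, map_mul, AlgHom.commutes,
        negHom_xCoord, AlgHom.id_apply]
      ring
  exact DFunLike.congr_fun this a

/-- The function field is generated over F(x) by η = 2y + a₁x + a₃, and η² = `Ψ₂Sq` is squarefree.
For an integral z = (p + qy)/d with conjugate ν(z), the trace z + ν(z) and the square of z - ν(z) =
qη/d are polynomials. Squarefreeness gives d ∣ q, and z is half of the sum of the trace and the
difference. -/
theorem isIntegrallyClosed_coordinateRing (h2 : (2 : F) ≠ 0) :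
    IsIntegrallyClosed E.toAffine.CoordinateRing := by
  let A := E.toAffine.CoordinateRing
  let L := E.toAffine.FunctionField
  suffices h : ∀ z : L, _root_.IsIntegral A z → ∃ y, algebraMap A L y = z from
    (isIntegrallyClosed_iff L).mpr fun {z} hz => h z hz
  intro z hz
  have hinj : Function.Injective (algebraMap A L) := IsFractionRing.injective _ _
  have hinjX : Function.Injective (algebraMap F[X] A) := FaithfulSMul.algebraMap_injective _ _
  -- write `z = a / d` with `d` a polynomial in `x`
  obtain ⟨a, d, hd, hzd⟩ : ∃ (a : A) (d : F[X]), d ≠ 0 ∧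
      algebraMap F[X] L d * z = algebraMap A L a := by
    obtain ⟨a, b, hb, rfl⟩ := IsFractionRing.div_surjective (A := A) z
    have hb0 : b ≠ 0 := nonZeroDivisors.ne_zero hb
    obtain ⟨c, hc⟩ := Ideal.mem_span_singleton'.mp
      (norm_mem_of_mem (Ideal.mem_span_singleton_self b))
    refine ⟨c * a, Algebra.norm F[X] b, norm_ne_zero hb0, ?_⟩
    rw [IsScalarTower.algebraMap_apply F[X] A L, ← hc, map_mul, map_mul]
    have : algebraMap A L b ≠ 0 := fun h0 => hb0 (hinj (h0.trans (map_zero _).symm))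
    rw [mul_assoc, mul_div_cancel₀ _ this]
  have hdL : algebraMap F[X] L d ≠ 0 := by
    rw [IsScalarTower.algebraMap_apply F[X] A L]
    exact fun h0 => hd (hinjX (hinj (by rw [h0, map_zero, map_zero])))
  -- The conjugation over F(x), induced by negation on the curve.
  let ν : L →ₐ[F] L := IsFractionRing.liftAlgHom (g := E.toFF.comp E.negHom)
    (hinj.comp (Function.LeftInverse.injective negHom_negHom))
  have hν : ∀ a : A, ν (algebraMap A L a) = algebraMap A L (E.negHom a) := fun a =>
    IsFractionRing.lift_algebraMap (g := (E.toFF.comp E.negHom).toRingHom)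
      (hinj.comp (Function.LeftInverse.injective negHom_negHom)) a
  have hνX : ∀ p : F[X], ν (algebraMap F[X] L p) = algebraMap F[X] L p := by
    intro p
    rw [IsScalarTower.algebraMap_apply F[X] A L, hν, negHom_algebraMap]
  let νX : L →ₐ[F[X]] L := { ν with commutes' := hνX }
  have hzX : _root_.IsIntegral F[X] z := isIntegral_trans (A := A) z hz
  have hzν : _root_.IsIntegral F[X] (ν z) := hzX.map νX
  obtain ⟨p, q, hpq⟩ := exists_eq_add_mul a
  set Y := E.yCoord
  set η : A := 2 * Y + algebraMap F A E.a₁ * E.xCoord + algebraMap F A E.a₃ with hη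
  have hzd' : algebraMap F[X] L d * ν z = algebraMap A L (E.negHom a) := by
    rw [← hνX d, ← map_mul, hzd, hν]
  have htr : algebraMap F[X] L d * (z + ν z) =
      algebraMap F[X] L (2 * p - q * (C E.a₁ * X + C E.a₃)) := by
    rw [mul_add, hzd, hzd', IsScalarTower.algebraMap_apply F[X] A L (2 * p - _), ← map_add]
    congr 1
    rw [algebraMap_polynomial, hpq]
    simp only [map_add, map_sub, map_mul, aeval_C, aeval_X, ← aeval_algHom_apply, negHom_xCoord,
      negHom_yCoord, Y, map_ofNat]
    ring
  obtain ⟨t, ht, -⟩ := exists_polynomial_of_isIntegral hd (hzX.add hzν) htr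
  have hdiff : algebraMap F[X] L d * (z - ν z) = algebraMap F[X] L q * algebraMap A L η := by
    rw [mul_sub, hzd, hzd', IsScalarTower.algebraMap_apply F[X] A L q, ← map_mul, ← map_sub]
    congr 1
    rw [algebraMap_polynomial, hpq]
    simp only [map_add, map_mul, ← aeval_algHom_apply, negHom_xCoord, negHom_yCoord, Y, hη]
    ring
  have hηsq : algebraMap F[X] A E.Ψ₂Sq = η ^ 2 := by
    rw [algebraMap_polynomial]
    exact E.aeval_Ψ₂Sq_coordinateRing (equation_of_algHom (AlgHom.id F A))
  have hsq : algebraMap F[X] L (d ^ 2) * (z - ν z) ^ 2 = algebraMap F[X] L (q ^ 2 * E.Ψ₂Sq) := by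
    rw [map_pow, ← mul_pow, hdiff, mul_pow, map_mul, map_pow,
      IsScalarTower.algebraMap_apply F[X] A L E.Ψ₂Sq, hηsq, map_pow]
  obtain ⟨s, -, hs⟩ := exists_polynomial_of_isIntegral (pow_ne_zero 2 hd)
    ((hzX.sub hzν).pow 2) hsq
  obtain ⟨r, rfl⟩ := dvd_of_sq_dvd_sq_mul (E.separable_Ψ₂Sq h2).squarefree hd ⟨s, hs.symm⟩
  have hdiff' : z - ν z = algebraMap F[X] L r * algebraMap A L η := by
    rw [map_mul, mul_assoc] at hdiff
    exact mul_left_cancel₀ hdL hdiff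
  refine ⟨algebraMap F A 2⁻¹ * (algebraMap F[X] A t + algebraMap F[X] A r * η), ?_⟩
  rw [map_mul, map_add, map_mul, ← IsScalarTower.algebraMap_apply,
    ← IsScalarTower.algebraMap_apply F[X], ← IsScalarTower.algebraMap_apply F[X], ← ht, ← hdiff',
    map_inv₀, map_ofNat]
  have h2L : (2 : L) ≠ 0 := by
    rw [← map_ofNat (algebraMap F L) 2]
    exact (_root_.map_ne_zero _).mpr h2
  rw [show z + ν z + (z - ν z) = 2 * z by ring, inv_mul_cancel_left₀ h2L]

theorem isDedekindDomain_coordinateRing (h2 : (2 : F) ≠ 0) :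
    IsDedekindDomain E.toAffine.CoordinateRing := by
  have := E.isIntegrallyClosed_coordinateRing h2
  have : IsNoetherianRing E.toAffine.CoordinateRing :=
    isNoetherianRing_iff.mpr (isNoetherian_of_tower F[X] inferInstance)
  have : Ring.DimensionLEOne E.toAffine.CoordinateRing :=
    Ring.DimensionLEOne.of_isIntegral F[X] _
  exact { }

end Dedekind
end WeierstrassCurve
end

/-! ### Places from valuation rings, and the maximal ideals of points. -/

noncomputable section

universe v

/-- The place of a valuation ring containing the base field. -/
theorem exists_fieldPlace {F : Type*} {L : Type v} [Field F] [Field L] [Algebra F L] (V : ValuationSubring L)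
    (hF : ∀ c : F, algebraMap F L c ∈ V) :
    ∃ (κ : Type v) (_ : Field κ) (_ : Algebra F κ) (p : FieldPlace F L κ),
      (∀ x, (∃ a, p.rel x a) ↔ x ∈ V) ∧ ∀ x, p.rel x 0 ↔ x ∈ V.nonunits := by
  let f : F →+* V := (algebraMap F L).codRestrict V.toSubring hF
  have h0 : ∀ x, (∃ h : x ∈ V, IsLocalRing.residue V ⟨x, h⟩ = 0) ↔ x ∈ V.nonunits := by
    intro x
    refine Iff.trans ?_ (Set.ext_iff.mp V.image_maximalIdeal x)
    simp only [IsLocalRing.residue_eq_zero_iff, Set.mem_image, Subtype.exists, SetLike.mem_coe]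
    constructor
    · rintro ⟨h, h'⟩
      exact ⟨x, h, h', rfl⟩
    · rintro ⟨y, h, h', rfl⟩
      exact ⟨h, h'⟩
  refine ⟨IsLocalRing.ResidueField ↥V, inferInstance, ((IsLocalRing.residue V).comp f).toAlgebra,
    @FieldPlace.mk F L (IsLocalRing.ResidueField ↥V) _ _ _ _ ((IsLocalRing.residue V).comp f).toAlgebra
    (fun x a => ∃ h : x ∈ V, IsLocalRing.residue V ⟨x, h⟩ = a) ?_ ?_ ?_ ?_ ?_, ?_, ?_⟩
  · rintro x y _ _ ⟨hx, rfl⟩ ⟨hy, rfl⟩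
    exact ⟨add_mem hx hy, map_add (IsLocalRing.residue V) ⟨x, hx⟩ ⟨y, hy⟩⟩
  · rintro x y _ _ ⟨hx, rfl⟩ ⟨hy, rfl⟩
    exact ⟨mul_mem hx hy, map_mul (IsLocalRing.residue V) ⟨x, hx⟩ ⟨y, hy⟩⟩
  · exact fun c => ⟨hF c, rfl⟩
  · rintro x _ _ ⟨h, rfl⟩ ⟨h', rfl⟩
    rfl
  · intro x
    rcases V.mem_or_inv_mem x with hx | hx
    · exact Or.inl ⟨_, hx, rfl⟩
    · by_cases hu : x⁻¹ ∈ V.nonunits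
      · exact Or.inr ((h0 _).mpr hu)
      · left
        rw [V.inv_mem_nonunits_iff] at hu
        push Not at hu
        refine ⟨_, ?_, rfl⟩
        by_cases hx0 : x = 0
        · rw [hx0]; exact zero_mem _
        · exact hu.2
  · intro x
    exact ⟨fun ⟨a, h, _⟩ => h, fun h => ⟨_, h, rfl⟩⟩
  · exact h0

namespace WeierstrassCurve

set_option linter.unusedSectionVars false

open scoped Classical
open Polynomial

section

variable {F : Type*} [Field F] [CharZero F] [IsAlgClosed F] (E : WeierstrassCurve F)

lemma exists_equation (c : F) : ∃ d, (E⁄F).toAffine.Equation c d := by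
  obtain ⟨s, hs⟩ := IsAlgClosed.exists_pow_nat_eq (aeval c E.Ψ₂Sq) two_pos
  refine ⟨(s - E.a₁ * c - E.a₃) / 2, ?_⟩
  rw [Affine.equation_iff]
  simp only [baseChange, map_a₁, map_a₂, map_a₃, map_a₄, map_a₆, Algebra.algebraMap_self,
    RingHom.id_apply]
  simp only [Ψ₂Sq, map_add, map_mul, map_pow, aeval_X, aeval_C, b₂, b₄, b₆, map_ofNat,
    Algebra.algebraMap_self, RingHom.id_apply] at hs
  linear_combination hs / 4

variable [E.IsElliptic]

/-- With `finite_two_torsion`, this provides the supply of constants that `map_add_of_generic` asks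
for. -/
instance infinite_point : Infinite (E⁄F).toAffine.Point := by
  choose d hd using E.exists_equation
  refine Infinite.of_injective (fun c => .some c (d c) (E.nonsingular_of_equation (hd c))) ?_
  intro c c' h
  simp only [Affine.Point.some.injEq] at h
  exact h.1

lemma finite_two_torsion : {C : (E⁄F).toAffine.Point | C + C = 0}.Finite := by
  have hf : E.Ψ₂Sq ≠ 0 := (E.separable_Ψ₂Sq two_ne_zero).ne_zero
  refine (((E.Ψ₂Sq.rootSet_finite F).image (fun c : F =>
    if h : (E⁄F).toAffine.Nonsingular c (-(E.a₁ * c + E.a₃) / 2) then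
      Affine.Point.some _ _ h else 0)).union (Set.finite_singleton 0)).subset ?_
  rintro (_ | ⟨c, d, h⟩) hC
  · exact Or.inr rfl
  · left
    rw [Set.mem_ofPred_eq, add_eq_zero_iff_eq_neg, Affine.Point.neg_some,
      Affine.Point.some.injEq] at hC
    have h1 : d = -d - E.a₁ * c - E.a₃ := hC.2
    have hd : d = -(E.a₁ * c + E.a₃) / 2 := by
      field_simp
      linear_combination h1
    refine ⟨c, ?_, ?_⟩
    · rw [mem_rootSet]
      refine ⟨hf, ?_⟩
      rw [E.aeval_Ψ₂Sq_coordinateRing h.1]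
      simp only [Algebra.algebraMap_self, RingHom.id_apply]
      rw [hd]
      ring
    · subst hd
      simp only [dif_pos h]

/-- Specialization of points at a place over an algebraically closed field. -/
def spec {L κ : Type*} [Field L] [Field κ] [Algebra F L] [Algebra F κ] (p : FieldPlace F L κ) :
    (E⁄L).toAffine.Point →+ (E⁄κ).toAffine.Point :=
  E.spHom p E.finite_two_torsion

lemma spec_apply {L κ : Type*} [Field L] [Field κ] [Algebra F L] [Algebra F κ]
    (p : FieldPlace F L κ) (P : (E⁄L).toAffine.Point) : E.spec p P = E.sp p P := rfl

/-- Restriction along a translation of the function field moves the centre of a place; this is how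
places at an affine point produce places at every point. -/
lemma sp_comap {L L' κ : Type*} [Field L] [Field L'] [Field κ] [Algebra F L] [Algebra F L']
    [Algebra F κ] (p : FieldPlace F L κ) (φ : L' →ₐ[F] L) (P : (E⁄L').toAffine.Point) :
    E.sp (p.comap φ) P = E.sp p (Affine.Point.map (W' := E.toAffine) φ P) := by
  rcases P with _ | ⟨x, y, h⟩
  · rfl
  · rw [Affine.Point.map_some]
    by_cases hx : ∃ a, p.rel (φ x) a
    · obtain ⟨a, ha⟩ := hx
      obtain ⟨b, hb⟩ := exists_rel_Y ((E.toAffine.baseChange_equation (f := φ) φ.injective x y).mpr h.1) ha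
      rw [sp_some (p := p.comap φ) h ha hb, sp_some _ ha hb]
    · rw [sp_some_eq_zero (p := p.comap φ) h hx, sp_some_eq_zero _ hx]

variable {E}

/-- The evaluation of a function of the coordinate ring at an affine point. -/
abbrev evalPt {c d : F} (h : (E⁄F).toAffine.Equation c d) : E.toAffine.CoordinateRing →ₐ[F] F :=
  E.evalCoord c d h

lemma rel_toFF {L κ : Type*} [Field L] [Field κ] [Algebra F L] [Algebra F κ]
    {p : FieldPlace F L κ} (φ : E.toAffine.CoordinateRing →ₐ[F] L) {c d : F}
    (h : (E⁄F).toAffine.Equation c d) (hx : p.rel (φ E.xCoord) (algebraMap F κ c))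
    (hy : p.rel (φ E.yCoord) (algebraMap F κ d)) (a : E.toAffine.CoordinateRing) :
    p.rel (φ a) (algebraMap F κ (evalPt h a)) := by
  have hpol : ∀ q : F[X], p.rel (φ (aeval E.xCoord q))
      (algebraMap F κ (evalPt h (aeval E.xCoord q))) := by
    intro q
    induction q using Polynomial.induction_on' with
    | add q r hq hr => simpa only [map_add] using p.add hq hr
    | monomial n e =>
      rw [aeval_monomial, map_mul, map_mul, map_mul, map_pow, map_pow, map_pow, AlgHom.commutes,
        AlgHom.commutes, evalCoord_xCoord]
      exact p.mul (p.const e) (FieldPlace.pow hx n)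
  obtain ⟨q, r, rfl⟩ := exists_eq_add_mul a
  rw [map_add, map_add, map_add, map_mul, map_mul, map_mul]
  refine p.add (hpol q) (p.mul (hpol r) ?_)
  rw [evalCoord_yCoord]
  exact hy

end

section PointIdeal

variable {F : Type*} [Field F] {E : WeierstrassCurve F}

lemma evalPt_surjective {c d : F} (h : (E⁄F).toAffine.Equation c d) :
    Function.Surjective (E.evalCoord c d h) := fun e => ⟨algebraMap F _ e, AlgHom.commutes _ e⟩

lemma exists_mem_XYIdeal {c d : F} (h : (E⁄F).toAffine.Equation c d)
    (a : E.toAffine.CoordinateRing) : a - algebraMap F _ (E.evalCoord c d h a) ∈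
      Affine.CoordinateRing.XYIdeal E.toAffine c (C d) := by
  set I := Affine.CoordinateRing.XYIdeal E.toAffine c (C d)
  have hx : Ideal.Quotient.mk I E.xCoord = algebraMap F _ c := by
    refine (Ideal.Quotient.mk_eq_mk_iff_sub_mem (I := I) E.xCoord (algebraMap F _ c)).mpr ?_
    refine Ideal.subset_span (Or.inl ?_)
    rw [Affine.CoordinateRing.XClass, C_sub, map_sub]
    rfl
  have hy : Ideal.Quotient.mk I E.yCoord = algebraMap F _ d := by
    refine (Ideal.Quotient.mk_eq_mk_iff_sub_mem (I := I) E.yCoord (algebraMap F _ d)).mpr ?_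
    refine Ideal.subset_span (Or.inr ?_)
    rw [Set.mem_singleton_iff, Affine.CoordinateRing.YClass, map_sub]
    rfl
  have : (Ideal.Quotient.mkₐ F I) = (Algebra.ofId F _).comp (E.evalCoord c d h) := by
    apply coordinateRing_algHom_ext
    · rw [AlgHom.comp_apply, evalCoord_xCoord]; exact hx
    · rw [AlgHom.comp_apply, evalCoord_yCoord]; exact hy
  refine (Ideal.Quotient.mk_eq_mk_iff_sub_mem (I := I) a _).mp ?_
  exact DFunLike.congr_fun this a

/-- Identifies the prime of a point with `XYIdeal`, in terms of which the homomorphism `toClass` to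
the class group is given. -/
lemma ker_evalPt {c d : F} (h : (E⁄F).toAffine.Equation c d) :
    RingHom.ker (E.evalCoord c d h) = Affine.CoordinateRing.XYIdeal E.toAffine c (C d) := by
  apply le_antisymm
  · intro a ha
    have := exists_mem_XYIdeal h a
    rwa [(RingHom.mem_ker).mp ha, map_zero, sub_zero] at this
  · rw [Affine.CoordinateRing.XYIdeal, Ideal.span_le]
    rintro a (rfl | ha)
    · rw [SetLike.mem_coe, RingHom.mem_ker, Affine.CoordinateRing.XClass, C_sub, map_sub,
        map_sub]
      rw [sub_eq_zero]
      exact (evalCoord_xCoord h).trans (AlgHom.commutes (E.evalCoord c d h) c).symm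
    · rw [Set.mem_singleton_iff] at ha
      rw [ha, SetLike.mem_coe, RingHom.mem_ker, Affine.CoordinateRing.YClass, map_sub, map_sub,
        sub_eq_zero]
      exact (evalCoord_yCoord h).trans (AlgHom.commutes (E.evalCoord c d h) d).symm

lemma isMaximal_ker_evalPt {c d : F} (h : (E⁄F).toAffine.Equation c d) :
    (RingHom.ker (E.evalCoord c d h)).IsMaximal :=
  RingHom.ker_isMaximal_of_surjective _ (evalPt_surjective h)

lemma xCoord_sub_ne_zero (c : F) : E.xCoord - algebraMap F _ c ≠ 0 := by
  intro h
  have h3 : algebraMap F[X] E.toAffine.CoordinateRing (X - C c) = 0 := by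
    rw [algebraMap_polynomial, map_sub, aeval_C, aeval_X, h]
  exact X_sub_C_ne_zero c ((FaithfulSMul.algebraMap_injective F[X] E.toAffine.CoordinateRing)
    (h3.trans (map_zero _).symm))

lemma ker_evalPt_ne_bot {c d : F} (h : (E⁄F).toAffine.Equation c d) :
    RingHom.ker (E.evalCoord c d h) ≠ ⊥ := by
  intro h0
  have : E.xCoord - algebraMap F _ c ∈ RingHom.ker (E.evalCoord c d h) := by
    rw [RingHom.mem_ker, map_sub, evalCoord_xCoord, AlgHom.commutes]
    simp
  rw [h0, Ideal.mem_bot] at this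
  exact xCoord_sub_ne_zero c this

/-- The Nullstellensatz for the curve. The coordinate ring is integral over F[x], so it is not a
field and the map to a residue field is not injective; hence x and y have constant values there. -/
lemma exists_ker_evalPt_eq [IsAlgClosed F] [E.IsElliptic] (P : Ideal E.toAffine.CoordinateRing) [P.IsMaximal] :
    ∃ c d, ∃ h : (E⁄F).toAffine.Equation c d, P = RingHom.ker (E.evalCoord c d h) := by
  let := Ideal.Quotient.field P
  have hni : ¬ Function.Injective (Ideal.Quotient.mkₐ F P) := by
    intro hi
    have hP : P = ⊥ := by
      rw [← Ideal.mk_ker (I := P)]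
      exact (RingHom.injective_iff_ker_eq_bot _).mp hi
    subst hP
    have h1 : IsField E.toAffine.CoordinateRing := by
      rw [Ring.isField_iff_maximal_bot]
      infer_instance
    have h2 : IsField F[X] := isField_of_isIntegral_of_isField
      (S := E.toAffine.CoordinateRing) (FaithfulSMul.algebraMap_injective _ _) h1
    exact Polynomial.not_isField F h2
  obtain ⟨c, d, hc, hd⟩ := exists_algebraMap_of_not_injective _ hni
  have heq := equation_of_algHom (Ideal.Quotient.mkₐ F P)
  rw [← hc, ← hd] at heq
  have h := equation_of_algebraMap (L := E.toAffine.CoordinateRing ⧸ P) heq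
  refine ⟨c, d, h, ?_⟩
  have hc' : E.xCoord - algebraMap F _ c ∈ P := (Ideal.Quotient.mk_eq_mk_iff_sub_mem _ _).mp hc.symm
  have hd' : E.yCoord - algebraMap F _ d ∈ P := (Ideal.Quotient.mk_eq_mk_iff_sub_mem _ _).mp hd.symm
  refine ((isMaximal_ker_evalPt h).eq_of_le (Ideal.IsMaximal.ne_top ‹_›) ?_).symm
  rw [ker_evalPt, Affine.CoordinateRing.XYIdeal, Ideal.span_le]
  rintro a (rfl | ha)
  · rw [Affine.CoordinateRing.XClass, C_sub, map_sub]
    exact hc'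
  · rw [Set.mem_singleton_iff] at ha
    rw [ha, Affine.CoordinateRing.YClass, map_sub]
    exact hd'

end PointIdeal

end WeierstrassCurve
end

/-! ### Normalized valuations at all points, infinity included. -/

noncomputable section

open IsDedekindDomain in
/-- A normalized valuation centered at a prime of a Dedekind domain is the adic valuation. -/
theorem IsDedekindDomain.HeightOneSpectrum.eq_valuation {A L : Type*} [CommRing A]
    [IsDedekindDomain A] [Field L] [Algebra A L] [IsFractionRing A L] (v : HeightOneSpectrum A)
    (w : Valuation L (WithZero (Multiplicative ℤ))) (h1 : ∀ a, w (algebraMap A L a) ≤ 1)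
    (h2 : ∀ a, w (algebraMap A L a) < 1 ↔ a ∈ v.asIdeal) (hw : Function.Surjective w) :
    w = v.valuation L := by
  obtain ⟨π, hπ⟩ := v.valuation_exists_uniformizer' L
  change v.valuation L (algebraMap A L π) = _ at hπ
  have hπ0 : algebraMap A L π ≠ 0 := by
    intro h
    rw [h, map_zero] at hπ
    exact WithZero.exp_ne_zero hπ.symm
  have hlt : w (algebraMap A L π) < 1 := by
    rw [h2, ← v.valuation_lt_one_iff_mem (K := L)]
    change v.valuation L (algebraMap A L π) < 1
    rw [hπ]
    exact WithZero.exp_lt_exp.mpr (by norm_num : (-1 : ℤ) < 0)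
  -- A unit at v is a quotient of elements outside the prime, and w is 1 on these. So w is
  -- determined by its value at the uniformizer π.
  have hone : ∀ g : L, v.valuation L g = 1 → w g = 1 := by
    intro g hg
    obtain ⟨a, s, has⟩ := v.exists_primeCompl_mul_eq_of_integer g hg.le
    have hs : w (algebraMap A L s) = 1 :=
      (h1 _).antisymm (not_lt.mp fun h => s.2 ((h2 _).mp h))
    have ha : w (algebraMap A L a) = 1 := by
      refine (h1 _).antisymm (not_lt.mp fun h => ?_)
      have h3 := (v.valuation_lt_one_iff_mem (K := L) a).mpr ((h2 _).mp h)
      change v.valuation L (algebraMap A L a) < 1 at h3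
      rw [← has, map_mul, hg, one_mul] at h3
      exact s.2 ((v.valuation_lt_one_iff_mem (K := L) _).mp h3)
    rw [← has, map_mul, hs, mul_one] at ha
    exact ha
  have hpow : ∀ f : L, f ≠ 0 → ∃ m : ℤ, v.valuation L f = WithZero.exp m ∧
      w f = w (algebraMap A L π) ^ (-m) := by
    intro f hf
    have hf' : v.valuation L f ≠ 0 := (Valuation.ne_zero_iff _).mpr hf
    refine ⟨WithZero.log (v.valuation L f), (WithZero.exp_log hf').symm, ?_⟩
    set m := WithZero.log (v.valuation L f) with hm
    have h4 : v.valuation L (f * algebraMap A L π ^ m) = 1 := by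
      rw [map_mul, map_zpow₀, hπ, ← WithZero.exp_log hf', ← hm, ← WithZero.exp_zsmul,
        ← WithZero.exp_add]
      simp
    have h5 := hone _ h4
    rw [map_mul, map_zpow₀] at h5
    rw [zpow_neg]
    exact eq_inv_of_mul_eq_one_left h5
  have hπw0 : w (algebraMap A L π) ≠ 0 := (Valuation.ne_zero_iff _).mpr hπ0
  obtain ⟨e, he⟩ : ∃ e : ℤ, w (algebraMap A L π) = WithZero.exp e :=
    ⟨_, (WithZero.exp_log hπw0).symm⟩
  -- The nonzero values of w are the powers of exp e with e < 0; surjectivity makes e divide 1.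
  have he1 : e = -1 := by
    obtain ⟨f, hf⟩ := hw (WithZero.exp (-1))
    have hf0 : f ≠ 0 := by
      rintro rfl
      rw [map_zero] at hf
      exact WithZero.exp_ne_zero hf.symm
    obtain ⟨m, -, h6⟩ := hpow f hf0
    rw [hf, he, ← WithZero.exp_zsmul, WithZero.exp_inj, smul_eq_mul] at h6
    rw [he] at hlt
    have hlt' : e < 0 := WithZero.exp_lt_exp.mp hlt
    have : e ∣ 1 := ⟨m, by linarith⟩
    have := Int.isUnit_iff.mp (isUnit_of_dvd_one this)
    omega
  ext f
  by_cases hf : f = 0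
  · rw [hf, map_zero, map_zero]
  · obtain ⟨m, h7, h8⟩ := hpow f hf
    rw [h7, h8, he, he1, ← WithZero.exp_zsmul]
    simp

namespace WeierstrassCurve

set_option linter.unusedSectionVars false

open scoped Classical WithZero
open Polynomial IsDedekindDomain

universe u

variable {F : Type u} [Field F] [CharZero F] {E : WeierstrassCurve F} [E.IsElliptic]

instance : IsDedekindDomain E.toAffine.CoordinateRing :=
  E.isDedekindDomain_coordinateRing two_ne_zero

/-- The prime of the coordinate ring at an affine point. -/
def pointPrime {c d : F} (h : (E⁄F).toAffine.Equation c d) :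
    HeightOneSpectrum E.toAffine.CoordinateRing :=
  ⟨RingHom.ker (E.evalCoord c d h), (isMaximal_ker_evalPt h).isPrime, ker_evalPt_ne_bot h⟩

lemma mem_pointPrime {c d : F} (h : (E⁄F).toAffine.Equation c d) {a : E.toAffine.CoordinateRing} :
    a ∈ (pointPrime h).asIdeal ↔ E.evalCoord c d h a = 0 := RingHom.mem_ker

variable [IsAlgClosed F]

lemma exists_pointPrime_eq (v : HeightOneSpectrum E.toAffine.CoordinateRing) :
    ∃ c d, ∃ h : (E⁄F).toAffine.Equation c d, v = pointPrime h := by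
  have := v.isMaximal
  obtain ⟨c, d, h, hv⟩ := exists_ker_evalPt_eq v.asIdeal
  exact ⟨c, d, h, HeightOneSpectrum.ext hv⟩

lemma valuation_algebraMap_le_one (v : HeightOneSpectrum E.toAffine.CoordinateRing) (c : F) :
    v.valuation E.toAffine.FunctionField (algebraMap F _ c) ≤ 1 := by
  rw [IsScalarTower.algebraMap_apply F E.toAffine.CoordinateRing]
  exact v.valuation_le_one _

/-- Functions in the prime take the value 0 at the place of the adic valuation, so x and y take the
values c and d. This makes `spec` available at affine points. -/
lemma exists_place_pointPrime {c d : F} (h : (E⁄F).toAffine.Equation c d) :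
    ∃ (κ : Type u) (_ : Field κ) (_ : Algebra F κ) (p : FieldPlace F E.toAffine.FunctionField κ),
      (∀ x, (∃ a, p.rel x a) ↔ (pointPrime h).valuation E.toAffine.FunctionField x ≤ 1) ∧
      (∀ x, p.rel x 0 ↔ (pointPrime h).valuation E.toAffine.FunctionField x < 1) ∧
      E.spec p E.genericPt = E.constPt (.some c d (E.nonsingular_of_equation h)) := by
  set w := (pointPrime h).valuation E.toAffine.FunctionField
  obtain ⟨κ, _, _, p, h1, h2⟩ := exists_fieldPlace (F := F) w.valuationSubring
    (valuation_algebraMap_le_one _)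
  have h3 : ∀ x, p.rel x 0 ↔ w x < 1 := by
    intro x
    rw [h2, ValuationSubring.mem_nonunits_iff]
    exact w.isEquiv_valuation_valuationSubring.lt_one_iff_lt_one.symm
  refine ⟨κ, inferInstance, inferInstance, p, h1, h3, ?_⟩
  have hval : ∀ a, E.evalCoord c d h a = 0 → p.rel (E.toFF a) 0 := by
    intro a ha
    rw [h3]
    exact ((pointPrime h).valuation_lt_one_iff_mem _).mpr ((mem_pointPrime h).mpr ha)
  have hrel : ∀ a, p.rel (E.toFF a) (algebraMap F κ (E.evalCoord c d h a)) := by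
    intro a
    have h4 := p.add (hval (a - algebraMap F _ (E.evalCoord c d h a)) (by
      rw [map_sub, AlgHom.commutes]; exact sub_self _)) (p.const (E.evalCoord c d h a))
    rw [map_sub, AlgHom.commutes, sub_add_cancel, zero_add] at h4
    exact h4
  rw [spec_apply, genericPt_eq]
  have hx := hrel E.xCoord
  have hy := hrel E.yCoord
  rw [evalCoord_xCoord] at hx
  rw [evalCoord_yCoord] at hy
  exact sp_some _ hx hy

lemma translate_surjective (P : (E⁄F).toAffine.Point) : Function.Surjective (translate P) := by
  intro f
  refine ⟨translate (-P) f, ?_⟩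
  rw [translate_translate, add_neg_cancel, translate_zero]
  rfl

variable (E) in
lemma exists_base_equation : ∃ t : F × F, (E⁄F).toAffine.Equation t.1 t.2 :=
  ⟨(0, (E.exists_equation 0).choose), (E.exists_equation 0).choose_spec⟩

variable (E) in
/-- Some affine point of the curve. -/
def basePoint : (E⁄F).toAffine.Point :=
  .some _ _ (E.nonsingular_of_equation E.exists_base_equation.choose_spec)

/-- The normalized valuation of the function field at a point, as a translate of the one at the base
point. -/
def ptVal (Q : (E⁄F).toAffine.Point) : Valuation E.toAffine.FunctionField ℤᵐ⁰ :=
  -- The function f(· + Q - B) behaves at the base point B as f does at Q. In this form infinity,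
  -- which is no prime of the coordinate ring, is on the same footing as the other points.
  ((pointPrime E.exists_base_equation.choose_spec).valuation E.toAffine.FunctionField).comap
    (translate (Q - E.basePoint)).toRingHom

lemma ptVal_apply (Q : (E⁄F).toAffine.Point) (f : E.toAffine.FunctionField) :
    ptVal Q f = (pointPrime E.exists_base_equation.choose_spec).valuation E.toAffine.FunctionField
      (translate (Q - E.basePoint) f) := rfl

lemma ptVal_translate (Q T : (E⁄F).toAffine.Point) (f : E.toAffine.FunctionField) :
    ptVal Q (translate T f) = ptVal (Q + T) f := by
  rw [ptVal_apply, ptVal_apply, translate_translate, sub_add_eq_add_sub]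

lemma ptVal_surjective (Q : (E⁄F).toAffine.Point) : Function.Surjective (ptVal Q) :=
  ((pointPrime _).valuation_surjective E.toAffine.FunctionField).comp (translate_surjective _)

lemma ptVal_algebraMap_le_one (Q : (E⁄F).toAffine.Point) (c : F) :
    ptVal Q (algebraMap F _ c) ≤ 1 := by
  rw [ptVal_apply, AlgHom.commutes]
  exact valuation_algebraMap_le_one _ c

lemma ptVal_algebraMap (Q : (E⁄F).toAffine.Point) {c : F} (hc : c ≠ 0) :
    ptVal Q (algebraMap F _ c) = 1 := by
  refine (ptVal_algebraMap_le_one Q c).antisymm (not_lt.mp fun h => ?_)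
  have h1 := mul_lt_one_of_lt_of_le h (ptVal_algebraMap_le_one Q c⁻¹)
  rw [← map_mul, ← map_mul, mul_inv_cancel₀ hc, map_one, map_one] at h1
  exact lt_irrefl _ h1

/-- At the translated place the generic point specializes to B + (Q - B) = Q, where B is the base
point; this rests on the additivity of `spec`. -/
lemma exists_place_ptVal (Q : (E⁄F).toAffine.Point) :
    ∃ (κ : Type u) (_ : Field κ) (_ : Algebra F κ) (p : FieldPlace F E.toAffine.FunctionField κ),
      (∀ x, (∃ a, p.rel x a) ↔ ptVal Q x ≤ 1) ∧ (∀ x, p.rel x 0 ↔ ptVal Q x < 1) ∧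
      E.spec p E.genericPt = E.constPt Q := by
  obtain ⟨κ, _, _, p, h1, h2, h3⟩ :=
    exists_place_pointPrime (E := E) E.exists_base_equation.choose_spec
  refine ⟨κ, inferInstance, inferInstance, p.comap (translate (Q - E.basePoint)),
    fun x => h1 _, fun x => h2 _, ?_⟩
  rw [spec_apply, sp_comap, ← spec_apply, map_translate, map_add, h3, spec_apply, sp_constPt,
    ← map_add]
  congr 1
  exact add_sub_cancel _ _

section Affine

variable {c d : F} {h : (E⁄F).toAffine.Nonsingular c d}

lemma ptVal_some_aux (a : E.toAffine.CoordinateRing) : ptVal (.some c d h) (E.toFF a) ≤ 1 ∧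
    (ptVal (.some c d h) (E.toFF a) < 1 ↔ E.evalCoord c d h.1 a = 0) := by
  obtain ⟨κ, _, _, p, h1, h2, h3⟩ := exists_place_ptVal (E := E) (.some c d h)
  rw [spec_apply, genericPt_eq, Affine.Point.map_some] at h3
  obtain ⟨x, y, h', e, hx, hy⟩ := exists_of_sp_eq_some h3
  rw [Affine.Point.some.injEq] at e
  obtain ⟨rfl, rfl⟩ := e
  have hr := rel_toFF E.toFF h.1 hx hy a
  refine ⟨(h1 _).mp ⟨_, hr⟩, ?_⟩
  rw [← h2]
  constructor
  · intro h0
    have := p.unique hr h0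
    rwa [_root_.map_eq_zero] at this
  · intro h0
    rwa [evalPt, h0, map_zero] at hr

lemma ptVal_some_le_one (a : E.toAffine.CoordinateRing) : ptVal (.some c d h) (E.toFF a) ≤ 1 :=
  (ptVal_some_aux a).1

lemma ptVal_some_lt_one_iff (a : E.toAffine.CoordinateRing) :
    ptVal (.some c d h) (E.toFF a) < 1 ↔ E.evalCoord c d h.1 a = 0 :=
  (ptVal_some_aux a).2

/-- The translated valuation is normalized, and the place of `exists_place_ptVal` shows that its
centre is the prime of the point; `eq_valuation` then applies. -/
lemma ptVal_some : ptVal (.some c d h) = (pointPrime h.1).valuation E.toAffine.FunctionField :=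
  (pointPrime h.1).eq_valuation _ ptVal_some_le_one
    (fun a => (ptVal_some_lt_one_iff a).trans (mem_pointPrime h.1).symm) (ptVal_surjective _)

end Affine

/-- Every height-one prime comes from an affine point, so such a function is integral at all primes
of a Dedekind domain. -/
lemma mem_range_toFF {f : E.toAffine.FunctionField}
    (hf : ∀ Q : (E⁄F).toAffine.Point, Q ≠ 0 → ptVal Q f ≤ 1) : ∃ a, E.toFF a = f := by
  refine HeightOneSpectrum.mem_integers_of_valuation_le_one _ f ?_
  intro v
  obtain ⟨c, d, h, rfl⟩ := exists_pointPrime_eq v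
  have := hf (.some c d (E.nonsingular_of_equation h)) (Affine.Point.some_ne_zero _)
  rwa [ptVal_some] at this

/-- If x were finite at infinity, so would be y, and the generic point would specialize there to an
affine point instead of 0. -/
lemma one_lt_ptVal_zero_x : 1 < ptVal (0 : (E⁄F).toAffine.Point) (E.toFF E.xCoord) := by
  obtain ⟨κ, _, _, p, h1, h2, h3⟩ := exists_place_ptVal (E := E) 0
  rw [← not_le, ← h1]
  rintro ⟨a, ha⟩
  rw [spec_apply, genericPt_eq, map_zero] at h3
  obtain ⟨b, hb⟩ := exists_rel_Y (equation_of_algHom E.toFF) ha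
  rw [sp_some _ ha hb] at h3
  exact Affine.Point.some_ne_zero _ h3

end WeierstrassCurve
end

/-! ### Degrees of polar divisors and the valuation at infinity. -/

noncomputable section

namespace WeierstrassCurve

set_option linter.unusedSectionVars false

open scoped Classical WithZero nonZeroDivisors
open Polynomial IsDedekindDomain

universe u

section Degree

variable {F : Type u} [Field F] {E : WeierstrassCurve F}

/-- The degree of the polar divisor of a function in the coordinate ring. -/
def poleDegree (a : E.toAffine.CoordinateRing) : ℕ := (Algebra.norm F[X] a).natDegree

lemma poleDegree_mul {a b : E.toAffine.CoordinateRing} (ha : a ≠ 0) (hb : b ≠ 0) :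
    poleDegree (a * b) = poleDegree a + poleDegree b := by
  rw [poleDegree, map_mul, natDegree_mul (norm_ne_zero ha) (norm_ne_zero hb)]
  rfl

lemma poleDegree_polynomial (p : F[X]) :
    poleDegree (E := E) (algebraMap F[X] _ p) = 2 * p.natDegree := by
  rw [poleDegree, Algebra.norm_algebraMap_of_basis (Affine.CoordinateRing.basis E.toAffine),
    natDegree_pow, Fintype.card_fin]

lemma poleDegree_pow {a : E.toAffine.CoordinateRing} (n : ℕ) :
    poleDegree (a ^ n) = n * poleDegree a := by
  rw [poleDegree, map_pow, natDegree_pow]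
  rfl

lemma poleDegree_eq_zero_of_isUnit {a : E.toAffine.CoordinateRing} (ha : IsUnit a) :
    poleDegree a = 0 := by
  have := ha.map (Algebra.norm F[X])
  rw [poleDegree, natDegree_eq_zero_of_isUnit this]

lemma degree_norm_eq {p q : F[X]} :
    (Algebra.norm F[X] (aeval E.xCoord p + aeval E.xCoord q * E.yCoord)).degree =
      max (2 • p.degree) (2 • q.degree + 3) := by
  rw [← Affine.CoordinateRing.degree_norm_smul_basis (W' := E.toAffine), ← algebraMap_polynomial,
    ← algebraMap_polynomial, Algebra.smul_def, Algebra.smul_def, mul_one]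
  rfl

lemma exists_algebraMap_of_poleDegree_eq_zero {a : E.toAffine.CoordinateRing}
    (ha : poleDegree a = 0) : ∃ c : F, algebraMap F _ c = a := by
  by_cases ha0 : a = 0
  · exact ⟨0, by rw [map_zero, ha0]⟩
  obtain ⟨p, q, rfl⟩ := exists_eq_add_mul a
  have h1 := degree_norm_eq (E := E) (p := p) (q := q)
  rw [degree_eq_natDegree (norm_ne_zero ha0)] at h1
  change ((poleDegree _ : ℕ) : WithBot ℕ) = _ at h1
  rw [ha] at h1
  have hq : q = 0 := by
    by_contra hq
    rw [degree_eq_natDegree hq] at h1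
    have h2 : ((2 * q.natDegree + 3 : ℕ) : WithBot ℕ) ≤ ((0 : ℕ) : WithBot ℕ) := by
      rw [h1]
      refine le_trans (le_of_eq ?_) (le_max_right _ _)
      push_cast
      rw [nsmul_eq_mul]; norm_cast
    have := Nat.cast_le.mp h2
    omega
  subst hq
  have hp : p ≠ 0 := by
    rintro rfl
    simp at ha0
  rw [degree_eq_natDegree hp] at h1
  have h2 : ((2 * p.natDegree : ℕ) : WithBot ℕ) ≤ ((0 : ℕ) : WithBot ℕ) := by
    rw [h1]
    refine le_trans (le_of_eq ?_) (le_max_left _ _)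
    push_cast
    rw [nsmul_eq_mul]; norm_cast
  have h3 := Nat.cast_le.mp h2
  obtain ⟨c, rfl⟩ := natDegree_eq_zero.mp (show p.natDegree = 0 by omega)
  exact ⟨c, by simp⟩

lemma mul_negHom [E.IsElliptic] (a : E.toAffine.CoordinateRing) :
    a * E.negHom a = algebraMap F[X] _ (Algebra.norm F[X] a) := by
  obtain ⟨p, q, rfl⟩ := Affine.CoordinateRing.exists_smul_basis_eq a
  have h := Affine.CoordinateRing.coe_norm_smul_basis (W' := E.toAffine) p q
  refine Eq.trans ?_ h.symm
  rw [map_mul]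
  congr 1
  · rw [map_add, map_mul, Algebra.smul_def, Algebra.smul_def, mul_one]
    rfl
  · rw [map_add, Algebra.smul_def, Algebra.smul_def, mul_one, map_mul, negHom_algebraMap,
      negHom_algebraMap]
    have hy := E.negHom_yCoord
    rw [yCoord] at hy
    rw [hy]
    simp only [map_add, map_mul, map_sub, map_neg]
    have e : ∀ a : F, algebraMap F E.toAffine.CoordinateRing a =
      Affine.CoordinateRing.mk E.toAffine (C (C a)) := fun a => rfl
    have e' : ∀ a : F[X], algebraMap F[X] E.toAffine.CoordinateRing a =
      Affine.CoordinateRing.mk E.toAffine (C a) := fun a => rfl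
    simp only [e, e', xCoord]
    ring

instance finiteDimensional_quotient_span {a : E.toAffine.CoordinateRing} [ha : NeZero a] :
    FiniteDimensional F (E.toAffine.CoordinateRing ⧸ Ideal.span {a}) := by
  have h : Ideal.span {a} ≠ ⊥ := by
    rw [Ne, Ideal.span_singleton_eq_bot]
    exact ha.out
  exact Module.Finite.equiv (Ideal.quotientEquivDirectSum F
    (Affine.CoordinateRing.basis E.toAffine) h).symm

variable [E.IsElliptic]

/-- Evaluation of functions of the coordinate ring at a point, with value `0` at infinity. -/
def evalAt : (E⁄F).toAffine.Point → E.toAffine.CoordinateRing →ₗ[F] F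
  | 0 => 0
  | .some c d h => (E.evalCoord c d h.1).toLinearMap

lemma evalAt_some {c d : F} {h : (E⁄F).toAffine.Nonsingular c d} (a : E.toAffine.CoordinateRing) :
    evalAt (.some c d h) a = E.evalCoord c d h.1 a := rfl

lemma evalAt_mul (Q : (E⁄F).toAffine.Point) (a b : E.toAffine.CoordinateRing) :
    evalAt Q (a * b) = evalAt Q a * evalAt Q b := by
  rcases Q with _ | ⟨c, d, h⟩
  · exact (mul_zero _).symm
  · exact map_mul (E.evalCoord c d h.1) a b

/-- A nonzero function of the coordinate ring has at most as many zeros as poles. -/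
lemma card_le_poleDegree {a : E.toAffine.CoordinateRing} (ha : a ≠ 0)
    (S : Finset (E⁄F).toAffine.Point) (hS : ∀ Q ∈ S, Q ≠ 0 ∧ evalAt Q a = 0) :
    S.card ≤ poleDegree a := by
  have : NeZero a := ⟨ha⟩
  let f : E.toAffine.CoordinateRing →ₗ[F] (S → F) := LinearMap.pi fun Q => evalAt (Q : _)
  -- Linear functions of x or y separate two points. Their products are delta functions on S, so
  -- evaluation on S is surjective.
  have hsep : ∀ Q R : (E⁄F).toAffine.Point, Q ≠ 0 → R ≠ 0 → Q ≠ R →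
      ∃ b, evalAt Q b = 1 ∧ evalAt R b = 0 := by
    rintro (_ | ⟨c, d, h⟩) (_ | ⟨c', d', h'⟩) h0 h0' hne
    · exact absurd rfl h0
    · exact absurd rfl h0
    · exact absurd rfl h0'
    by_cases hc : c = c'
    · subst hc
      have hd : d - d' ≠ 0 := by
        intro hd
        rw [sub_eq_zero] at hd
        subst hd
        exact hne rfl
      refine ⟨algebraMap F _ (d - d')⁻¹ * (E.yCoord - algebraMap F _ d'), ?_, ?_⟩
      · rw [evalAt_some, map_mul, map_sub, AlgHom.commutes, AlgHom.commutes, evalCoord_yCoord]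
        exact inv_mul_cancel₀ hd
      · rw [evalAt_some, map_mul, map_sub, AlgHom.commutes, AlgHom.commutes, evalCoord_yCoord]
        simp
    · refine ⟨algebraMap F _ (c - c')⁻¹ * (E.xCoord - algebraMap F _ c'), ?_, ?_⟩
      · rw [evalAt_some, map_mul, map_sub, AlgHom.commutes, AlgHom.commutes, evalCoord_xCoord]
        exact inv_mul_cancel₀ (sub_ne_zero.mpr hc)
      · rw [evalAt_some, map_mul, map_sub, AlgHom.commutes, AlgHom.commutes, evalCoord_xCoord]
        simp
  have hone : ∀ Q : (E⁄F).toAffine.Point, Q ≠ 0 → evalAt Q (1 : E.toAffine.CoordinateRing) = 1 := by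
    rintro (_ | ⟨c, d, h⟩) h0
    · exact absurd rfl h0
    · exact map_one (E.evalCoord c d h.1)
  have hprod : ∀ Q : (E⁄F).toAffine.Point, Q ≠ 0 → ∀ T : Finset (E⁄F).toAffine.Point,
      (∀ R ∈ T, R ≠ 0 ∧ R ≠ Q) →
      ∃ b : E.toAffine.CoordinateRing, evalAt Q b = 1 ∧ ∀ R ∈ T, evalAt R b = 0 := by
    intro Q hQ T
    induction T using Finset.induction_on with
    | empty => exact fun _ => ⟨1, hone Q hQ, by simp⟩
    | insert R T _ ih =>
      intro hT
      obtain ⟨b, hb, hb'⟩ := ih fun R hR => hT R (Finset.mem_insert_of_mem hR)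
      obtain ⟨h1, h2⟩ := hT R (Finset.mem_insert_self R T)
      obtain ⟨b', h3, h4⟩ := hsep Q R hQ h1 h2.symm
      refine ⟨b' * b, by rw [evalAt_mul, hb, h3, one_mul], fun R' hR' => ?_⟩
      rw [evalAt_mul]
      rcases Finset.mem_insert.mp hR' with rfl | h5
      · rw [h4, zero_mul]
      · rw [hb' _ h5, mul_zero]
  have hf : Function.Surjective f := by
    rw [← LinearMap.range_eq_top, eq_top_iff, ← (Pi.basisFun F S).span_eq, Submodule.span_le]
    rintro _ ⟨Q, rfl⟩
    obtain ⟨b, hb, hb'⟩ := hprod Q (hS Q Q.2).1 (S.erase Q) fun R hR =>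
      ⟨(hS R (Finset.mem_of_mem_erase hR)).1, Finset.ne_of_mem_erase hR⟩
    refine ⟨b, funext fun R => ?_⟩
    rw [Pi.basisFun_apply, LinearMap.pi_apply]
    by_cases hRQ : R = Q
    · rw [hRQ, Pi.single_eq_same, hb]
    · rw [Pi.single_eq_of_ne hRQ]
      exact hb' R (Finset.mem_erase.mpr ⟨fun h => hRQ (Subtype.ext h), R.2⟩)
  have hker : (Ideal.span {a}).restrictScalars F ≤ LinearMap.ker f := by
    intro b hb
    obtain ⟨b', rfl⟩ := Ideal.mem_span_singleton.mp hb
    rw [LinearMap.mem_ker]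
    funext Q
    rw [LinearMap.pi_apply, evalAt_mul, (hS Q Q.2).2, zero_mul]
    rfl
  have hf' : Function.Surjective (((Ideal.span {a}).restrictScalars F).liftQ f hker) := by
    intro v
    obtain ⟨b, rfl⟩ := hf v
    exact ⟨Submodule.Quotient.mk b, rfl⟩
  have : Module.Finite F (E.toAffine.CoordinateRing ⧸ (Ideal.span {a}).restrictScalars F) :=
    finiteDimensional_quotient_span (a := a)
  -- Evaluation on S factors through the quotient by a, whose dimension is the degree of the norm of
  -- a.
  have h6 := LinearMap.finrank_le_finrank_of_surjective hf'
  rw [Module.finrank_fintype_fun_eq_card, Fintype.card_coe] at h6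
  refine h6.trans (le_of_eq ?_)
  exact finrank_quotient_span_eq_natDegree_norm (Affine.CoordinateRing.basis E.toAffine) ha

end Degree

section Infinity

variable {F : Type u} [Field F] [CharZero F] [IsAlgClosed F] {E : WeierstrassCurve F} [E.IsElliptic]

instance (Q : (E⁄F).toAffine.Point) : (ptVal Q).IsTrivialOn F := ⟨fun _ h => ptVal_algebraMap Q h⟩

lemma ptVal_lt_one_iff {Q : (E⁄F).toAffine.Point} (hQ : Q ≠ 0) (a : E.toAffine.CoordinateRing) :
    ptVal Q (E.toFF a) < 1 ↔ evalAt Q a = 0 := by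
  rcases Q with _ | ⟨c, d, h⟩
  · exact absurd rfl hQ
  · exact ptVal_some_lt_one_iff a

/-- Since x has a pole at infinity, y² and x³ dominate the two sides of the Weierstrass equation
there. -/
lemma ptVal_zero_y_sq : ptVal (0 : (E⁄F).toAffine.Point) (E.toFF E.yCoord) ^ 2 =
    ptVal (0 : (E⁄F).toAffine.Point) (E.toFF E.xCoord) ^ 3 := by
  set v := ptVal (0 : (E⁄F).toAffine.Point)
  set x := E.toFF E.xCoord
  set y := E.toFF E.yCoord
  have hx : 1 < v x := one_lt_ptVal_zero_x
  have hc : ∀ c : F, v (algebraMap F _ c) ≤ 1 := ptVal_algebraMap_le_one 0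
  have hx0 : 0 < v x := zero_lt_one.trans hx
  have heq := congrArg E.toFF E.yCoord_sq
  simp only [map_add, map_mul, map_pow, AlgHom.commutes] at heq
  have hlt : ∀ {m n : ℕ}, m < n → v x ^ m < v x ^ n := fun h => pow_lt_pow_right₀ hx h
  have hR : v (x ^ 3 + algebraMap F _ E.a₂ * x ^ 2 + algebraMap F _ E.a₄ * x +
      algebraMap F _ E.a₆) = v x ^ 3 := by
    rw [add_assoc, add_assoc]
    refine (Valuation.map_add_eq_of_lt_left v ?_).trans (map_pow v x 3)
    rw [map_pow v]
    refine Valuation.map_add_lt _ ?_ (Valuation.map_add_lt _ ?_ ?_)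
    · rw [map_mul, map_pow]
      exact (mul_le_of_le_one_left' (hc _)).trans_lt (hlt (by norm_num))
    · rw [map_mul]
      refine (mul_le_of_le_one_left' (hc _)).trans_lt ?_
      simpa using hlt (show 1 < 3 by norm_num)
    · refine (hc _).trans_lt ?_
      simpa using hlt (show 0 < 3 by norm_num)
  have hy : v x < v y := by
    by_contra! hy
    have h1 : v (y ^ 2 + algebraMap F _ E.a₁ * x * y + algebraMap F _ E.a₃ * y) ≤ v x ^ 2 := by
      refine Valuation.map_add_le _ (Valuation.map_add_le _ ?_ ?_) ?_
      · rw [map_pow]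
        exact pow_le_pow_left₀ zero_le hy 2
      · rw [map_mul, map_mul, sq]
        exact mul_le_mul' (mul_le_of_le_one_left' (hc _)) hy
      · rw [map_mul]
        refine (mul_le_of_le_one_left' (hc _)).trans (hy.trans ?_)
        simpa using (hlt (show 1 < 2 by norm_num)).le
    rw [heq, hR] at h1
    exact absurd h1 (not_le.mpr (hlt (by norm_num)))
  have hy1 : 1 < v y := hx.trans hy
  have hL : v (y ^ 2 + algebraMap F _ E.a₁ * x * y + algebraMap F _ E.a₃ * y) = v y ^ 2 := by
    rw [add_assoc]
    refine (Valuation.map_add_eq_of_lt_left v ?_).trans (map_pow v y 2)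
    rw [map_pow v]
    refine Valuation.map_add_lt _ ?_ ?_
    · rw [map_mul, map_mul, sq]
      exact (mul_le_mul_left (mul_le_of_le_one_left' (hc _)) _).trans_lt
        (mul_lt_mul_of_pos_right hy (zero_lt_one.trans hy1))
    · rw [map_mul]
      refine (mul_le_of_le_one_left' (hc _)).trans_lt ?_
      simpa using pow_lt_pow_right₀ hy1 (show 1 < 2 by norm_num)
  rw [← hL, heq, hR]

/-- The poles of x and y have orders 2e and 3e. In p(x) + q(x)y the two terms have pole orders e
times an even and e times an odd number, so they do not cancel and the pole order is e times the
degree of the norm. Normalization gives e = 1. -/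
theorem ptVal_zero {a : E.toAffine.CoordinateRing} (ha : a ≠ 0) :
    ptVal (0 : (E⁄F).toAffine.Point) (E.toFF a) = WithZero.exp (poleDegree a : ℤ) := by
  set v := ptVal (0 : (E⁄F).toAffine.Point) with hv
  have hx : 1 < v (E.toFF E.xCoord) := one_lt_ptVal_zero_x
  have hsq : v (E.toFF E.yCoord) ^ 2 = v (E.toFF E.xCoord) ^ 3 := ptVal_zero_y_sq
  obtain ⟨m, hm⟩ : ∃ m : ℤ, v (E.toFF E.xCoord) = WithZero.exp m :=
    ⟨_, (WithZero.exp_log (zero_lt_one.trans hx).ne').symm⟩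
  have hy0 : v (E.toFF E.yCoord) ≠ 0 := by
    intro h
    rw [h, hm, ← WithZero.exp_nsmul] at hsq
    exact WithZero.exp_ne_zero (hsq.symm.trans (zero_pow two_ne_zero))
  obtain ⟨l, hl⟩ : ∃ l : ℤ, v (E.toFF E.yCoord) = WithZero.exp l :=
    ⟨_, (WithZero.exp_log hy0).symm⟩
  rw [hm, hl, ← WithZero.exp_nsmul, ← WithZero.exp_nsmul, WithZero.exp_inj] at hsq
  rw [hm, ← WithZero.exp_zero, WithZero.exp_lt_exp] at hx
  obtain ⟨e, rfl, rfl, he⟩ : ∃ e : ℤ, m = 2 * e ∧ l = 3 * e ∧ 0 < e := by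
    simp only [nsmul_eq_mul, Nat.cast_ofNat] at hsq
    exact ⟨l - m, by omega, by omega, by omega⟩
  have hpoly : ∀ p : F[X], p ≠ 0 → v (E.toFF (aeval E.xCoord p)) =
      WithZero.exp (e * (2 * p.natDegree : ℕ)) := by
    intro p hp
    have h1 : 1 < v (E.toFF E.xCoord) := one_lt_ptVal_zero_x
    rw [← aeval_algHom_apply,
      Polynomial.valuation_aeval_eq_valuation_X_pow_natDegree_of_one_lt_valuation_X _ h1 hp, hm,
      ← WithZero.exp_nsmul, WithZero.exp_inj]
    push_cast
    simp only [nsmul_eq_mul]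
    ring
  have key : ∀ b : E.toAffine.CoordinateRing, b ≠ 0 →
      v (E.toFF b) = WithZero.exp (e * (poleDegree b : ℕ)) := by
    intro b hb
    have hN := norm_ne_zero hb
    obtain ⟨p, q, rfl⟩ := exists_eq_add_mul b
    have hdeg : ((poleDegree (aeval E.xCoord p + aeval E.xCoord q * E.yCoord) : ℕ) : WithBot ℕ) =
        max (2 • p.degree) (2 • q.degree + 3) := by
      rw [← degree_norm_eq (E := E), degree_eq_natDegree hN]
      rfl
    by_cases hq : q = 0
    · subst hq
      have hp : p ≠ 0 := by
        rintro rfl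
        simp at hb
      rw [map_zero, zero_mul, add_zero, hpoly p hp, ← algebraMap_polynomial (E := E),
        poleDegree_polynomial]
    have hqy : v (E.toFF (aeval E.xCoord q * E.yCoord)) =
        WithZero.exp (e * (2 * q.natDegree + 3 : ℕ)) := by
      rw [map_mul, map_mul, hpoly q hq, hl, ← WithZero.exp_add, WithZero.exp_inj]
      push_cast
      ring
    by_cases hp : p = 0
    · subst hp
      rw [degree_zero, degree_eq_natDegree hq] at hdeg
      have h2 : poleDegree (aeval E.xCoord (0 : F[X]) + aeval E.xCoord q * E.yCoord) =
          2 * q.natDegree + 3 := by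
        have h3 : ((2 * q.natDegree + 3 : ℕ) : WithBot ℕ) =
            max (2 • (⊥ : WithBot ℕ)) (2 • (q.natDegree : WithBot ℕ) + 3) := by
          rw [max_eq_right (by exact bot_le)]
          push_cast
          rw [nsmul_eq_mul]; norm_cast
        exact WithBot.coe_injective (hdeg.trans h3.symm)
      rw [h2, map_zero, zero_add, hqy]
    rw [degree_eq_natDegree hp, degree_eq_natDegree hq] at hdeg
    have h2 : poleDegree (aeval E.xCoord p + aeval E.xCoord q * E.yCoord) =
        max (2 * p.natDegree) (2 * q.natDegree + 3) := by
      refine WithBot.coe_injective (hdeg.trans ?_)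
      rw [nsmul_eq_mul, nsmul_eq_mul]
      rfl
    rw [h2, map_add, Valuation.map_add_of_distinct_val, hpoly p hp, hqy]
    · rcases le_total (2 * p.natDegree) (2 * q.natDegree + 3) with h | h
      · rw [max_eq_right h, max_eq_right]
        exact WithZero.exp_le_exp.mpr (mul_le_mul_of_nonneg_left (by exact_mod_cast h) he.le)
      · rw [max_eq_left h, max_eq_left]
        exact WithZero.exp_le_exp.mpr (mul_le_mul_of_nonneg_left (by exact_mod_cast h) he.le)
    · rw [hpoly p hp, hqy, Ne, WithZero.exp_inj]
      intro h
      have := mul_left_cancel₀ he.ne' h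
      omega
  have he1 : e = 1 := by
    obtain ⟨f, hf⟩ := ptVal_surjective (0 : (E⁄F).toAffine.Point) (WithZero.exp 1)
    obtain ⟨b, s, hs, rfl⟩ := IsFractionRing.div_surjective (A := E.toAffine.CoordinateRing) f
    have hb : b ≠ 0 := by
      rintro rfl
      rw [map_zero, zero_div, map_zero] at hf
      exact WithZero.exp_ne_zero hf.symm
    have hs0 : s ≠ 0 := nonZeroDivisors.ne_zero hs
    rw [map_div₀] at hf
    have h1 := key b hb
    have h2 := key s hs0
    change v (algebraMap _ _ b) = _ at h1
    change v (algebraMap _ _ s) = _ at h2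
    rw [← hv, h1, h2, ← WithZero.exp_sub, WithZero.exp_inj, ← mul_sub] at hf
    have : e ∣ 1 := ⟨_, hf.symm⟩
    have := Int.isUnit_iff.mp (isUnit_of_dvd_one this)
    omega
  rw [key a ha, he1, one_mul]

end Infinity

end WeierstrassCurve
end

/-! ### Functions with divisor n(-T) - n(0). -/

noncomputable section

namespace WeierstrassCurve

set_option linter.unusedSectionVars false

open scoped Classical WithZero nonZeroDivisors
open Polynomial IsDedekindDomain

universe u

section Ideal

variable {F : Type u} [Field F] {E : WeierstrassCurve F} [E.IsElliptic]

lemma map_negHom_XYIdeal_le (c d : F) :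
    (Affine.CoordinateRing.XYIdeal E.toAffine c (C d)).map E.negHom ≤
      Affine.CoordinateRing.XYIdeal E.toAffine c (C (E.toAffine.negY c d)) := by
  rw [Affine.CoordinateRing.XYIdeal, Ideal.map_span, Ideal.span_le]
  have hX : ∀ c : F, Affine.CoordinateRing.XClass E.toAffine c = E.xCoord - algebraMap F _ c := by
    intro c
    rw [Affine.CoordinateRing.XClass, C_sub, map_sub]
    rfl
  have hY : ∀ d : F, Affine.CoordinateRing.YClass E.toAffine (C d) =
      E.yCoord - algebraMap F _ d := by
    intro d
    rw [Affine.CoordinateRing.YClass, map_sub]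
    rfl
  have hXm : E.xCoord - algebraMap F _ c ∈
      Affine.CoordinateRing.XYIdeal E.toAffine c (C (E.toAffine.negY c d)) := by
    rw [← hX]
    exact Ideal.subset_span (Or.inl rfl)
  have hYm : E.yCoord - algebraMap F _ (E.toAffine.negY c d) ∈
      Affine.CoordinateRing.XYIdeal E.toAffine c (C (E.toAffine.negY c d)) := by
    rw [← hY]
    exact Ideal.subset_span (Or.inr rfl)
  rintro _ ⟨a, ha | ha, rfl⟩
  · rw [ha, hX, SetLike.mem_coe, map_sub, AlgHom.commutes, negHom_xCoord]
    exact hXm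
  · rw [Set.mem_singleton_iff] at ha
    rw [ha, hY, SetLike.mem_coe, map_sub, AlgHom.commutes, negHom_yCoord]
    have : -E.yCoord - algebraMap F _ E.a₁ * E.xCoord - algebraMap F _ E.a₃ - algebraMap F _ d =
        -(E.yCoord - algebraMap F _ (E.toAffine.negY c d)) +
          (-algebraMap F _ E.a₁) * (E.xCoord - algebraMap F _ c) := by
      rw [Affine.negY]
      simp only [toAffine, map_sub, map_neg, map_mul]
      ring
    rw [this]
    exact add_mem (neg_mem hYm) (Ideal.mul_mem_left _ _ hXm)

lemma map_negHom_XYIdeal (c d : F) :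
    (Affine.CoordinateRing.XYIdeal E.toAffine c (C d)).map E.negHom =
      Affine.CoordinateRing.XYIdeal E.toAffine c (C (E.toAffine.negY c d)) := by
  refine (map_negHom_XYIdeal_le c d).antisymm ?_
  have h := Ideal.map_mono (f := E.negHom) (map_negHom_XYIdeal_le c (E.toAffine.negY c d))
  rw [Affine.negY_negY, Ideal.map_mapₐ] at h
  have h2 : E.negHom.comp E.negHom = AlgHom.id F _ := AlgHom.ext negHom_negHom
  rw [h2] at h
  exact le_trans (Ideal.map_id _).ge h

/-- The product of the n-th power of the prime of (c, d) with its conjugate is generated both by (x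
- c)ⁿ and by the norm of a; the degrees are then compared. -/
lemma poleDegree_of_span_eq {c d : F} (h : E.toAffine.Nonsingular c d) {n : ℕ}
    {a : E.toAffine.CoordinateRing} (ha0 : a ≠ 0)
    (ha : Affine.CoordinateRing.XYIdeal E.toAffine c (C d) ^ n = Ideal.span {a}) :
    poleDegree a = n := by
  have h1 : Ideal.span {E.negHom a} =
      Affine.CoordinateRing.XYIdeal E.toAffine c (C (E.toAffine.negY c d)) ^ n := by
    rw [← Set.image_singleton, ← Ideal.map_span, ← ha, Ideal.map_pow, map_negHom_XYIdeal]
  have h2 : Ideal.span {algebraMap F[X] E.toAffine.CoordinateRing (Algebra.norm F[X] a)} =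
      Ideal.span {Affine.CoordinateRing.XClass E.toAffine c ^ n} := by
    rw [← mul_negHom, ← Ideal.span_singleton_mul_span_singleton, mul_comm,
      ← Ideal.span_singleton_pow, h1, ← ha, ← mul_pow, Affine.CoordinateRing.XYIdeal_neg_mul h]
    rfl
  obtain ⟨u, hu⟩ := Ideal.span_singleton_eq_span_singleton.mp h2
  have h3 : Affine.CoordinateRing.XClass E.toAffine c =
      algebraMap F[X] E.toAffine.CoordinateRing (X - C c) := rfl
  have hN0 : algebraMap F[X] E.toAffine.CoordinateRing (Algebra.norm F[X] a) ≠ 0 := by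
    rw [Ne, FaithfulSMul.algebraMap_eq_zero_iff]
    exact norm_ne_zero ha0
  have h4 := congrArg poleDegree hu
  rw [poleDegree_mul hN0 u.ne_zero, poleDegree_eq_zero_of_isUnit u.isUnit,
    poleDegree_pow, h3, poleDegree_polynomial, poleDegree_polynomial, natDegree_X_sub_C] at h4
  change 2 * poleDegree a + 0 = _ at h4
  omega

end Ideal

variable {F : Type u} [Field F] [CharZero F] [IsAlgClosed F] {E : WeierstrassCurve F} [E.IsElliptic]

/-- Both f and f⁻¹ lie in the coordinate ring, so f is a unit there. Units have pole degree 0, hence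
are constants. -/
lemma exists_algebraMap_of_ptVal_eq_one {f : E.toAffine.FunctionField}
    (hf : ∀ Q : (E⁄F).toAffine.Point, Q ≠ 0 → ptVal Q f = 1) :
    ∃ c : F, c ≠ 0 ∧ algebraMap F _ c = f := by
  obtain ⟨a, ha⟩ := mem_range_toFF fun Q hQ => (hf Q hQ).le
  obtain ⟨b, hb⟩ := mem_range_toFF (f := f⁻¹) fun Q hQ => by rw [map_inv₀, hf Q hQ, inv_one]
  have hf0 : f ≠ 0 := by
    rintro rfl
    have := hf E.basePoint (Affine.Point.some_ne_zero _)
    rw [map_zero] at this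
    exact zero_ne_one this
  have hab : a * b = 1 := by
    apply IsFractionRing.injective E.toAffine.CoordinateRing E.toAffine.FunctionField
    have : E.toFF (a * b) = E.toFF 1 := by
      rw [map_mul, ha, hb, mul_inv_cancel₀ hf0, map_one]
    exact this
  obtain ⟨c, rfl⟩ := exists_algebraMap_of_poleDegree_eq_zero
    (poleDegree_eq_zero_of_isUnit (IsUnit.of_mul_eq_one _ hab))
  rw [AlgHom.commutes] at ha
  refine ⟨c, ?_, ha⟩
  rintro rfl
  rw [map_zero] at ha
  exact hf0 ha.symm

/-- The weight at infinity that defines the Riemann–Roch space of `n` times the origin. -/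
def infWeight (n : ℕ) (Q : (E⁄F).toAffine.Point) : ℤᵐ⁰ :=
  if Q = 0 then WithZero.exp (-(n : ℤ)) else 1

lemma infWeight_ne_zero (n : ℕ) (Q : (E⁄F).toAffine.Point) : infWeight n Q ≠ 0 := by
  rw [infWeight]
  split_ifs
  · exact WithZero.exp_ne_zero
  · exact one_ne_zero

lemma infWeight_of_ne (n : ℕ) {Q : (E⁄F).toAffine.Point} (hQ : Q ≠ 0) : infWeight n Q = 1 :=
  if_neg hQ

lemma infWeight_zero (n : ℕ) :
    infWeight n (0 : (E⁄F).toAffine.Point) = WithZero.exp (-(n : ℤ)) := if_pos rfl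

lemma pointPrime_asIdeal_le {c d c' d' : F} {h : (E⁄F).toAffine.Equation c d}
    {h' : (E⁄F).toAffine.Equation c' d'} (hle : (pointPrime h).asIdeal ≤ (pointPrime h').asIdeal) :
    c = c' ∧ d = d' := by
  have hx : E.xCoord - algebraMap F _ c ∈ (pointPrime h').asIdeal := hle (by
    rw [mem_pointPrime, map_sub, AlgHom.commutes, evalCoord_xCoord]; exact sub_self c)
  have hy : E.yCoord - algebraMap F _ d ∈ (pointPrime h').asIdeal := hle (by
    rw [mem_pointPrime, map_sub, AlgHom.commutes, evalCoord_yCoord]; exact sub_self d)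
  rw [mem_pointPrime, map_sub, AlgHom.commutes, evalCoord_xCoord, sub_eq_zero] at hx
  rw [mem_pointPrime, map_sub, AlgHom.commutes, evalCoord_yCoord, sub_eq_zero] at hy
  exact ⟨hx.symm, hy.symm⟩

/-- Since `toClass` is a homomorphism, the n-th power of the prime of an n-torsion point has trivial
class. -/
lemma exists_span_eq_pow {c d : F} {h : (E⁄F).toAffine.Nonsingular c d} {n : ℕ}
    (hn : n • (Affine.Point.some c d h : (E⁄F).toAffine.Point) = 0) :
    ∃ a : E.toAffine.CoordinateRing, a ≠ 0 ∧ (pointPrime h.1).asIdeal ^ n = Ideal.span {a} := by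
  have hI : (pointPrime h.1).asIdeal = Affine.CoordinateRing.XYIdeal E.toAffine c (C d) :=
    ker_evalPt h.1
  rw [hI]
  let P : E.toAffine.Point := Affine.Point.some (W' := E.toAffine) c d h
  have h1 : n • P = 0 := hn
  have h2 : n • Affine.Point.toClass P = 0 := by
    rw [← map_nsmul, h1, map_zero]
  have h' : E.toAffine.Nonsingular c d := h
  have h3 : ClassGroup.mk E.toAffine.FunctionField
      (Affine.CoordinateRing.XYIdeal' (W := E.toAffine) h' ^ n) = 1 := by
    rw [map_pow]
    exact h2
  refine (ClassGroup.mk_eq_one_of_coe_ideal ?_).mp h3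
  rw [Units.val_pow_eq_pow_val, Affine.CoordinateRing.XYIdeal'_eq, FractionalIdeal.coeIdeal_pow]

/-- The function with divisor `n (-T) - n (0)` for an `n`-torsion point `T`. -/
theorem exists_divisor_torsion {n : ℕ} {T : (E⁄F).toAffine.Point} (hT : n • T = 0) :
    ∃ a : E.toAffine.CoordinateRing, a ≠ 0 ∧
      ∀ Q : (E⁄F).toAffine.Point, ptVal Q (E.toFF a) * infWeight n Q = infWeight n (Q + T) := by
  by_cases hT0 : T = 0
  · subst hT0
    exact ⟨1, one_ne_zero, fun Q => by rw [map_one, map_one, one_mul, add_zero]⟩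
  -- The zero is placed at -T, the point that Q ↦ Q + T carries to infinity; this is where the
  -- right-hand side of the claim is small.
  obtain ⟨c, d, h, hneg⟩ : ∃ c d, ∃ h : (E⁄F).toAffine.Nonsingular c d, -T = .some c d h := by
    rcases hc : -T with _ | ⟨c, d, h⟩
    · exact absurd (neg_eq_zero.mp hc) hT0
    · exact ⟨c, d, h, rfl⟩
  have hn : n • (Affine.Point.some c d h : (E⁄F).toAffine.Point) = 0 := by
    rw [← hneg, smul_neg, hT, neg_zero]
  obtain ⟨a, ha0, ha⟩ := exists_span_eq_pow hn
  set m := pointPrime h.1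
  have hvT : ptVal (.some c d h) (E.toFF a) = WithZero.exp (-(n : ℤ)) := by
    rw [ptVal_some]
    change m.valuation _ (algebraMap _ _ a) = _
    rw [HeightOneSpectrum.valuation_of_algebraMap]
    apply le_antisymm
    · rw [HeightOneSpectrum.intValuation_le_pow_iff_mem, ha]
      exact Ideal.mem_span_singleton_self a
    -- A smaller value would put a, hence the n-th power of the prime, into the (n + 1)-th power.
    · by_contra! hlt
      obtain ⟨k, hk⟩ : ∃ k : ℤ, m.intValuation a = WithZero.exp k :=
        ⟨_, (WithZero.exp_log (m.intValuation_ne_zero a ha0)).symm⟩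
      have hle : m.intValuation a ≤ WithZero.exp (-((n + 1 : ℕ) : ℤ)) := by
        rw [hk, WithZero.exp_lt_exp] at hlt
        rw [hk, WithZero.exp_le_exp]
        push_cast
        omega
      rw [HeightOneSpectrum.intValuation_le_pow_iff_mem, ← Ideal.span_singleton_le_iff_mem,
        ← ha] at hle
      exact absurd hle (not_le_of_gt (Ideal.pow_right_strictAnti _ m.ne_bot m.isPrime.ne_top
        (Nat.lt_succ_self n)))
  have hvQ : ∀ Q : (E⁄F).toAffine.Point, Q ≠ 0 → Q ≠ -T → ptVal Q (E.toFF a) = 1 := by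
    rintro (_ | ⟨c', d', h'⟩) hQ hQT
    · exact absurd rfl hQ
    · refine (ptVal_some_le_one a).antisymm (not_lt.mp fun hlt => hQT ?_)
      rw [ptVal_some_lt_one_iff, ← mem_pointPrime, ← Ideal.span_singleton_le_iff_mem, ← ha] at hlt
      obtain ⟨rfl, rfl⟩ := pointPrime_asIdeal_le ((pointPrime h'.1).isPrime.le_of_pow_le hlt)
      exact hneg.symm
  have hdeg : poleDegree a = n := by
    refine poleDegree_of_span_eq (E := E) h ha0 ?_
    rw [← ha]
    congr 1
    exact (ker_evalPt h.1).symm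
  refine ⟨a, ha0, fun Q => ?_⟩
  by_cases hQ0 : Q = 0
  · subst hQ0
    rw [zero_add, infWeight_zero, infWeight_of_ne n hT0, ptVal_zero ha0]
    rw [hdeg, ← WithZero.exp_add]
    simp
  · rw [infWeight_of_ne n hQ0, mul_one]
    by_cases hQT : Q = -T
    · rw [hQT, neg_add_cancel, infWeight_zero, hneg, hvT]
    · rw [hvQ Q hQ0 hQT, infWeight_of_ne]
      intro h0
      exact hQT (eq_neg_of_add_eq_zero_left h0)

end WeierstrassCurve
end

/-! ### Theta operators and the Weil pairing. -/

noncomputable section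

namespace WeierstrassCurve

set_option linter.unusedSectionVars false

open scoped Classical WithZero nonZeroDivisors
open Polynomial IsDedekindDomain

universe u

variable {F : Type u} [Field F] [CharZero F] [IsAlgClosed F] {E : WeierstrassCurve F} [E.IsElliptic]

/-- A function with divisor `n (-T) - n (0)`, where `T` is an `n`-torsion point. -/
def divisorFn (n : ℕ) (T : (E⁄F).toAffine.Point) : E.toAffine.CoordinateRing :=
  if hT : n • T = 0 then (exists_divisor_torsion hT).choose else 1

lemma divisorFn_ne_zero (n : ℕ) (T : (E⁄F).toAffine.Point) : divisorFn n T ≠ 0 := by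
  rw [divisorFn]
  split_ifs with hT
  · exact (exists_divisor_torsion hT).choose_spec.1
  · exact one_ne_zero

lemma toFF_divisorFn_ne_zero (n : ℕ) (T : (E⁄F).toAffine.Point) : E.toFF (divisorFn n T) ≠ 0 := by
  intro h
  exact divisorFn_ne_zero n T (IsFractionRing.injective E.toAffine.CoordinateRing
    E.toAffine.FunctionField (h.trans (map_zero E.toFF).symm))

lemma ptVal_divisorFn {n : ℕ} {T : (E⁄F).toAffine.Point} (hT : n • T = 0)
    (Q : (E⁄F).toAffine.Point) :
    ptVal Q (E.toFF (divisorFn n T)) * infWeight n Q = infWeight n (Q + T) := by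
  rw [divisorFn, dif_pos hT]
  exact (exists_divisor_torsion hT).choose_spec.2 Q

/-- The operator `f ↦ h_T · f(· + T)` where `h_T` has divisor `n (-T) - n (0)`. -/
def thetaOp (n : ℕ) (T : (E⁄F).toAffine.Point) :
    E.toAffine.FunctionField →ₗ[F] E.toAffine.FunctionField :=
  (LinearMap.mulLeft F (E.toFF (divisorFn n T))).comp (translate T).toLinearMap

lemma thetaOp_apply (n : ℕ) (T : (E⁄F).toAffine.Point) (f : E.toAffine.FunctionField) :
    thetaOp n T f = E.toFF (divisorFn n T) * translate T f := rfl

lemma thetaOp_ne_zero (n : ℕ) (T : (E⁄F).toAffine.Point) {f : E.toAffine.FunctionField}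
    (hf : f ≠ 0) : thetaOp n T f ≠ 0 :=
  mul_ne_zero (toFF_divisorFn_ne_zero n T) ((_root_.map_ne_zero (translate T)).mpr hf)

/-- The product of `ptVal Q f` and `infWeight n Q` is the valuation at Q of f as a section of
O(n·0). The divisor of h_T is chosen so that the operator of T translates this by T; in particular
it preserves L(n·0). -/
lemma ptVal_thetaOp {n : ℕ} {T : (E⁄F).toAffine.Point} (hT : n • T = 0)
    (Q : (E⁄F).toAffine.Point) (f : E.toAffine.FunctionField) :
    ptVal Q (thetaOp n T f) * infWeight n Q = ptVal (Q + T) f * infWeight n (Q + T) := by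
  rw [thetaOp_apply, map_mul, ptVal_translate, mul_right_comm, ptVal_divisorFn hT, mul_comm]

lemma exists_algebraMap_mul_of_ptVal_eq {f g : E.toAffine.FunctionField} (hg : g ≠ 0)
    (h : ∀ Q : (E⁄F).toAffine.Point, Q ≠ 0 → ptVal Q f = ptVal Q g) :
    ∃ c : F, c ≠ 0 ∧ f = c • g := by
  obtain ⟨c, hc, hcf⟩ := exists_algebraMap_of_ptVal_eq_one (f := f / g) fun Q hQ => by
    rw [map_div₀, h Q hQ, div_self ((Valuation.ne_zero_iff _).mpr hg)]
  exact ⟨c, hc, by rw [Algebra.smul_def, hcf, div_mul_cancel₀ _ hg]⟩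

lemma exists_thetaOp_divisorFn {n : ℕ} {S T : (E⁄F).toAffine.Point} (hS : n • S = 0)
    (hT : n • T = 0) : ∃ c : F, c ≠ 0 ∧
      thetaOp n S (E.toFF (divisorFn n T)) = c • E.toFF (divisorFn n (S + T)) := by
  refine exists_algebraMap_mul_of_ptVal_eq (toFF_divisorFn_ne_zero n _) fun Q _ => ?_
  apply mul_right_cancel₀ (infWeight_ne_zero n Q)
  rw [ptVal_thetaOp hS, ptVal_divisorFn hT, ptVal_divisorFn (by rw [smul_add, hS, hT, add_zero]),
    add_assoc]

lemma thetaOp_mul (n : ℕ) (T : (E⁄F).toAffine.Point) (f g : E.toAffine.FunctionField) :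
    thetaOp n T (f * g) = thetaOp n T f * translate T g := by
  rw [thetaOp_apply, thetaOp_apply, map_mul, mul_assoc]

/-- The functions h_S · h_T(· + S) and h_{S+T} have the same valuation at all affine points, so the
operators are multiplicative up to scalars. The scalar in the commutator of two of them is the Weil
pairing. -/
lemma exists_thetaOp_thetaOp {n : ℕ} {S T : (E⁄F).toAffine.Point} (hS : n • S = 0)
    (hT : n • T = 0) : ∃ c : F, c ≠ 0 ∧
      ∀ f, thetaOp n S (thetaOp n T f) = c • thetaOp n (S + T) f := by
  obtain ⟨c, hc, h⟩ := exists_thetaOp_divisorFn hS hT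
  refine ⟨c, hc, fun f => ?_⟩
  rw [thetaOp_apply n T, thetaOp_mul, h, translate_translate, thetaOp_apply, smul_mul_assoc]

/-- The operators of `S` and `T` commute up to the factor `e`. -/
def IsWeilPairing (n : ℕ) (S T : (E⁄F).toAffine.Point) (e : F) : Prop :=
  ∀ f, thetaOp n S (thetaOp n T f) = e • thetaOp n T (thetaOp n S f)

lemma exists_isWeilPairing {n : ℕ} {S T : (E⁄F).toAffine.Point} (hS : n • S = 0)
    (hT : n • T = 0) : ∃ e : F, e ≠ 0 ∧ IsWeilPairing n S T e := by
  obtain ⟨c, hc, h⟩ := exists_thetaOp_thetaOp hS hT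
  obtain ⟨d, hd, h'⟩ := exists_thetaOp_thetaOp hT hS
  refine ⟨c * d⁻¹, mul_ne_zero hc (inv_ne_zero hd), fun f => ?_⟩
  rw [h, h', smul_smul, inv_mul_cancel_right₀ hd, add_comm]

lemma IsWeilPairing.unique {n : ℕ} {S T : (E⁄F).toAffine.Point} {e e' : F}
    (h : IsWeilPairing n S T e) (h' : IsWeilPairing n S T e') : e = e' := by
  have := (h 1).symm.trans (h' 1)
  exact smul_left_injective F (thetaOp_ne_zero n T (thetaOp_ne_zero n S one_ne_zero)) this

lemma isWeilPairing_self (n : ℕ) (T : (E⁄F).toAffine.Point) : IsWeilPairing n T T (1 : F) :=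
  fun f => by rw [one_smul]

lemma IsWeilPairing.symm {n : ℕ} {S T : (E⁄F).toAffine.Point} {e : F} (he : e ≠ 0)
    (h : IsWeilPairing n S T e) : IsWeilPairing n T S e⁻¹ :=
  fun f => by rw [h f, smul_smul, inv_mul_cancel₀ he, one_smul]

lemma IsWeilPairing.add_left {n : ℕ} {S S' T : (E⁄F).toAffine.Point} (hS : n • S = 0)
    (hS' : n • S' = 0) {e e' : F} (h : IsWeilPairing n S T e) (h' : IsWeilPairing n S' T e') :
    IsWeilPairing n (S + S') T (e * e') := by
  obtain ⟨c, hc, hadd⟩ := exists_thetaOp_thetaOp hS hS'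
  intro f
  apply smul_right_injective _ hc
  dsimp only
  rw [← hadd, h', map_smul, h, smul_smul, smul_smul, hadd, map_smul, smul_smul]
  congr 1
  ring

/-- By additivity the value e at 0 satisfies e = e², and e ≠ 0. -/
lemma isWeilPairing_zero_left {n : ℕ} {T : (E⁄F).toAffine.Point} (hT : n • T = 0) :
    IsWeilPairing n 0 T (1 : F) := by
  obtain ⟨e, he, h⟩ := exists_isWeilPairing (E := E) (smul_zero n) hT
  have h2 := h.add_left (smul_zero n) (smul_zero n) h
  rw [add_zero] at h2
  have h3 := h.unique h2
  have : e = 1 := by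
    have : e * (e - 1) = 0 := by linear_combination -h3
    rcases mul_eq_zero.mp this with h4 | h4
    · exact absurd h4 he
    · exact sub_eq_zero.mp h4
  rwa [this] at h

lemma IsWeilPairing.nsmul_left {n : ℕ} {S T : (E⁄F).toAffine.Point} (hS : n • S = 0)
    (hT : n • T = 0) {e : F} (h : IsWeilPairing n S T e) (i : ℕ) :
    IsWeilPairing n (i • S) T (e ^ i) := by
  induction i with
  | zero => rw [zero_smul, pow_zero]; exact isWeilPairing_zero_left hT
  | succ i ih =>
    rw [succ_nsmul, pow_succ]
    exact ih.add_left (by rw [smul_comm, hS, smul_zero]) hS h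

lemma IsWeilPairing.nsmul_right {n : ℕ} {S T : (E⁄F).toAffine.Point} (hS : n • S = 0)
    (hT : n • T = 0) {e : F} (he : e ≠ 0) (h : IsWeilPairing n S T e) (i : ℕ) :
    IsWeilPairing n S (i • T) (e ^ i) := by
  have := ((h.symm he).nsmul_left hT hS i).symm (pow_ne_zero _ (inv_ne_zero he))
  rwa [inv_pow, inv_inv] at this

lemma IsWeilPairing.pow_eq_one {n : ℕ} {S T : (E⁄F).toAffine.Point} (hS : n • S = 0)
    (hT : n • T = 0) {e : F} (h : IsWeilPairing n S T e) : e ^ n = 1 := by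
  have := h.nsmul_left hS hT n
  rw [hS] at this
  exact this.unique (isWeilPairing_zero_left hT)

/-- Bilinearity and the triviality of the pairing of S or T with itself. The exponent is the
determinant ps - rq, written as a quotient because p, q, r, s are natural numbers. -/
lemma IsWeilPairing.linear_combination {n : ℕ} {S T : (E⁄F).toAffine.Point} (hS : n • S = 0)
    (hT : n • T = 0) {e : F} (he : e ≠ 0) (h : IsWeilPairing n S T e) (p q r s : ℕ) :
    IsWeilPairing n (p • S + r • T) (q • S + s • T) (e ^ (p * s) * (e ^ (r * q))⁻¹) := by
  have hn : ∀ (i : ℕ) {R : (E⁄F).toAffine.Point}, n • R = 0 → n • (i • R) = 0 := fun i R hR => by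
    rw [smul_comm, hR, smul_zero]
  have hx : ∀ {R : (E⁄F).toAffine.Point} {c d : F}, c ≠ 0 → d ≠ 0 → n • R = 0 →
      IsWeilPairing n S R c → IsWeilPairing n T R d →
        IsWeilPairing n (p • S + r • T) R (c ^ p * d ^ r) :=
    fun _ _ hR h1 h2 => (h1.nsmul_left hS hR p).add_left (hn p hS) (hn r hT)
      (h2.nsmul_left hT hR r)
  have h1 := hx one_ne_zero (inv_ne_zero he) hS (isWeilPairing_self n S) (h.symm he)
  have h2 := hx he one_ne_zero hT h (isWeilPairing_self n T)
  have hP : n • (p • S + r • T) = 0 := by rw [smul_add, hn p hS, hn r hT, add_zero]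
  have n1 : (1 : F) ^ p * e⁻¹ ^ r ≠ 0 := mul_ne_zero (by simp) (pow_ne_zero _ (inv_ne_zero he))
  have n2 : e ^ p * 1 ^ r ≠ 0 := mul_ne_zero (pow_ne_zero _ he) (by simp)
  have h3 := (((h1.nsmul_right hP hS n1 q).symm (pow_ne_zero _ n1)).add_left (hn q hS) (hn s hT)
    ((h2.nsmul_right hP hT n2 s).symm (pow_ne_zero _ n2))).symm
    (mul_ne_zero (inv_ne_zero (pow_ne_zero _ n1)) (inv_ne_zero (pow_ne_zero _ n2)))
  convert h3 using 1
  rw [one_pow, one_pow, one_mul, mul_one, inv_pow, mul_inv, inv_inv, inv_inv, ← pow_mul, inv_pow,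
    ← pow_mul, mul_comm]

section RiemannRoch

/-- The functions with poles only at infinity, of order at most `n`. -/
def poleSpace (E : WeierstrassCurve F) [E.IsElliptic] (n : ℕ) :
    Submodule F E.toAffine.FunctionField where
  carrier := {f | ∀ Q : (E⁄F).toAffine.Point, ptVal Q f * infWeight n Q ≤ 1}
  add_mem' := by
    intro f g hf hg Q
    have h := (ptVal Q).map_add f g
    rcases le_max_iff.mp h with h | h
    · exact (mul_le_mul_left h _).trans (hf Q)
    · exact (mul_le_mul_left h _).trans (hg Q)
  zero_mem' := fun Q => by rw [map_zero, zero_mul]; exact zero_le_one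
  smul_mem' := by
    intro c f hf Q
    rw [Algebra.smul_def, map_mul, mul_assoc]
    exact mul_le_one' (ptVal_algebraMap_le_one Q c) (hf Q)

lemma thetaOp_mem_poleSpace {n : ℕ} {T : (E⁄F).toAffine.Point} (hT : n • T = 0)
    {f : E.toAffine.FunctionField} (hf : f ∈ E.poleSpace n) : thetaOp n T f ∈ E.poleSpace n :=
  fun Q => by rw [ptVal_thetaOp hT]; exact hf _

lemma one_mem_poleSpace (n : ℕ) : (1 : E.toAffine.FunctionField) ∈ E.poleSpace n := by
  intro Q
  rw [map_one, one_mul, infWeight]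
  split_ifs
  · rw [← WithZero.exp_zero, WithZero.exp_le_exp]
    omega
  · exact le_rfl

lemma exists_of_mem_poleSpace {n : ℕ} {f : E.toAffine.FunctionField} (hf : f ∈ E.poleSpace n) :
    ∃ a, E.toFF a = f ∧ poleDegree a ≤ n := by
  obtain ⟨a, rfl⟩ := mem_range_toFF fun Q hQ => by
    have := hf Q
    rwa [infWeight_of_ne n hQ, mul_one] at this
  refine ⟨a, rfl, ?_⟩
  by_cases ha : a = 0
  · rw [ha, poleDegree, Algebra.norm_zero, natDegree_zero]
    exact Nat.zero_le n
  have := hf 0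
  rw [infWeight_zero, ptVal_zero ha, ← WithZero.exp_add, ← WithZero.exp_zero,
    WithZero.exp_le_exp] at this
  omega

/-- An element is p(x) + q(x)y, and the pole degree bounds the degrees of p and q. Finiteness is
needed for eigenvectors to exist. -/
instance finiteDimensional_poleSpace (n : ℕ) : FiniteDimensional F (E.poleSpace n) := by
  let g : degreeLT F (n + 1) × degreeLT F (n + 1) →ₗ[F] E.toAffine.FunctionField :=
    E.toFF.toLinearMap.comp
      (((aeval E.xCoord).toLinearMap.comp ((degreeLT F (n + 1)).subtype.comp
          (LinearMap.fst F _ _))) +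
        (LinearMap.mulRight F E.yCoord).comp ((aeval E.xCoord).toLinearMap.comp
          ((degreeLT F (n + 1)).subtype.comp (LinearMap.snd F _ _))))
  have : FiniteDimensional F (degreeLT F (n + 1)) :=
    Module.Finite.equiv (degreeLTEquiv F (n + 1)).symm
  refine Submodule.finiteDimensional_of_le (S₂ := LinearMap.range g) ?_
  intro f hf
  obtain ⟨a, rfl, ha⟩ := exists_of_mem_poleSpace hf
  obtain ⟨p, q, rfl⟩ := exists_eq_add_mul a
  have hd : max (2 • p.degree) (2 • q.degree + 3) ≤ (n : WithBot ℕ) := by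
    rw [← degree_norm_eq (E := E)]
    exact degree_le_natDegree.trans (Nat.cast_le.mpr ha)
  have hp : p ∈ degreeLT F (n + 1) := by
    rw [mem_degreeLT]
    by_cases hp : p = 0
    · rw [hp, degree_zero]
      exact WithBot.bot_lt_coe _
    · have := (le_max_left _ _).trans hd
      rw [degree_eq_natDegree hp, nsmul_eq_mul] at this
      rw [degree_eq_natDegree hp]
      have h2 : 2 * p.natDegree ≤ n := by exact_mod_cast this
      exact_mod_cast (by omega : p.natDegree < n + 1)
  have hq : q ∈ degreeLT F (n + 1) := by
    rw [mem_degreeLT]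
    by_cases hq : q = 0
    · rw [hq, degree_zero]
      exact WithBot.bot_lt_coe _
    · have := (le_max_right _ _).trans hd
      rw [degree_eq_natDegree hq, nsmul_eq_mul] at this
      rw [degree_eq_natDegree hq]
      have h2 : 2 * q.natDegree + 3 ≤ n := by exact_mod_cast this
      exact_mod_cast (by omega : q.natDegree < n + 1)
  exact ⟨(⟨p, hp⟩, ⟨q, hq⟩), rfl⟩

/-- A function that is an eigenvector for the operators of a set of torsion points is invariant
under them as a divisor, so the set has at most `n` elements. -/
lemma card_le_of_eigenvector {n : ℕ} (hn : 0 < n) {f : E.toAffine.FunctionField} (hf0 : f ≠ 0)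
    (hf : f ∈ E.poleSpace n) (B : Finset (E⁄F).toAffine.Point)
    (hB : ∀ T ∈ B, n • T = 0 ∧ ∃ c : F, thetaOp n T f = c • f) : B.card ≤ n := by
  have hinv : ∀ T ∈ B, ∀ Q : (E⁄F).toAffine.Point,
      ptVal (Q + T) f * infWeight n (Q + T) = ptVal Q f * infWeight n Q := by
    intro T hT Q
    obtain ⟨h1, c, h2⟩ := hB T hT
    have hc : c ≠ 0 := by
      rintro rfl
      rw [zero_smul] at h2
      exact thetaOp_ne_zero n T hf0 h2
    rw [← ptVal_thetaOp h1, h2, Algebra.smul_def, map_mul, ptVal_algebraMap Q hc, one_mul]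
  -- If the section f of O(n·0) vanishes at Q, it vanishes on all of Q + B, and it has at most n
  -- zeros. A section without zeros would be a constant function, but as a section a constant
  -- vanishes to order n > 0 at infinity.
  by_cases hex : ∃ Q : (E⁄F).toAffine.Point, ptVal Q f * infWeight n Q < 1
  · obtain ⟨Q, hQ⟩ := hex
    obtain ⟨a, rfl, ha⟩ := exists_of_mem_poleSpace hf
    have ha0 : a ≠ 0 := by
      rintro rfl
      exact hf0 (map_zero _)
    let S := B.image (Q + ·)
    have hS : S.card = B.card := Finset.card_image_of_injective _ (add_right_injective Q)
    have hlt : ∀ R ∈ S, ptVal R (E.toFF a) * infWeight n R < 1 := by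
      intro R hR
      obtain ⟨T, hT, rfl⟩ := Finset.mem_image.mp hR
      rw [hinv T hT]
      exact hQ
    have hle : (S.erase 0).card ≤ poleDegree a := by
      refine card_le_poleDegree ha0 _ fun R hR => ?_
      have hR0 := Finset.ne_of_mem_erase hR
      have := hlt R (Finset.mem_of_mem_erase hR)
      rw [infWeight_of_ne n hR0, mul_one, ptVal_lt_one_iff hR0] at this
      exact ⟨hR0, this⟩
    rw [← hS]
    -- A zero of the section at infinity means that a has pole degree less than n, which makes up
    -- for the point removed from S.
    by_cases h0 : (0 : (E⁄F).toAffine.Point) ∈ S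
    · have h1 := hlt 0 h0
      rw [infWeight_zero, ptVal_zero ha0, ← WithZero.exp_add, ← WithZero.exp_zero,
        WithZero.exp_lt_exp] at h1
      rw [Finset.card_erase_of_mem h0] at hle
      omega
    · rw [Finset.erase_eq_of_notMem h0] at hle
      omega
  · exfalso
    push Not at hex
    have h1 : ∀ Q : (E⁄F).toAffine.Point, ptVal Q f * infWeight n Q = 1 :=
      fun Q => (hf Q).antisymm (hex Q)
    obtain ⟨c, hc, rfl⟩ := exists_algebraMap_of_ptVal_eq_one (f := f) fun Q hQ => by
      have := h1 Q
      rwa [infWeight_of_ne n hQ, mul_one] at this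
    have h2 := h1 0
    rw [ptVal_algebraMap 0 hc, one_mul, infWeight_zero, ← WithZero.exp_zero,
      WithZero.exp_inj] at h2
    omega

end RiemannRoch

/-- Commuting operators on a nonzero finite-dimensional space over an algebraically closed field have
a common eigenvector. -/
lemma _root_.Module.End.exists_common_eigenvector {V : Type*} [AddCommGroup V] [Module F V]
    [FiniteDimensional F V] [Nontrivial V] (f g : Module.End F V) (h : Commute f g) :
    ∃ v : V, v ≠ 0 ∧ (∃ c : F, f v = c • v) ∧ ∃ c : F, g v = c • v := by
  obtain ⟨c, hc⟩ := Module.End.exists_eigenvalue f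
  have hmaps : ∀ v ∈ f.eigenspace c, g v ∈ f.eigenspace c := by
    intro v hv
    rw [Module.End.mem_eigenspace_iff] at hv ⊢
    have := LinearMap.congr_fun h v
    change f (g v) = g (f v) at this
    rw [this, hv, map_smul]
  have : Nontrivial (f.eigenspace c) := (Submodule.nontrivial_iff_ne_bot).mpr hc
  obtain ⟨d, hd⟩ := Module.End.exists_eigenvalue (g.restrict hmaps)
  obtain ⟨v, hv⟩ := hd.exists_hasEigenvector
  refine ⟨v, fun h0 => hv.2 (Subtype.ext h0), ⟨c, Module.End.mem_eigenspace_iff.mp v.2⟩, d, ?_⟩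
  exact congrArg Subtype.val hv.apply_eq_smul

/-- The Weil pairing of two generators of the `n`-torsion has order `n`. -/
theorem IsWeilPairing.isPrimitiveRoot {n : ℕ} (hn : 0 < n) {S T : (E⁄F).toAffine.Point}
    (hS : n • S = 0) (hT : n • T = 0)
    (hind : ∀ i j : ℕ, i • S + j • T = 0 → n ∣ i ∧ n ∣ j) {e : F} (he : e ≠ 0)
    (h : IsWeilPairing n S T e) : IsPrimitiveRoot e n := by
  refine ⟨h.pow_eq_one hS hT, ?_⟩
  suffices horder : n ≤ orderOf e by
    intro l hl
    have h1 : orderOf e ∣ n := orderOf_dvd_of_pow_eq_one (h.pow_eq_one hS hT)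
    rw [← (Nat.le_of_dvd hn h1).antisymm horder]
    exact orderOf_dvd_of_pow_eq_one hl
  -- Let m be the order of e and n = mq. The operators of S and mT commute, so they have a common
  -- eigenvector in L(n·0). It is an eigenvector for the whole group generated by S and mT, which
  -- has nq elements; hence nq ≤ n and m = n.
  obtain ⟨q, hq⟩ : orderOf e ∣ n := orderOf_dvd_of_pow_eq_one (h.pow_eq_one hS hT)
  set m := orderOf e
  have hmT : n • (m • T) = 0 := by rw [smul_comm, hT, smul_zero]
  have hcomm : IsWeilPairing n S (m • T) (1 : F) := by
    rw [← pow_orderOf_eq_one e]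
    exact h.nsmul_right hS hT he m
  let f : Module.End F (E.poleSpace n) := (thetaOp n S).restrict fun v hv => thetaOp_mem_poleSpace hS hv
  let g : Module.End F (E.poleSpace n) :=
    (thetaOp n (m • T)).restrict fun v hv => thetaOp_mem_poleSpace hmT hv
  have hfg : Commute f g := by
    refine LinearMap.ext fun v => Subtype.ext ?_
    have := hcomm (v : E.toAffine.FunctionField)
    rwa [one_smul] at this
  have : Nontrivial (E.poleSpace n) :=
    ⟨⟨⟨1, one_mem_poleSpace n⟩, 0, fun h0 => one_ne_zero (congrArg Subtype.val h0)⟩⟩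
  obtain ⟨v, hv0, ⟨c, hc⟩, d, hd⟩ := Module.End.exists_common_eigenvector f g hfg
  have hv0' : (v : E.toAffine.FunctionField) ≠ 0 := fun h0 => hv0 (Subtype.ext h0)
  have hc' : thetaOp n S v = c • (v : E.toAffine.FunctionField) := congrArg Subtype.val hc
  have hd' : thetaOp n (m • T) v = d • (v : E.toAffine.FunctionField) := congrArg Subtype.val hd
  let P : (E⁄F).toAffine.Point → Prop := fun R => n • R = 0 ∧
    ∃ c : F, thetaOp n R v = c • (v : E.toAffine.FunctionField)
  have hadd : ∀ R R', P R → P R' → P (R + R') := by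
    rintro R R' ⟨h1, c1, h2⟩ ⟨h3, c2, h4⟩
    refine ⟨by rw [smul_add, h1, h3, add_zero], ?_⟩
    obtain ⟨c3, hc3, h5⟩ := exists_thetaOp_thetaOp h1 h3
    refine ⟨c3⁻¹ * (c2 * c1), ?_⟩
    have h6 := h5 v
    rw [h4, map_smul, h2, smul_smul] at h6
    rw [← smul_smul, h6, smul_smul, inv_mul_cancel₀ hc3, one_smul]
  have hP0 : P 0 := by
    have h1 : ∀ i : ℕ, P ((i + 1) • S) := by
      intro i
      induction i with
      | zero => rw [zero_add, one_smul]; exact ⟨hS, c, hc'⟩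
      | succ i ih => rw [succ_nsmul]; exact hadd _ _ ih ⟨hS, c, hc'⟩
    have := h1 (n - 1)
    rwa [Nat.sub_add_cancel hn, hS] at this
  have hPn : ∀ (i : ℕ) R, P R → P (i • R) := by
    intro i R hR
    induction i with
    | zero => rw [zero_smul]; exact hP0
    | succ i ih => rw [succ_nsmul]; exact hadd _ _ ih hR
  let B : Finset (E⁄F).toAffine.Point :=
    (Finset.range n ×ˢ Finset.range q).image fun ij => ij.1 • S + ij.2 • (m • T)
  have hB : B.card = n * q := by
    rw [Finset.card_image_of_injOn, Finset.card_product, Finset.card_range, Finset.card_range]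
    rintro ⟨i, j⟩ hij ⟨i', j'⟩ hij' heq
    simp only [Finset.coe_product, Finset.coe_range, Set.mem_prod, Set.mem_Iio] at hij hij'
    have hpos : 0 < m := Nat.pos_of_ne_zero fun h0 => by rw [h0, zero_mul] at hq; omega
    have hjm : m * j < n := by rw [hq]; exact Nat.mul_lt_mul_of_pos_left hij.2 hpos
    have hjm' : m * j' < n := by rw [hq]; exact Nat.mul_lt_mul_of_pos_left hij'.2 hpos
    dsimp only at heq hij hij'
    -- Here n - i' and n - mj' stand for -i' and -mj', since `hind` concerns natural coefficients.
    have h2 : (i + (n - i')) • S + (m * j + (n - m * j')) • T = 0 := by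
      have e1 : (n - i') • S = -(i' • S) := by
        rw [eq_neg_iff_add_eq_zero, ← add_smul, Nat.sub_add_cancel hij'.1.le, hS]
      have e2 : (n - m * j') • T = -(j' • (m • T)) := by
        rw [eq_neg_iff_add_eq_zero, smul_smul, mul_comm j', ← add_smul,
          Nat.sub_add_cancel hjm'.le, hT]
      rw [add_smul, add_smul, e1, e2, mul_comm m j, mul_smul]
      rw [← sub_eq_zero] at heq
      rw [← heq]
      abel
    obtain ⟨h3, h4⟩ := hind _ _ h2
    have h5 : i = i' := by
      obtain ⟨t, ht⟩ := h3
      have : t = 1 := by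
        rcases Nat.lt_or_ge t 1 with h | h
        · have : t = 0 := by omega
          subst this; omega
        · rcases Nat.lt_or_ge 1 t with h' | h'
          · have := Nat.mul_le_mul_left n h'
            omega
          · omega
      subst this
      omega
    have h6 : m * j = m * j' := by
      obtain ⟨t, ht⟩ := h4
      have : t = 1 := by
        rcases Nat.lt_or_ge t 1 with h | h
        · have : t = 0 := by omega
          subst this; omega
        · rcases Nat.lt_or_ge 1 t with h' | h'
          · have := Nat.mul_le_mul_left n h'
            omega
          · omega
      subst this
      omega
    rw [h5, Nat.eq_of_mul_eq_mul_left hpos h6]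
  have hcard := card_le_of_eigenvector hn hv0' v.2 B (by
    intro R hR
    obtain ⟨ij, -, rfl⟩ := Finset.mem_image.mp hR
    exact hadd _ _ (hPn _ _ ⟨hS, c, hc'⟩) (hPn _ _ ⟨hmT, d, hd'⟩))
  rw [hB] at hcard
  have hq1 : q ≤ 1 := by
    by_contra! hq1
    have := Nat.mul_le_mul_left n hq1
    omega
  calc n = m * q := hq
    _ ≤ m * 1 := Nat.mul_le_mul_left m hq1
    _ = m := mul_one m

end WeierstrassCurve
end

/-! ### Galois equivariance of the Weil pairing and the cyclotomic character. -/

noncomputable section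

namespace WeierstrassCurve

set_option linter.unusedSectionVars false

open scoped Classical WithZero nonZeroDivisors
open Polynomial IsDedekindDomain

universe u

lemma coordinateRing_ringHom_ext {F : Type*} [Field F] {E : WeierstrassCurve F} {B : Type*}
    [CommRing B] {f g : E.toAffine.CoordinateRing →+* B}
    (hc : ∀ c : F, f (algebraMap F _ c) = g (algebraMap F _ c)) (hx : f E.xCoord = g E.xCoord)
    (hy : f E.yCoord = g E.yCoord) : f = g := by
  have hp : ∀ p : F[X], f (aeval E.xCoord p) = g (aeval E.xCoord p) := by
    intro p
    induction p using Polynomial.induction_on' with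
    | add p q hp hq => rw [map_add, map_add, map_add, hp, hq]
    | monomial n c => rw [aeval_monomial, map_mul, map_mul, map_pow, map_pow, hc, hx]
  refine RingHom.ext fun a => ?_
  obtain ⟨p, q, rfl⟩ := exists_eq_add_mul a
  rw [map_add, map_add, map_mul, map_mul, hp, hp, hy]

lemma eval₂_polynomial_eq_zero {F B : Type*} [CommRing F] [CommRing B] (E : Affine F)
    (i : F[X] →+* B) {x y b₁ b₂ b₃ b₄ b₆ : B} (hx : i X = x) (h₁ : i (C E.a₁) = b₁)
    (h₂ : i (C E.a₂) = b₂) (h₃ : i (C E.a₃) = b₃) (h₄ : i (C E.a₄) = b₄) (h₆ : i (C E.a₆) = b₆)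
    (h : y ^ 2 + b₁ * x * y + b₃ * y = x ^ 3 + b₂ * x ^ 2 + b₄ * x + b₆) :
    eval₂ i y E.polynomial = 0 := by
  simp only [Affine.polynomial, eval₂_add, eval₂_sub, eval₂_mul, eval₂_pow, eval₂_X, eval₂_C,
    map_add, map_mul, map_pow, hx, h₁, h₂, h₃, h₄, h₆]
  linear_combination h

section Semilinear

variable {k : Type*} [Field k] (W : WeierstrassCurve k) {Ω : Type u} [Field Ω] [Algebra k Ω]

/-- The action of `Gal(Ω/k)` on the coordinate ring of a curve over `k`. -/
def galCoord (σ : Gal(Ω/k)) :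
    (W⁄Ω).toAffine.CoordinateRing →+* (W⁄Ω).toAffine.CoordinateRing :=
  AdjoinRoot.lift (f := (W⁄Ω).toAffine.polynomial) ((aeval (R := Ω) (W⁄Ω).xCoord).toRingHom.comp (mapRingHom (σ : Ω →+* Ω)))
    (W⁄Ω).yCoord (by
      have h := (W⁄Ω).yCoord_sq
      have hc : ∀ c : k, ((aeval (R := Ω) (W⁄Ω).xCoord).toRingHom.comp
          (mapRingHom (σ : Ω →+* Ω))) (C (algebraMap k Ω c)) =
            algebraMap Ω _ (algebraMap k Ω c) := fun c => by simp
      have hx : ((aeval (R := Ω) (W⁄Ω).xCoord).toRingHom.comp (mapRingHom (σ : Ω →+* Ω))) X =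
        (W⁄Ω).xCoord := by simp
      exact eval₂_polynomial_eq_zero _ _ hx (hc _) (hc _) (hc _) (hc _) (hc _) h)

variable {W}

lemma galCoord_xCoord (σ : Gal(Ω/k)) : W.galCoord σ (W⁄Ω).xCoord = (W⁄Ω).xCoord := by
  refine (AdjoinRoot.lift_of _).trans ?_
  simp

lemma galCoord_yCoord (σ : Gal(Ω/k)) : W.galCoord σ (W⁄Ω).yCoord = (W⁄Ω).yCoord :=
  AdjoinRoot.lift_root _

lemma galCoord_algebraMap (σ : Gal(Ω/k)) (c : Ω) :
    W.galCoord σ (algebraMap Ω _ c) = algebraMap Ω _ (σ c) := by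
  refine (AdjoinRoot.lift_of (x := C c) _).trans ?_
  simp

lemma galCoord_comp (σ τ : Gal(Ω/k)) (h : ∀ c, σ (τ c) = c) (a : (W⁄Ω).toAffine.CoordinateRing) :
    W.galCoord σ (W.galCoord τ a) = a := by
  have : (W.galCoord σ).comp (W.galCoord τ) = RingHom.id _ := by
    apply coordinateRing_ringHom_ext
    · intro c
      rw [RingHom.comp_apply, galCoord_algebraMap, galCoord_algebraMap, h]
      rfl
    · rw [RingHom.comp_apply, galCoord_xCoord, galCoord_xCoord]; rfl
    · rw [RingHom.comp_apply, galCoord_yCoord, galCoord_yCoord]; rfl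
  exact RingHom.congr_fun this a

lemma galCoord_injective (σ : Gal(Ω/k)) : Function.Injective (W.galCoord σ) :=
  Function.LeftInverse.injective (g := W.galCoord σ⁻¹)
    (galCoord_comp σ⁻¹ σ fun c => σ.symm_apply_apply c)

variable [W.IsElliptic]

lemma toFF_galCoord_injective (σ : Gal(Ω/k)) :
    Function.Injective ((algebraMap (W⁄Ω).toAffine.CoordinateRing
      (W⁄Ω).toAffine.FunctionField).comp (W.galCoord σ)) :=
  (IsFractionRing.injective _ _).comp (galCoord_injective σ)

variable (W) in
/-- The action of `Gal(Ω/k)` on the function field of a curve over `k`. -/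
def galFF (σ : Gal(Ω/k)) : (W⁄Ω).toAffine.FunctionField →+* (W⁄Ω).toAffine.FunctionField :=
  IsFractionRing.lift (toFF_galCoord_injective (W := W) σ)

lemma galFF_toFF (σ : Gal(Ω/k)) (a : (W⁄Ω).toAffine.CoordinateRing) :
    W.galFF σ ((W⁄Ω).toFF a) = (W⁄Ω).toFF (W.galCoord σ a) :=
  IsFractionRing.lift_algebraMap (toFF_galCoord_injective σ) a

lemma galFF_algebraMap (σ : Gal(Ω/k)) (c : Ω) :
    W.galFF σ (algebraMap Ω _ c) = algebraMap Ω _ (σ c) := by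
  rw [← (W⁄Ω).toFF.commutes, galFF_toFF, galCoord_algebraMap, AlgHom.commutes]

lemma functionField_ringHom_ext {F : Type*} [Field F] {E : WeierstrassCurve F} [E.IsElliptic]
    {B : Type*} [CommRing B] {f g : E.toAffine.FunctionField →+* B}
    (hc : ∀ c : F, f (algebraMap F _ c) = g (algebraMap F _ c))
    (hx : f (E.toFF E.xCoord) = g (E.toFF E.xCoord))
    (hy : f (E.toFF E.yCoord) = g (E.toFF E.yCoord)) : f = g := by
  apply IsLocalization.ringHom_ext (nonZeroDivisors E.toAffine.CoordinateRing)
  refine coordinateRing_ringHom_ext (fun c => ?_) hx hy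
  have h := hc c
  rw [← E.toFF.commutes] at h
  exact h

lemma galFF_surjective (σ : Gal(Ω/k)) : Function.Surjective (W.galFF σ) := by
  intro f
  refine ⟨W.galFF σ⁻¹ f, ?_⟩
  have : (W.galFF σ).comp (W.galFF σ⁻¹) = RingHom.id _ := by
    apply functionField_ringHom_ext
    · intro c
      rw [RingHom.comp_apply, galFF_algebraMap, galFF_algebraMap]
      exact congrArg _ (σ.apply_symm_apply c)
    · rw [RingHom.comp_apply, galFF_toFF, galCoord_xCoord, galFF_toFF, galCoord_xCoord]; rfl
    · rw [RingHom.comp_apply, galFF_toFF, galCoord_yCoord, galFF_toFF, galCoord_yCoord]; rfl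
  exact RingHom.congr_fun this f

variable (W) in
/-- The action of `Gal(Ω/k)` on the function field, as a homomorphism of `k`-algebras. -/
def galFFAlg (σ : Gal(Ω/k)) : (W⁄Ω).toAffine.FunctionField →ₐ[k] (W⁄Ω).toAffine.FunctionField where
  __ := W.galFF σ
  commutes' c := by
    rw [IsScalarTower.algebraMap_apply k Ω]
    refine (galFF_algebraMap σ _).trans ?_
    rw [AlgEquiv.commutes]

lemma galFFAlg_apply (σ : Gal(Ω/k)) (f : (W⁄Ω).toAffine.FunctionField) :
    W.galFFAlg σ f = W.galFF σ f := rfl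

variable (W Ω) in
/-- The points of the base change of a curve over `k` as points of that curve. -/
def toBase : ((W⁄Ω)⁄((W⁄Ω).toAffine.FunctionField)).toAffine.Point →+
    (W⁄((W⁄Ω).toAffine.FunctionField)).toAffine.Point where
  toFun P := P
  map_zero' := rfl
  map_add' _ _ := rfl

variable (W Ω) in
/-- The generic point, as a point of the curve over `k`. -/
def genericPtBase : (W⁄((W⁄Ω).toAffine.FunctionField)).toAffine.Point :=
  W.toBase Ω (genericPt (W⁄Ω))

lemma exists_genericPtBase_eq : ∃ h : (W⁄((W⁄Ω).toAffine.FunctionField)).toAffine.Nonsingular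
    ((W⁄Ω).toFF (W⁄Ω).xCoord) ((W⁄Ω).toFF (W⁄Ω).yCoord), W.genericPtBase Ω = .some _ _ h :=
  ⟨(W⁄Ω).nonsingular_of_equation (equation_of_algHom (W⁄Ω).toFF), rfl⟩

variable (W Ω) in
/-- The constant points, as points of the curve over `k`. -/
def constPtBase : ((W⁄Ω)⁄Ω).toAffine.Point →+
    (W⁄((W⁄Ω).toAffine.FunctionField)).toAffine.Point :=
  (W.toBase Ω).comp (W⁄Ω).constPt

variable (W) in
/-- The action of `Gal(Ω/k)` on the points of the base change of a curve over `k`. -/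
def galBase (σ : Gal(Ω/k)) : ((W⁄Ω)⁄Ω).toAffine.Point →+ ((W⁄Ω)⁄Ω).toAffine.Point :=
  W.galPoint σ

lemma exists_galBase_some (σ : Gal(Ω/k)) {c d : Ω} (h : ((W⁄Ω)⁄Ω).toAffine.Nonsingular c d) :
    ∃ h', W.galBase σ (.some c d h) = .some (σ c) (σ d) h' :=
  ⟨_, Affine.Point.map_some (W' := W.toAffine) (F := Ω) (K := Ω) (S := k) σ.toAlgHom h⟩

lemma map_base (φ : (W⁄Ω).toAffine.FunctionField →ₐ[Ω] (W⁄Ω).toAffine.FunctionField)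
    (T : ((W⁄Ω)⁄((W⁄Ω).toAffine.FunctionField)).toAffine.Point) :
    W.toBase Ω (Affine.Point.map (W' := (W⁄Ω).toAffine) φ T) =
      Affine.Point.map (W' := W.toAffine) (φ.restrictScalars k) (W.toBase Ω T) := by
  cases T <;> rfl

lemma map_galFFAlg_genericPtBase (σ : Gal(Ω/k)) :
    Affine.Point.map (W' := W.toAffine) (W.galFFAlg σ) (W.genericPtBase Ω) = W.genericPtBase Ω := by
  obtain ⟨h, hg⟩ := exists_genericPtBase_eq (W := W) (Ω := Ω)
  rw [hg, Affine.Point.map_some, Affine.Point.some.injEq]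
  constructor
  · rw [galFFAlg_apply, galFF_toFF, galCoord_xCoord]
  · rw [galFFAlg_apply, galFF_toFF, galCoord_yCoord]

lemma map_galFFAlg_constPtBase (σ : Gal(Ω/k)) (T : ((W⁄Ω)⁄Ω).toAffine.Point) :
    Affine.Point.map (W' := W.toAffine) (W.galFFAlg σ) (W.constPtBase Ω T) =
      W.constPtBase Ω (W.galBase σ T) := by
  have hsome : ∀ {c d : Ω} (h : ((W⁄Ω)⁄Ω).toAffine.Nonsingular c d),
      ∃ h', W.constPtBase Ω (.some c d h) = .some (algebraMap Ω _ c) (algebraMap Ω _ d) h' :=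
    fun h => ⟨_, rfl⟩
  rcases T with _ | ⟨c, d, h⟩
  · rfl
  · obtain ⟨h1, e1⟩ := exists_galBase_some σ h
    obtain ⟨h2, e2⟩ := hsome h
    obtain ⟨h3, e3⟩ := hsome h1
    rw [e1, e2, e3, Affine.Point.map_some, Affine.Point.some.injEq]
    exact ⟨galFF_algebraMap σ c, galFF_algebraMap σ d⟩

variable [CharZero Ω] [IsAlgClosed Ω]

lemma map_translate_genericPtBase (T : ((W⁄Ω)⁄Ω).toAffine.Point) :
    Affine.Point.map (W' := W.toAffine) ((translate T).restrictScalars k)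
      (W.genericPtBase Ω) = W.genericPtBase Ω + W.constPtBase Ω T := by
  rw [genericPtBase, ← map_base, map_translate, map_add]
  rfl

/-- Both sides are determined by their action on constants and on the generic point. There σ fixes
the generic point and moves the constant point T to σT. -/
lemma galFF_translate (σ : Gal(Ω/k)) (T : ((W⁄Ω)⁄Ω).toAffine.Point)
    (f : (W⁄Ω).toAffine.FunctionField) :
    W.galFF σ (translate T f) =
      translate (W.galBase σ T) (W.galFF σ f) := by
  have h1 : Affine.Point.map (W' := W.toAffine)
      ((W.galFFAlg σ).comp ((translate T).restrictScalars k)) (W.genericPtBase Ω) =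
      Affine.Point.map (W' := W.toAffine)
        ((translate (W.galBase σ T)).restrictScalars k) (W.genericPtBase Ω) := by
    rw [← Affine.Point.map_map, map_translate_genericPtBase, map_translate_genericPtBase, map_add,
      map_galFFAlg_genericPtBase, map_galFFAlg_constPtBase]
  obtain ⟨h, hg⟩ := exists_genericPtBase_eq (W := W) (Ω := Ω)
  rw [hg, Affine.Point.map_some, Affine.Point.map_some, Affine.Point.some.injEq] at h1
  have h2 : (W.galFF σ).comp (translate T).toRingHom =
      (translate (W.galBase σ T)).toRingHom.comp (W.galFF σ) := by
    apply functionField_ringHom_ext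
    · intro c
      change W.galFF σ (translate T _) =
        translate (W.galBase σ T) (W.galFF σ _)
      rw [AlgHom.commutes, galFF_algebraMap, AlgHom.commutes]
    · change _ = translate (W.galBase σ T) (W.galFF σ _)
      rw [galFF_toFF, galCoord_xCoord]
      exact h1.1
    · change _ = translate (W.galBase σ T) (W.galFF σ _)
      rw [galFF_toFF, galCoord_yCoord]
      exact h1.2
  exact RingHom.congr_fun h2 f

lemma galBase_mul_inv (σ : Gal(Ω/k)) (T : ((W⁄Ω)⁄Ω).toAffine.Point) :
    W.galBase σ (W.galBase σ⁻¹ T) = T := by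
  rcases T with _ | ⟨c, d, h⟩
  · rfl
  · obtain ⟨h1, e1⟩ := exists_galBase_some σ⁻¹ h
    obtain ⟨h2, e2⟩ := exists_galBase_some σ h1
    rw [e1, e2, Affine.Point.some.injEq]
    exact ⟨σ.apply_symm_apply c, σ.apply_symm_apply d⟩

lemma galBase_eq_zero_iff (σ : Gal(Ω/k)) (T : ((W⁄Ω)⁄Ω).toAffine.Point) :
    W.galBase σ T = 0 ↔ T = 0 :=
  map_eq_zero_iff (W.galBase σ) (Affine.Point.map_injective (W' := W.toAffine) σ.toAlgHom)

/-- The valuation f ↦ `ptVal (σQ) (σf)` is normalized and centred at Q, so it is the one at Q.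
Affine points are enough, since they determine a function up to a constant. -/
lemma ptVal_galFF (σ : Gal(Ω/k)) {Q : ((W⁄Ω)⁄Ω).toAffine.Point} (hQ : Q ≠ 0)
    (f : (W⁄Ω).toAffine.FunctionField) :
    ptVal (W.galBase σ Q) (W.galFF σ f) = ptVal Q f := by
  rcases Q with _ | ⟨c, d, h⟩
  · exact absurd rfl hQ
  let E := W⁄Ω
  obtain ⟨h', hg⟩ := exists_galBase_some σ h
  rw [hg]
  have hev : ∀ a, E.evalCoord (σ c) (σ d) h'.1 (W.galCoord σ a) = σ (E.evalCoord c d h.1 a) := by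
    intro a
    have : (E.evalCoord (σ c) (σ d) h'.1).toRingHom.comp (W.galCoord σ) =
        (σ : Ω →+* Ω).comp (E.evalCoord c d h.1).toRingHom := by
      apply coordinateRing_ringHom_ext
      · intro e
        change E.evalCoord (σ c) (σ d) h'.1 (W.galCoord σ _) = σ (E.evalCoord c d h.1 _)
        rw [galCoord_algebraMap, AlgHom.commutes, AlgHom.commutes]
        rfl
      · change E.evalCoord (σ c) (σ d) h'.1 (W.galCoord σ _) = σ (E.evalCoord c d h.1 _)
        rw [galCoord_xCoord, evalCoord_xCoord, evalCoord_xCoord]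
      · change E.evalCoord (σ c) (σ d) h'.1 (W.galCoord σ _) = σ (E.evalCoord c d h.1 _)
        rw [galCoord_yCoord, evalCoord_yCoord, evalCoord_yCoord]
    exact RingHom.congr_fun this a
  have h1 := (pointPrime (E := E) h.1).eq_valuation
    ((ptVal (E := E) (.some (σ c) (σ d) h')).comap (W.galFF σ))
    (fun a => by
      change ptVal (E := E) (.some (σ c) (σ d) h') (W.galFF σ (E.toFF a)) ≤ 1
      rw [galFF_toFF]
      exact ptVal_some_le_one _)
    (fun a => by
      change ptVal (E := E) (.some (σ c) (σ d) h') (W.galFF σ (E.toFF a)) < 1 ↔ _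
      rw [galFF_toFF, ptVal_some_lt_one_iff, hev, mem_pointPrime]
      exact _root_.map_eq_zero σ)
    ((ptVal_surjective (E := E) _).comp (galFF_surjective σ))
  have h2 : ptVal (E := E) (.some c d h) = _ := ptVal_some (h := h)
  exact DFunLike.congr_fun (h1.trans h2.symm) f

lemma nsmul_galBase {n : ℕ} {T : ((W⁄Ω)⁄Ω).toAffine.Point} (hT : n • T = 0) (σ : Gal(Ω/k)) :
    n • W.galBase σ T = 0 := by
  rw [← map_nsmul, hT, map_zero]

lemma exists_galFF_divisorFn {n : ℕ} {T : ((W⁄Ω)⁄Ω).toAffine.Point} (hT : n • T = 0)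
    (σ : Gal(Ω/k)) : ∃ c : Ω, c ≠ 0 ∧
      W.galFF σ ((W⁄Ω).toFF (divisorFn n T)) =
        c • (W⁄Ω).toFF (divisorFn n (W.galBase σ T)) := by
  refine exists_algebraMap_mul_of_ptVal_eq (toFF_divisorFn_ne_zero _ _) fun Q hQ => ?_
  have hinf : ∀ R : ((W⁄Ω)⁄Ω).toAffine.Point,
      infWeight n (W.galBase σ R) = infWeight n R := by
    intro R
    by_cases hR : R = 0
    · subst hR
      rw [map_zero]
    · rw [infWeight_of_ne n hR,
        infWeight_of_ne n fun h => hR ((galBase_eq_zero_iff σ R).mp h)]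
  obtain ⟨R, rfl⟩ : ∃ R, W.galBase σ R = Q := ⟨_, galBase_mul_inv σ Q⟩
  have hR : R ≠ 0 := fun h => hQ ((galBase_eq_zero_iff σ R).mpr h)
  rw [ptVal_galFF σ hR]
  apply mul_right_cancel₀ (infWeight_ne_zero n (W.galBase σ R))
  rw [ptVal_divisorFn (nsmul_galBase hT σ), hinf, ptVal_divisorFn hT, ← map_add, hinf]

lemma exists_galFF_thetaOp {n : ℕ} {T : ((W⁄Ω)⁄Ω).toAffine.Point} (hT : n • T = 0)
    (σ : Gal(Ω/k)) : ∃ c : Ω, c ≠ 0 ∧ ∀ f, W.galFF σ (thetaOp n T f) =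
      c • thetaOp n (W.galBase σ T) (W.galFF σ f) := by
  obtain ⟨c, hc, h⟩ := exists_galFF_divisorFn hT σ
  refine ⟨c, hc, fun f => ?_⟩
  rw [thetaOp_apply, map_mul, h, galFF_translate, thetaOp_apply, smul_mul_assoc]

/-- The Weil pairing is Galois equivariant. -/
theorem IsWeilPairing.galBase {n : ℕ} {S T : ((W⁄Ω)⁄Ω).toAffine.Point} (hS : n • S = 0)
    (hT : n • T = 0) {e : Ω} (h : IsWeilPairing n S T e) (σ : Gal(Ω/k)) :
    IsWeilPairing n (W.galBase σ S) (W.galBase σ T) (σ e) := by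
  obtain ⟨c, hc, h1⟩ := exists_galFF_thetaOp hS σ
  obtain ⟨d, hd, h2⟩ := exists_galFF_thetaOp hT σ
  intro f
  obtain ⟨f, rfl⟩ := galFF_surjective (W := W) σ f
  have h3 := congrArg (W.galFF σ) (h f)
  rw [h1, h2, Algebra.smul_def e, map_mul, galFF_algebraMap, h2, h1, ← Algebra.smul_def, map_smul,
    map_smul, smul_smul, smul_smul, smul_smul] at h3
  apply smul_right_injective _ (mul_ne_zero hc hd)
  dsimp only
  rw [h3, smul_smul]
  congr 1
  ring

end Semilinear

section Cyclotomic

variable {k : Type*} [Field k] {W : WeierstrassCurve k} [W.IsElliptic] {Ω : Type u} [Field Ω]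
  [Algebra k Ω] [CharZero Ω] [IsAlgClosed Ω]

/-- The determinant of the Galois representation in the `n`-torsion is the cyclotomic character. -/
theorem TorsionBasis.apply_eq_of_det_rhoMod (b : W.TorsionBasis Ω) (n : ℕ+) (σ : Gal(Ω/k))
    (hdet : (b.rhoMod n σ : Matrix (Fin 2) (Fin 2) (ZMod (n : ℕ))).det = 1) {ζ : Ω}
    (hζ : ζ ^ (n : ℕ) = 1) : σ ζ = ζ := by
  have hn : 0 < (n : ℕ) := n.pos
  let s : Fin 2 → W.torsionPoints Ω n := fun i => (b.coord n).symm (Pi.single i 1)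
  have hs : ∀ i, (n : ℕ) • (s i : (W⁄Ω).toAffine.Point) = 0 := fun i => (s i).2
  have hcomb : ∀ i j : ℕ, b.coord n (i • s 0 + j • s 1) = ![(i : ZMod (n : ℕ)), (j : ZMod (n : ℕ))] := by
    intro i j
    rw [map_add, map_nsmul, map_nsmul, AddEquiv.apply_symm_apply, AddEquiv.apply_symm_apply]
    funext l
    fin_cases l <;> simp
  have hind : ∀ i j : ℕ, i • (s 0 : (W⁄Ω).toAffine.Point) + j • (s 1 : (W⁄Ω).toAffine.Point) = 0 →
      (n : ℕ) ∣ i ∧ (n : ℕ) ∣ j := by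
    intro i j h
    have h1 : i • s 0 + j • s 1 = 0 := Subtype.ext h
    have h2 := hcomb i j
    rw [h1, map_zero] at h2
    have h3 := congrFun h2 0
    have h4 := congrFun h2 1
    exact ⟨(ZMod.natCast_eq_zero_iff _ _).mp h3.symm, (ZMod.natCast_eq_zero_iff _ _).mp h4.symm⟩
  let M : Matrix (Fin 2) (Fin 2) (ZMod (n : ℕ)) := b.rhoMod n σ
  have hσ : ∀ i, W.galPoint σ (s i) =
      (M 0 i).val • (s 0 : (W⁄Ω).toAffine.Point) + (M 1 i).val • (s 1 : (W⁄Ω).toAffine.Point) := by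
    intro i
    have h1 : W.galTorsion n σ (s i) = (M 0 i).val • s 0 + (M 1 i).val • s 1 := by
      apply (b.coord n).injective
      rw [← b.rhoMod_mulVec, hcomb, AddEquiv.apply_symm_apply, Matrix.mulVec_single_one,
        ZMod.natCast_zmod_val, ZMod.natCast_zmod_val]
      funext l
      fin_cases l <;> rfl
    exact congrArg Subtype.val h1
  -- The pairing e of the basis vectors is a primitive n-th root of unity. By equivariance and
  -- bilinearity σ(e) = e^det = e, and every n-th root of unity is a power of e.
  obtain ⟨e, he, hw⟩ := exists_isWeilPairing (E := W⁄Ω) (hs 0) (hs 1)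
  have hprim : IsPrimitiveRoot e n := hw.isPrimitiveRoot hn (hs 0) (hs 1) hind he
  have h1 : IsWeilPairing (E := W⁄Ω) n (W.galPoint σ (s 0)) (W.galPoint σ (s 1)) (σ e) :=
    hw.galBase (hs 0) (hs 1) σ
  rw [hσ 0, hσ 1] at h1
  have h2 := h1.unique (hw.linear_combination (hs 0) (hs 1) he _ _ _ _)
  have hfix : σ e = e := by
    rw [h2, ← div_eq_mul_inv, div_eq_iff (pow_ne_zero _ he), ← pow_succ']
    refine pow_eq_pow_of_modEq ((ZMod.natCast_eq_natCast_iff _ _ _).mp ?_) hprim.pow_eq_one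
    push_cast
    rw [ZMod.natCast_zmod_val, ZMod.natCast_zmod_val, ZMod.natCast_zmod_val, ZMod.natCast_zmod_val]
    rw [Matrix.det_fin_two] at hdet
    linear_combination hdet
  have : NeZero (n : ℕ) := ⟨hn.ne'⟩
  obtain ⟨i, -, rfl⟩ := hprim.eq_pow_of_pow_eq_one hζ
  rw [map_pow, hfix]

end Cyclotomic

end WeierstrassCurve
end

/-! ### Abstract Kummer theory for a group with large image in SL₂. -/

noncomputable section

/-- A basis of the `n`-torsion of a group with an action of `G`, such that the image of `G` contains
four elements that generate a large subgroup of `SL₂`. -/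
structure TorsionFrame (G M : Type*) [Group G] [AddCommGroup M] [DistribMulAction G M] (n : ℕ) where
  /-- The first basis vector. -/
  fst : M
  /-- The second basis vector. -/
  snd : M
  rel : ∀ i j : ℤ, i • fst + j • snd = 0 ↔ (n : ℤ) ∣ i ∧ (n : ℤ) ∣ j
  span : ∀ t : M, n • t = 0 → ∃ i j : ℤ, t = i • fst + j • snd
  upper : ∃ g : G, g • fst = fst ∧ g • snd = (2 : ℤ) • fst + snd
  lower : ∃ g : G, g • fst = fst + (2 : ℤ) • snd ∧ g • snd = snd
  rot : ∃ g : G, g • fst = fst - snd ∧ g • snd = fst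
  neg : ∃ g : G, g • fst = -fst ∧ g • snd = -snd

section KummerOrbit

variable {G M : Type*} [Group G] [AddCommGroup M] [DistribMulAction G M]

lemma smul_zsmul_comm' (g : G) (i : ℤ) (x : M) : g • (i • x) = i • (g • x) :=
  map_zsmul (DistribSMul.toAddMonoidHom M g) i x

lemma smul_nsmul_comm' (g : G) (i : ℕ) (x : M) : g • (i • x) = i • (g • x) :=
  map_nsmul (DistribSMul.toAddMonoidHom M g) i x

/-- The differences `σ Q - Q` for the `σ` that act trivially on the `n`-torsion, where `n Q` is a
fixed point. -/
def kummerSubgroup (G : Type*) [Group G] [DistribMulAction G M] {n : ℕ} {Q : M}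
    (hQ : ∀ g : G, g • (n • Q) = n • Q) : AddSubgroup M where
  carrier := {t | ∃ σ : G, (∀ s : M, n • s = 0 → σ • s = s) ∧ σ • Q = Q + t}
  zero_mem' := ⟨1, fun s _ => one_smul G s, by rw [one_smul, add_zero]⟩
  add_mem' := by
    rintro t t' ⟨σ, hσ, h⟩ ⟨τ, hτ, h'⟩
    have ht' : n • t' = 0 := by
      have := hQ τ
      rwa [smul_nsmul_comm', h', smul_add, add_eq_left] at this
    refine ⟨σ * τ, fun s hs => by rw [mul_smul, hτ s hs, hσ s hs], ?_⟩
    rw [mul_smul, h', smul_add, h, hσ t' ht', add_assoc]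
  neg_mem' := by
    rintro t ⟨σ, hσ, h⟩
    have ht : n • t = 0 := by
      have := hQ σ
      rwa [smul_nsmul_comm', h, smul_add, add_eq_left] at this
    have hinv : ∀ s : M, n • s = 0 → σ⁻¹ • s = s := fun s hs => by
      rw [inv_smul_eq_iff, hσ s hs]
    refine ⟨σ⁻¹, hinv, ?_⟩
    rw [inv_smul_eq_iff, smul_add, h, smul_neg, hσ t ht, add_neg_cancel_right]

variable {n : ℕ} {Q : M} {hQ : ∀ g : G, g • (n • Q) = n • Q}

lemma nsmul_smul_sub (hQ : ∀ g : G, g • (n • Q) = n • Q) (g : G) : n • (g • Q - Q) = 0 := by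
  rw [smul_sub, ← smul_nsmul_comm', hQ, sub_self]

lemma nsmul_eq_zero_of_mem_kummerSubgroup {t : M} (ht : t ∈ kummerSubgroup G hQ) : n • t = 0 := by
  obtain ⟨σ, -, h⟩ := ht
  have := nsmul_smul_sub hQ σ
  rwa [h, add_sub_cancel_left] at this

/-- If σ moves Q by t, then gσg⁻¹ moves Q by g • t, because g⁻¹Q - Q is an n-torsion point and σ
fixes it. -/
lemma smul_mem_kummerSubgroup {t : M} (ht : t ∈ kummerSubgroup G hQ) (g : G) :
    g • t ∈ kummerSubgroup G hQ := by
  obtain ⟨σ, hσ, h⟩ := ht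
  refine ⟨g * σ * g⁻¹, fun s hs => ?_, ?_⟩
  · rw [mul_smul, mul_smul, hσ _ (by rw [← smul_nsmul_comm', hs, smul_zero]), smul_inv_smul]
  · have h1 : n • (g⁻¹ • Q - Q) = 0 := nsmul_smul_sub hQ g⁻¹
    have h2 : g⁻¹ • Q = Q + (g⁻¹ • Q - Q) := by abel
    rw [mul_smul, mul_smul, h2, smul_add σ, h, hσ _ h1, add_right_comm, ← h2, smul_add,
      smul_inv_smul]

/-- A subgroup of the `n`-torsion that is stable under the group is the `m`-torsion for a divisor
`m` of `n`. -/
lemma TorsionFrame.exists_eq_torsion (hn : 0 < n) (f : TorsionFrame G M n) (N : AddSubgroup M)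
    (htors : ∀ t ∈ N, n • t = 0) (hstab : ∀ t ∈ N, ∀ g : G, g • t ∈ N) :
    ∃ d m : ℕ, d * m = n ∧ ∀ t, t ∈ N ↔ m • t = 0 := by
  obtain ⟨gu, hu1, hu2⟩ := f.upper
  obtain ⟨gl, hl1, hl2⟩ := f.lower
  obtain ⟨gr, hr1, hr2⟩ := f.rot
  have hrot : ∀ i j : ℤ, i • f.fst + j • f.snd ∈ N → (i + j) • f.fst + (-i) • f.snd ∈ N := by
    intro i j h
    have := hstab _ h gr
    rw [smul_add, smul_zsmul_comm', smul_zsmul_comm', hr1, hr2] at this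
    convert this using 1
    module
  -- J describes N on the axis of `fst`; by the rotation it describes N on the axis of `snd` as
  -- well. The aim is N = J·fst + J·snd.
  let J : AddSubgroup ℤ := N.comap (zmultiplesHom M f.fst)
  have hJ : ∀ a, a ∈ J ↔ a • f.fst ∈ N := fun a => Iff.rfl
  have hJ2 : ∀ a, a ∈ J ↔ a • f.snd ∈ N := by
    intro a
    rw [hJ]
    constructor
    · intro h
      have h1 := hrot a 0 (by rwa [zero_smul, add_zero])
      rw [add_zero] at h1
      have h2 := N.sub_mem h h1
      convert h2 using 1
      module
    · intro h
      have h1 := hrot 0 a (by rwa [zero_smul, zero_add])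
      convert h1 using 1
      module
  -- The frame only contains the unipotents with entry 2, and these move a vector by twice one of
  -- its coordinates.
  have hdouble : ∀ i j : ℤ, i • f.fst + j • f.snd ∈ N → 2 * i ∈ J ∧ 2 * j ∈ J := by
    intro i j h
    constructor
    · rw [hJ2]
      have := N.sub_mem (hstab _ h gl) h
      rw [smul_add, smul_zsmul_comm', smul_zsmul_comm', hl1, hl2] at this
      convert this using 1
      module
    · rw [hJ]
      have := N.sub_mem (hstab _ h gu) h
      rw [smul_add, smul_zsmul_comm', smul_zsmul_comm', hu1, hu2] at this
      convert this using 1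
      module
  -- The factor 2 is removed by parity. Write i = ga and j = gb with g the gcd, so 2g ∈ J. If a or b
  -- is even, that coordinate lies in J and then so does the other. If both are odd, i + j ∈ J, and
  -- the rotated vector (i + j, -i) gives i ∈ J.
  have hcoord : ∀ i j : ℤ, i • f.fst + j • f.snd ∈ N → i ∈ J ∧ j ∈ J := by
    intro i j h
    obtain ⟨h1, h2⟩ := hdouble i j h
    have hmul : ∀ (c a : ℤ), a ∈ J → c * a ∈ J := fun c a ha => by
      rw [← smul_eq_mul]; exact J.zsmul_mem ha c
    have hg : 2 * (Int.gcd i j : ℤ) ∈ J := by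
      have : 2 * (Int.gcd i j : ℤ) = Int.gcdA i j * (2 * i) + Int.gcdB i j * (2 * j) := by
        rw [Int.gcd_eq_gcd_ab]; ring
      rw [this]
      exact J.add_mem (hmul _ _ h1) (hmul _ _ h2)
    obtain ⟨a, ha⟩ : (Int.gcd i j : ℤ) ∣ i := Int.gcd_dvd_left ..
    obtain ⟨b, hb⟩ : (Int.gcd i j : ℤ) ∣ j := Int.gcd_dvd_right ..
    have heven : ∀ c : ℤ, Even c → (Int.gcd i j : ℤ) * c ∈ J := by
      rintro c ⟨c', rfl⟩
      have : (Int.gcd i j : ℤ) * (c' + c') = c' * (2 * (Int.gcd i j : ℤ)) := by ring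
      rw [this]
      exact hmul _ _ hg
    have hfst : j ∈ J → i ∈ J := fun hj => by
      rw [hJ]
      have := N.sub_mem h ((hJ2 j).mp hj)
      rwa [add_sub_cancel_right] at this
    have hsnd : i ∈ J → j ∈ J := fun hi => by
      rw [hJ2]
      have := N.sub_mem h ((hJ i).mp hi)
      rwa [add_sub_cancel_left] at this
    suffices i ∈ J from ⟨this, hsnd this⟩
    by_cases hae : Even a
    · rw [ha]; exact heven a hae
    by_cases hbe : Even b
    · exact hfst (by rw [hb]; exact heven b hbe)
    have hab : i + j ∈ J := by
      have : i + j = (Int.gcd i j : ℤ) * (a + b) := by rw [mul_add, ← ha, ← hb]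
      rw [this]
      exact heven _ ((Int.not_even_iff_odd.mp hae).add_odd (Int.not_even_iff_odd.mp hbe))
    have h3 := N.sub_mem (hrot i j h) ((hJ _).mp hab)
    rw [add_sub_cancel_left] at h3
    have h4 := J.neg_mem ((hJ2 _).mpr h3)
    rwa [neg_neg] at h4
  obtain ⟨d, hd⟩ := Int.subgroup_cyclic J |>.imp fun d hd => hd
  have hdJ : ∀ a, a ∈ J ↔ d ∣ a := fun a => by
    rw [hd, ← AddSubgroup.zmultiples_eq_closure, Int.mem_zmultiples_iff]
  have hnfst : (n : ℤ) • f.fst = 0 := by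
    have := (f.rel n 0).mpr ⟨dvd_rfl, dvd_zero _⟩
    rwa [zero_smul, add_zero] at this
  obtain ⟨m, hm⟩ : d ∣ n := (hdJ _).mp ((hJ _).mpr (by rw [hnfst]; exact N.zero_mem))
  have hd0 : d ≠ 0 := by rintro rfl; rw [zero_mul] at hm; omega
  have hm0 : m ≠ 0 := by rintro rfl; rw [mul_zero] at hm; omega
  refine ⟨d.natAbs, m.natAbs, ?_, fun t => ?_⟩
  · rw [← Int.natAbs_mul, ← hm, Int.natAbs_natCast]
  have hkey : ∀ i j : ℤ, i • f.fst + j • f.snd ∈ N ↔ m.natAbs • (i • f.fst + j • f.snd) = 0 := by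
    intro i j
    have h1 : m.natAbs • (i • f.fst + j • f.snd) = 0 ↔ m • (i • f.fst + j • f.snd) = 0 := by
      rw [← natCast_zsmul]
      rcases Int.natAbs_eq m with h | h
      · rw [← h]
      · conv_rhs => rw [h]
        rw [neg_smul, neg_eq_zero]
    rw [h1, smul_add, smul_smul, smul_smul, f.rel, hm, mul_comm d m,
      mul_dvd_mul_iff_left hm0, mul_dvd_mul_iff_left hm0, ← hdJ, ← hdJ]
    exact ⟨hcoord i j, fun h => N.add_mem ((hJ _).mp h.1) ((hJ2 _).mp h.2)⟩
  constructor
  · intro ht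
    obtain ⟨i, j, rfl⟩ := f.span t (htors t ht)
    exact (hkey i j).mp ht
  · intro ht
    have hnt : n • t = 0 := by
      have : n = d.natAbs * m.natAbs := by
        rw [← Int.natAbs_mul, ← hm, Int.natAbs_natCast]
      rw [this, mul_smul, ht, smul_zero]
    obtain ⟨i, j, rfl⟩ := f.span t hnt
    exact (hkey i j).mpr ht

/-- The points of order two are not fixed. -/
lemma TorsionFrame.eq_zero_of_fixed (f : TorsionFrame G M 2) {t : M} (ht : 2 • t = 0)
    (h : ∀ g : G, g • t = t) : t = 0 := by
  obtain ⟨g, h1, h2⟩ := f.rot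
  obtain ⟨i, j, rfl⟩ := f.span t ht
  have h3 := h g
  rw [smul_add, smul_zsmul_comm', smul_zsmul_comm', h1, h2, ← sub_eq_zero] at h3
  have h4 : j • f.fst + (-i - j) • f.snd = 0 := by
    rw [← h3]; module
  rw [f.rel] at h4 ⊢
  push_cast at h4 ⊢
  omega

/-- If the point cannot be divided, then the Kummer subgroup is all of the `n`-torsion or its
multiples by `2`. -/
lemma TorsionFrame.kummer_aux (hn : 0 < n) (f : TorsionFrame G M n) (f2 : TorsionFrame G M 2)
    (hQ : ∀ g : G, g • (n • Q) = n • Q)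
    (hind : ∀ m : ℕ, 1 < m → ∀ R : M, (∀ g : G, g • R = R) → n • Q ≠ m • R) :
    (∀ t : M, n • t = 0 → t ∈ kummerSubgroup G hQ) ∨
      ∃ m, 2 * m = n ∧ ∀ t : M, t ∈ kummerSubgroup G hQ ↔ m • t = 0 := by
  obtain ⟨d, m, hdm, hN⟩ := f.exists_eq_torsion hn (kummerSubgroup G hQ)
    (fun t => nsmul_eq_zero_of_mem_kummerSubgroup) (fun t ht g => smul_mem_kummerSubgroup ht g)
  have hd0 : 0 < d := Nat.pos_of_ne_zero fun h => by rw [h, zero_mul] at hdm; omega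
  obtain ⟨τ, hτ1, hτ2⟩ := f.neg
  have hτ : ∀ t : M, n • t = 0 → τ • t = -t := by
    intro t ht
    obtain ⟨i, j, rfl⟩ := f.span t ht
    rw [smul_add, smul_zsmul_comm', smul_zsmul_comm', hτ1, hτ2]
    module
  have hτ' : ∀ t : M, n • t = 0 → τ⁻¹ • t = -t := by
    intro t ht
    rw [inv_smul_eq_iff, smul_neg, hτ t ht, neg_neg]
  -- As τ acts as -1 on the n-torsion, the commutator h of σ and τ is trivial there, and hQ - Q = σS
  -- - S. So σS - S lies in the Kummer subgroup, which is the m-torsion; hence mS is invariant, and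
  -- d·mS = 2nQ.
  set S := Q + τ • Q with hS
  have hSN : ∀ σ : G, σ • S - S ∈ kummerSubgroup G hQ := by
    intro σ
    have htors : ∀ (g : G) (t : M), n • t = 0 → n • (g • t) = 0 := fun g t ht => by
      rw [← smul_nsmul_comm', ht, smul_zero]
    let h := σ * τ * σ⁻¹ * τ⁻¹
    have hh : ∀ t : M, n • t = 0 → h • t = t := by
      intro t ht
      simp only [h, mul_smul]
      rw [hτ' t ht, smul_neg, smul_neg, hτ _ (htors _ _ ht), neg_neg, smul_inv_smul]
    have hστ : σ * τ = h * (τ * σ) := by simp only [h]; group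
    have h1 := nsmul_smul_sub hQ σ
    have h2 := nsmul_smul_sub hQ τ
    refine ⟨h, hh, ?_⟩
    have e1 : σ • τ • Q = h • (τ • Q) - (σ • Q - Q) := by
      have e0 : σ • τ • Q = h • τ • σ • Q := by
        rw [← mul_smul σ, hστ, mul_smul h, mul_smul τ]
      have e3 : τ • σ • Q = τ • Q - (σ • Q - Q) := by
        rw [sub_eq_add_neg, ← hτ _ h1, ← smul_add, add_sub_cancel]
      rw [e0, e3, smul_sub, hh _ h1]
    have e2 : h • (τ • Q) = h • Q + (τ • Q - Q) := by
      have : τ • Q = Q + (τ • Q - Q) := by abel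
      rw [this, smul_add, hh _ h2]
      abel
    rw [hS, smul_add, e1, e2]
    abel
  have hR : ∀ σ : G, σ • (m • S) = m • S := by
    intro σ
    have := (hN _).mp (hSN σ)
    rwa [smul_sub, sub_eq_zero, ← smul_nsmul_comm'] at this
  have hdR : d • (m • S) = 2 • (n • Q) := by
    rw [smul_smul, hdm, hS, smul_add, ← smul_nsmul_comm', hQ, two_smul]
  rcases Nat.even_or_odd' d with ⟨e, he | he⟩
  -- Here d = 2e: nQ and e·mS differ by an invariant point of order dividing two, which is 0, and
  -- indivisibility leaves e = 1.
  · right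
    have h1 : n • Q - e • (m • S) = 0 := by
      apply f2.eq_zero_of_fixed
      · rw [smul_sub, ← hdR, he, mul_smul, sub_self]
      · intro g
        rw [smul_sub, hQ, smul_nsmul_comm', hR]
    have h2 : ¬ 1 < e := fun h => hind e h _ hR (sub_eq_zero.mp h1)
    have he1 : e = 1 := by omega
    subst he1
    exact ⟨m, by rw [← hdm, he], hN⟩
  -- Here d = 2e + 1, so nQ = d·nQ - e·2nQ = d·(nQ - e·mS), and indivisibility leaves d = 1.
  · left
    have h1 : n • Q = d • (n • Q - e • (m • S)) := by
      rw [smul_sub, smul_smul d e, mul_comm d e, mul_smul, hdR, he, add_smul, mul_smul, one_smul,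
        smul_comm 2 e]
      abel
    have h2 : ¬ 1 < d := fun h => hind d h _ (fun g => by
      rw [smul_sub, hQ, smul_nsmul_comm', hR]) h1
    have hd1 : d = 1 := by omega
    rw [hd1, one_mul] at hdm
    intro t ht
    rw [hN, hdm, ht]

/-- If the half of a point that cannot be divided by two is moved, then it is moved by elements
that act trivially on the two-torsion. -/
lemma TorsionFrame.kummer_two (f : TorsionFrame G M 2) {Q : M}
    (hQ : ∀ g : G, g • (2 • Q) = 2 • Q)
    (hind : ∀ R : M, (∀ g : G, g • R = R) → 2 • Q ≠ 2 • R) :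
    ∀ t : M, 2 • t = 0 → t ∈ kummerSubgroup G hQ := by
  obtain ⟨d, m, hdm, hN⟩ := f.exists_eq_torsion two_pos (kummerSubgroup G hQ)
    (fun t => nsmul_eq_zero_of_mem_kummerSubgroup) (fun t ht g => smul_mem_kummerSubgroup ht g)
  have hm2 : m ∣ 2 := ⟨d, by rw [mul_comm]; exact hdm.symm⟩
  -- The case m = 1 has to be excluded. Then elements trivial on the 2-torsion fix Q, and the group
  -- acts on the halves of 2Q through its image in S₃. An element g of order three in this image
  -- fixes a half R, which turns out to be invariant under the group, against `hind`.
  rcases (Nat.dvd_prime Nat.prime_two).mp hm2 with rfl | rfl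
  swap
  · exact fun t ht => (hN t).mpr ht
  exfalso
  obtain ⟨g, h1, h2⟩ := f.rot
  obtain ⟨a, b, hab⟩ : ∃ a b, a = f.fst ∧ b = f.snd := ⟨_, _, rfl, rfl⟩
  rw [← hab.1, ← hab.2] at h1 h2
  have hself : ∀ t : M, 2 • t = 0 → -t = t := fun t ht => by
    rw [neg_eq_iff_add_eq_zero, ← two_smul ℕ, ht]
  have hst : ∀ (g : G) (t : M), 2 • t = 0 → 2 • (g • t) = 0 := fun g t ht => by
    rw [← smul_nsmul_comm', ht, smul_zero]
  have ha : 2 • a = 0 := by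
    have := (f.rel 2 0).mpr ⟨dvd_rfl, dvd_zero _⟩
    rw [zero_smul, add_zero, ← hab.1] at this
    exact_mod_cast this
  have hb : 2 • b = 0 := by
    have := (f.rel 0 2).mpr ⟨dvd_zero _, dvd_rfl⟩
    rw [zero_smul, zero_add, ← hab.2] at this
    exact_mod_cast this
  have hred : ∀ (i : ℤ) (t : M), 2 • t = 0 → i • t = 0 ∨ i • t = t := by
    intro i t ht
    rcases Int.even_or_odd' i with ⟨c, rfl | rfl⟩
    · left; rw [mul_comm, mul_smul, ofNat_zsmul, ht, smul_zero]
    · right; rw [add_smul, one_smul, mul_comm, mul_smul, ofNat_zsmul, ht, smul_zero, zero_add]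
  have hfour : ∀ t : M, 2 • t = 0 → t = 0 ∨ t = a ∨ t = b ∨ t = a + b := by
    intro t ht
    obtain ⟨i, j, rfl⟩ := f.span t ht
    rw [← hab.1, ← hab.2]
    rcases hred i a ha with h | h <;> rcases hred j b hb with h' | h' <;> rw [h, h'] <;> simp
  have hga : g • a = a + b := by rw [h1, sub_eq_add_neg, hself b hb]
  have hgab : g • (a + b) = b := by
    rw [smul_add, hga, h2, add_right_comm, ← two_smul ℕ, ha, zero_add]
  have hcyc : ∀ t : M, 2 • t = 0 → t + g • t + g • g • t = 0 := by
    intro t ht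
    have e : a + b + (a + b) = 0 := by rw [← two_smul ℕ, smul_add, ha, hb, add_zero]
    rcases hfour t ht with h | h | h | h <;> rw [h]
    · simp
    · rw [hga, hgab]; exact (add_assoc a (a + b) b).trans (by rw [← e]; abel)
    · rw [h2, hga, add_comm b, e]
    · rw [hgab, h2, add_assoc, add_comm b a, e]
  have hfix : ∀ t : M, 2 • t = 0 → g • t = t → t = 0 := by
    intro t ht h
    have := hcyc t ht
    rwa [h, h, ← two_smul ℕ, ht, zero_add] at this
  have hfix2 : ∀ t : M, 2 • t = 0 → g • g • t = t → t = 0 := by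
    intro t ht h
    have := hcyc t ht
    rw [h, add_right_comm, ← two_smul ℕ, ht, zero_add] at this
    rwa [smul_eq_zero_iff_eq] at this
  -- An element acting without fixed points and with 1 + g' + g'² = 0 acts as g or g²: it sends a to
  -- a + b = ga or to b = g²a, and this determines it.
  have hclass : ∀ g' : G, (∀ t : M, 2 • t = 0 → g' • t = t → t = 0) →
      (∀ t : M, 2 • t = 0 → t + g' • t + g' • g' • t = 0) →
      (∀ t : M, 2 • t = 0 → g' • t = g • t) ∨ (∀ t : M, 2 • t = 0 → g' • t = g • g • t) := by
    intro g' hf hc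
    have hab0 : ∀ i j : ℤ, i • a + j • b = 0 → (2 : ℤ) ∣ i ∧ (2 : ℤ) ∣ j := by
      intro i j h
      rw [hab.1, hab.2] at h
      exact (f.rel i j).mp h
    have ha0 : a ≠ 0 := fun h => by
      have := (hab0 1 0 (by rw [h]; simp)).1
      omega
    have hsec : g' • g' • a = a + g' • a := by
      have := hc a ha
      rw [add_eq_zero_iff_eq_neg] at this
      rw [← hself _ (hst g' _ (hst g' _ ha)), ← this]
    have hspan : ∀ k : G, (g' • a = k • a) → (g' • (g' • a) = k • (g' • a)) →
        ∀ t : M, 2 • t = 0 → g' • t = k • t := by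
      intro k e1 e2 t ht
      have hb' : ∃ i : ℤ, b = g' • a + i • a := by
        rcases hfour _ (hst g' a ha) with h | h | h | h
        · exact absurd ((smul_eq_zero_iff_eq g').mp h) ha0
        · exact absurd (hf a ha h) ha0
        · exact ⟨0, by rw [h]; simp⟩
        · exact ⟨-1, by rw [h]; simp⟩
      obtain ⟨c, hc⟩ := hb'
      obtain ⟨i, j, rfl⟩ := f.span t ht
      rw [← hab.1, ← hab.2, hc]
      simp only [smul_add, smul_zsmul_comm', e1]
      rw [e1] at e2
      rw [e2]
    rcases hfour _ (hst g' a ha) with h | h | h | h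
    · exact absurd ((smul_eq_zero_iff_eq g').mp h) ha0
    · exact absurd (hf a ha h) ha0
    · right
      intro t ht
      rw [← mul_smul]
      refine hspan _ ?_ ?_ t ht
      · rw [mul_smul, hga, hgab, h]
      · rw [hsec, mul_smul, h, h2, hga]
    · left
      refine hspan _ (by rw [h, hga]) ?_
      rw [hsec, h, hgab, ← add_assoc, ← two_smul ℕ, ha, zero_add]
  have hmain : ∀ σ : G, (∀ t : M, 2 • t = 0 → σ • t = t) → σ • Q = Q := by
    intro σ hσ
    have h3 : σ • Q - Q ∈ kummerSubgroup G hQ := ⟨σ, hσ, by abel⟩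
    rw [hN, one_smul, sub_eq_zero] at h3
    exact h3
  set t := g • Q - Q with ht
  have ht2 : 2 • t = 0 := nsmul_smul_sub hQ g
  -- With gQ = Q + t and t + gt + g²t = 0, gR = Q + t + g²t = Q - gt = R, as gt is 2-torsion.
  set R := Q + g • t with hR
  have hgR : g • R = R := by
    have e : g • Q = Q + t := by rw [ht]; abel
    have := hcyc t ht2
    rw [add_eq_zero_iff_eq_neg, add_comm] at this
    rw [hR, smul_add, e, add_assoc, ← neg_neg (g • g • t), ← this, ← sub_eq_add_neg,
      sub_add_cancel_right, hself _ (hst g t ht2)]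
  have h2R : 2 • R = 2 • Q := by rw [hR, smul_add, hst g t ht2, add_zero]
  have hmainR : ∀ σ : G, (∀ t : M, 2 • t = 0 → σ • t = t) → σ • R = R := by
    intro σ hσ
    rw [hR, smul_add, hmain σ hσ, hσ _ (hst g t ht2)]
  refine hind R (fun h => ?_) h2R.symm
  have hs : 2 • (h • R - R) = 0 := by rw [smul_sub, ← smul_nsmul_comm', h2R, hQ, sub_self]
  have hR' : h • R = R + (h • R - R) := by abel
  have hinv : ∀ u : M, 2 • u = 0 → u = h • (h⁻¹ • u) := fun u _ => (smul_inv_smul h u).symm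
  have hg'R : (h * g * h⁻¹) • h • R = h • R := by
    rw [mul_smul, mul_smul, inv_smul_smul, hgR]
  suffices h • R - R = 0 by rwa [sub_eq_zero] at this
  have hfree : ∀ u : M, 2 • u = 0 → (h * g * h⁻¹) • u = u → u = 0 := by
    intro u hu he
    rw [mul_smul, mul_smul, ← eq_inv_smul_iff] at he
    have := hfix _ (hst _ _ hu) he
    rwa [smul_eq_zero_iff_eq] at this
  have hsum : ∀ u : M, 2 • u = 0 →
      u + (h * g * h⁻¹) • u + (h * g * h⁻¹) • (h * g * h⁻¹) • u = 0 := by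
    intro u hu
    have := congrArg (h • ·) (hcyc _ (hst h⁻¹ u hu))
    simp only [smul_add, smul_zero, smul_inv_smul] at this
    simpa only [mul_smul, inv_smul_smul] using this
  -- The conjugate hgh⁻¹ fixes hR. It differs from g or g² by an element trivial on the 2-torsion,
  -- and all of these fix R, so it fixes R too. Hence g or g² fixes the 2-torsion point hR - R,
  -- which is therefore 0.
  rcases hclass (h * g * h⁻¹) hfree hsum with hc | hc
  · apply hfix _ hs
    have e1 : (g⁻¹ * (h * g * h⁻¹)) • R = R := hmainR _ fun u hu => by
      rw [mul_smul, hc u hu, inv_smul_smul]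
    rw [mul_smul, inv_smul_eq_iff, hgR] at e1
    rw [← hc _ hs, smul_sub, hg'R, e1]
  · apply hfix2 _ hs
    have e1 : ((g * g)⁻¹ * (h * g * h⁻¹)) • R = R := hmainR _ fun u hu => by
      rw [mul_smul, hc u hu, ← mul_smul g, inv_smul_smul]
    rw [mul_smul, inv_smul_eq_iff, mul_smul g, hgR, hgR] at e1
    rw [← hc _ hs, smul_sub, hg'R, e1]

/-- The group permutes transitively the points obtained by dividing a point that cannot be
divided. -/
theorem exists_smul_eq_of_nsmul_eq (f : ∀ n : ℕ, 0 < n → TorsionFrame G M n) {P : M}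
    (hP : ∀ g : G, g • P = P)
    (hind : ∀ m : ℕ, 1 < m → ∀ R : M, (∀ g : G, g • R = R) → P ≠ m • R)
    {n : ℕ} (hn : 0 < n) {Q₁ Q₂ : M} (h₁ : n • Q₁ = P) (h₂ : n • Q₂ = P) :
    ∃ g : G, g • Q₁ = Q₂ := by
  subst h₁
  have hQ12 : n • (Q₂ - Q₁) = 0 := by rw [smul_sub, h₂, sub_self]
  rcases (f n hn).kummer_aux hn (f 2 two_pos) hP hind with h | ⟨m, hm, h⟩
  · obtain ⟨σ, -, hσ⟩ := h _ hQ12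
    exact ⟨σ, by rw [hσ]; abel⟩
  -- Now n = 2m and the Kummer subgroup is the m-torsion. The point mQ₁ is a half of P, so
  -- `kummer_two` gives g with g·mQ₁ = mQ₂. The error Q₂ - gQ₁ is m-torsion and is absorbed by an
  -- element of the Kummer subgroup.
  · have hP2 : ∀ g : G, g • (2 • (m • Q₁)) = 2 • (m • Q₁) := fun g => by
      rw [smul_smul, hm, hP]
    have h4 : 2 • (m • Q₂ - m • Q₁) = 0 := by
      rw [smul_sub, smul_smul, smul_smul, hm, h₂, sub_self]
    obtain ⟨g, -, hg⟩ := (f 2 two_pos).kummer_two hP2 (fun R hR => by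
      rw [smul_smul, hm]; exact hind 2 one_lt_two R hR) _ h4
    have h5 : m • (Q₂ - g • Q₁) = 0 := by
      rw [smul_sub, ← smul_nsmul_comm', hg]; abel
    have h6 : m • (g⁻¹ • (Q₂ - g • Q₁)) = 0 := by rw [← smul_nsmul_comm', h5, smul_zero]
    obtain ⟨σ, -, hσ⟩ := (h _).mpr h6
    exact ⟨g * σ, by rw [mul_smul, hσ, smul_add, smul_inv_smul]; abel⟩

end KummerOrbit

end

/-! ### Lifting matrices to SL₂(ℤ), signs, and part (i). -/

noncomputable section

section Lifting

open Matrix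

/-- Two residue classes modulo `n` that generate the unit ideal lift to coprime integers. -/
lemma ZMod.exists_isCoprime_lift {n : ℕ} [NeZero n] {a c : ZMod n} (h : IsCoprime a c) :
    ∃ a' c' : ℤ, IsCoprime a' c' ∧ (a' : ZMod n) = a ∧ (c' : ZMod n) = c := by
  have hn : n ≠ 0 := NeZero.ne n
  set x := a.val with hx
  set y := c.val + n with hy
  have hxa : (x : ZMod n) = a := ZMod.natCast_zmod_val a
  have hyc : (y : ZMod n) = c := by rw [hy]; push_cast; rw [ZMod.natCast_zmod_val]; simp
  have hy0 : y ≠ 0 := by omega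
  -- This makes x + tn prime to y: a prime divisor of y that divides x divides neither t nor n, and
  -- one that does not divide x divides t. The summand n in y ensures y ≠ 0.
  let t := ∏ p ∈ y.primeFactors with ¬ p ∣ x, p
  refine ⟨((x + t * n : ℕ) : ℤ), (y : ℤ), ?_, by push_cast; simp [hxa], by simpa using hyc⟩
  rw [Nat.isCoprime_iff_coprime]
  refine Nat.coprime_of_dvd fun p hp h1 h2 => ?_
  by_cases hpx : p ∣ x
  · have htn : p ∣ t * n := (Nat.dvd_add_right hpx).mp h1
    rcases hp.dvd_mul.mp htn with h3 | h3
    · obtain ⟨q, hq, hpq⟩ := (hp.prime.dvd_finsetProd_iff _).mp h3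
      rw [Finset.mem_filter, Nat.mem_primeFactors] at hq
      exact hq.2 (((Nat.prime_dvd_prime_iff_eq hp hq.1.1).mp hpq) ▸ hpx)
    · obtain ⟨u, v, huv⟩ := h
      have := congrArg (ZMod.castHom h3 (ZMod p)) huv
      rw [← hxa, ← hyc] at this
      simp only [map_add, map_mul, map_natCast, map_one] at this
      rw [(ZMod.natCast_eq_zero_iff x p).mpr hpx, (ZMod.natCast_eq_zero_iff y p).mpr h2, mul_zero,
        mul_zero, add_zero] at this
      have : Fact p.Prime := ⟨hp⟩
      exact zero_ne_one ‹_›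
  · have hpt : p ∣ t := Finset.dvd_prod_of_mem _ (by
      rw [Finset.mem_filter, Nat.mem_primeFactors]
      exact ⟨⟨hp, h2, hy0⟩, hpx⟩)
    exact hpx ((Nat.dvd_add_left (hpt.mul_right n)).mp h1)

/-- The reduction `SL₂(ℤ) → SL₂(ℤ/n)` is surjective. -/
lemma Matrix.SpecialLinearGroup.map_intCast_zmod_surjective (n : ℕ) [NeZero n] :
    Function.Surjective (SpecialLinearGroup.map (n := Fin 2) (Int.castRingHom (ZMod n))) := by
  intro A
  -- The first column of A lifts to a coprime pair, which is completed to B in SL₂(ℤ). Then B⁻¹A has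
  -- first column (1, 0) and determinant 1, so it is unipotent and lifts too.
  obtain ⟨a, c, hac, ha, hc⟩ := ZMod.exists_isCoprime_lift (A.isCoprime_col 0)
  obtain ⟨B, hB⟩ := hac.exists_SL2_col 0
  set f := SpecialLinearGroup.map (n := Fin 2) (Int.castRingHom (ZMod n)) with hf
  have hB0 : ∀ i, f B i 0 = A i 0 := by
    intro i
    have h1 : f B i 0 = ((B i 0 : ℤ) : ZMod n) := rfl
    rw [h1]
    fin_cases i
    · simpa [hB.1] using ha
    · simpa [hB.2] using hc
  obtain ⟨x, hx⟩ := ZMod.intCast_surjective (((f B)⁻¹ * A) 0 1)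
  let U : SpecialLinearGroup (Fin 2) ℤ := ⟨!![1, x; 0, 1], by simp [Matrix.det_fin_two]⟩
  have hcol : ∀ i, ((f B)⁻¹ * A) i 0 = (1 : Matrix (Fin 2) (Fin 2) (ZMod n)) i 0 := by
    intro i
    have h1 : ((f B)⁻¹ * A) i 0 = ((f B)⁻¹ * f B) i 0 := by
      rw [SpecialLinearGroup.coe_mul, SpecialLinearGroup.coe_mul, Matrix.mul_apply,
        Matrix.mul_apply]
      exact Finset.sum_congr rfl fun j _ => by rw [hB0]
    rw [h1, inv_mul_cancel]; rfl
  have hfU : f U = (f B)⁻¹ * A := by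
    have hdet := ((f B)⁻¹ * A).det_coe
    rw [Matrix.det_fin_two, hcol, hcol] at hdet
    ext i j
    have h1 : f U i j = ((U i j : ℤ) : ZMod n) := rfl
    rw [h1]
    fin_cases j
    · refine Eq.trans ?_ (hcol i).symm
      fin_cases i
      · simp only [U]; exact Int.cast_one
      · simp only [U]; exact Int.cast_zero
    · fin_cases i
      · simpa [U] using hx
      · simp at hdet; simpa [U] using hdet.symm
  exact ⟨B * U, by rw [map_mul, hfU, mul_inv_cancel_left]⟩

end Lifting

section Sign

open Matrix

lemma signMod_comp {R S : Type*} [CommRing R] [CommRing S] (f : R →+* S) (g : S →+* ZMod 2)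
    (A : SpecialLinearGroup (Fin 2) R) :
    signMod g (SpecialLinearGroup.map f A) = signMod (g.comp f) A := rfl

lemma signMod_eq_one_of_map_eq_one {R : Type*} [CommRing R] (f : R →+* ZMod 2)
    {A : SpecialLinearGroup (Fin 2) R} (hA : SpecialLinearGroup.map f A = 1) : signMod f A = 1 := by
  change signTwo (SpecialLinearGroup.toGL (SpecialLinearGroup.map f A)) = 1
  rw [hA, map_one, map_one]

/-- A sign equals its own cube. -/
lemma signMod_eq_one_of_pow_three {R : Type*} [CommRing R] (f : R →+* ZMod 2)
    {A : SpecialLinearGroup (Fin 2) R} (hA : SpecialLinearGroup.map f (A ^ 3) = 1) :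
    signMod f A = 1 := by
  have h := signMod_eq_one_of_map_eq_one f hA
  rw [map_pow] at h
  rcases Int.units_eq_one_or (signMod f A) with h1 | h1
  · exact h1
  · rw [h1] at h; exact absurd h (by decide)

/-- The transvection exchanges (0, 1) and (1, 1) and fixes the other two vectors. It serves to
correct the sign of a lift when n is odd. -/
lemma signTwo_transvection :
    signTwo (SpecialLinearGroup.toGL ⟨!![1, 1; 0, 1], by decide⟩) = -1 := by
  have h : MulAction.toPermHom (LinearMap.GeneralLinearGroup (ZMod 2) (Fin 2 → ZMod 2))
      (Fin 2 → ZMod 2) (Matrix.GeneralLinearGroup.toLin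
        (SpecialLinearGroup.toGL ⟨!![1, 1; 0, 1], by decide⟩)) =
      Equiv.swap ![0, 1] ![1, 1] := by
    ext v : 1
    change Matrix.toLin' (!![1, 1; 0, 1] : Matrix (Fin 2) (Fin 2) (ZMod 2)) v = _
    rw [Matrix.toLin'_apply]
    revert v
    decide
  exact (congrArg Equiv.Perm.sign h).trans
    (Equiv.Perm.sign_swap (show (![0, 1] : Fin 2 → ZMod 2) ≠ ![1, 1] by decide))

lemma ZHat.reduce_comp_intCast (n : ℕ+) :
    (ZHat.reduce n).comp (Int.castRingHom ZHat) = Int.castRingHom (ZMod (n : ℕ)) :=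
  RingHom.ext_int _ _

lemma toGL_map_intCast_mem_SLPlusZHat {B : SpecialLinearGroup (Fin 2) ℤ}
    (hB : signMod (Int.castRingHom (ZMod 2)) B = 1) :
    SpecialLinearGroup.toGL (SpecialLinearGroup.map (Int.castRingHom ZHat) B) ∈ SLPlusZHat := by
  refine Subgroup.mem_map_of_mem _ ?_
  obtain ⟨r, hr⟩ : ∃ r : ZHat →+* ZMod 2, r = ZHat.reduce 2 := ⟨_, rfl⟩
  have h : signMod r (SpecialLinearGroup.map (Int.castRingHom ZHat) B) = 1 := by
    rw [signMod_comp, RingHom.ext_int (r.comp (Int.castRingHom ZHat)) (Int.castRingHom (ZMod 2)), hB]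
  rw [hr] at h
  exact MonoidHom.mem_ker.mpr h

end Sign

namespace WeierstrassCurve

set_option linter.unusedSectionVars false

variable {k : Type*} [Field k] [CharZero k] {W : WeierstrassCurve k} [W.IsElliptic]
  {Ω : Type*} [Field Ω] [Algebra k Ω]

namespace TorsionBasis

variable (b : W.TorsionBasis Ω)

lemma map_reduce_rho (n : ℕ+) (σ : Gal(Ω/k)) :
    Matrix.GeneralLinearGroup.map (ZHat.reduce n) (b.rho σ) = b.rhoMod n σ := by
  ext i j; rfl

lemma mem_fixingSubgroup_cyclotomicExtension [CharZero Ω] [IsAlgClosed Ω] {σ : Gal(Ω/k)}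
    (hσ : ∀ n : ℕ+, (b.rhoMod n σ : Matrix (Fin 2) (Fin 2) (ZMod (n : ℕ))).det = 1) :
    σ ∈ (cyclotomicExtension k Ω).fixingSubgroup := by
  have h : cyclotomicExtension k Ω ≤ IntermediateField.fixedField (Subgroup.zpowers σ) := by
    rw [cyclotomicExtension, IntermediateField.adjoin_le_iff]
    rintro ζ ⟨n, hn, hζ⟩
    have hfix : σ ζ = ζ := b.apply_eq_of_det_rhoMod ⟨n, hn⟩ σ (hσ _) hζ
    rw [SetLike.mem_coe, IntermediateField.mem_fixedField_iff]
    intro τ hτ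
    have h1 : Subgroup.zpowers σ ≤ MulAction.stabilizer Gal(Ω/k) ζ := by
      rw [Subgroup.zpowers_le]
      exact hfix
    exact h1 hτ
  exact (IntermediateField.le_iff_le _ _).mp h (Subgroup.mem_zpowers σ)

/-- A preimage σ of an element of SL₂⁺(Ẑ) has determinant 1 modulo every n, so by the Weil pairing
it already fixes k^cyc and hence K. -/
lemma SLPlusZHat_le_map_rho [CharZero Ω] [IsAlgClosed Ω] (hρ : SLPlusZHat ≤ b.rho.range)
    {K : IntermediateField k Ω} (hK : K ≤ cyclotomicExtension k Ω) :
    SLPlusZHat ≤ K.fixingSubgroup.map b.rho := by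
  intro M hM
  obtain ⟨σ, hσ⟩ := hρ hM
  obtain ⟨A, -, hA⟩ := hM
  refine ⟨σ, ?_, hσ⟩
  refine IntermediateField.fixingSubgroup_antitone hK
    (b.mem_fixingSubgroup_cyclotomicExtension fun n => ?_)
  rw [← b.map_reduce_rho, hσ, ← hA]
  change ((ZHat.reduce n).mapMatrix (A : Matrix (Fin 2) (Fin 2) ZHat)).det = 1
  rw [← RingHom.map_det, A.det_coe, map_one]

lemma toGL_map_intCast_mem_map_rhoMod {H : Subgroup Gal(Ω/k)} (hH : SLPlusZHat ≤ H.map b.rho)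
    (n : ℕ+) {B : Matrix.SpecialLinearGroup (Fin 2) ℤ}
    (hB : signMod (Int.castRingHom (ZMod 2)) B = 1) :
    Matrix.SpecialLinearGroup.toGL
      (Matrix.SpecialLinearGroup.map (Int.castRingHom (ZMod (n : ℕ))) B) ∈
      H.map (b.rhoMod n) := by
  obtain ⟨σ, hσH, hσ⟩ := hH (toGL_map_intCast_mem_SLPlusZHat hB)
  refine ⟨σ, hσH, ?_⟩
  rw [← b.map_reduce_rho, hσ, ← ZHat.reduce_comp_intCast]
  ext i j; rfl

lemma SLPlusZMod_le_map_rhoMod {H : Subgroup Gal(Ω/k)} (hH : SLPlusZHat ≤ H.map b.rho) (n : ℕ+) :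
    SLPlusZMod n ≤ H.map (b.rhoMod n) := by
  have : NeZero (n : ℕ) := ⟨n.pos.ne'⟩
  rintro M ⟨A, hA, rfl⟩
  obtain ⟨B, hB⟩ := Matrix.SpecialLinearGroup.map_intCast_zmod_surjective (n : ℕ) A
  by_cases h2 : 2 ∣ (n : ℕ)
  · rw [dif_pos h2, SetLike.mem_coe, MonoidHom.mem_ker, ← hB] at hA
    rw [← hB]
    refine b.toGL_map_intCast_mem_map_rhoMod hH n ?_
    have h3 := (signMod_comp (Int.castRingHom (ZMod (n : ℕ))) (ZMod.castHom h2 (ZMod 2)) B).symm.trans hA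
    have h4 : (ZMod.castHom h2 (ZMod 2)).comp (Int.castRingHom (ZMod (n : ℕ))) =
      Int.castRingHom (ZMod 2) := RingHom.ext_int _ _
    rw [h4] at h3
    exact h3
  · rcases Int.units_eq_one_or (signMod (Int.castRingHom (ZMod 2)) B) with h | h
    · rw [← hB]; exact b.toGL_map_intCast_mem_map_rhoMod hH n h
    -- For odd n the lift B may have sign -1. The matrix T is trivial modulo n and a transvection
    -- modulo 2, so TB is a lift of the same element with sign 1.
    · let T : Matrix.SpecialLinearGroup (Fin 2) ℤ :=
        ⟨!![1, (n : ℤ); 0, 1], by simp [Matrix.det_fin_two]⟩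
      have hT1 : Matrix.SpecialLinearGroup.map (Int.castRingHom (ZMod (n : ℕ))) T = 1 := by
        ext i j
        change (((!![1, (n : ℤ); 0, 1] : Matrix _ _ ℤ) i j : ℤ) : ZMod (n : ℕ)) = _
        fin_cases i <;> fin_cases j <;> simp
      have hT2 : signMod (Int.castRingHom (ZMod 2)) T = -1 := by
        have hn1 : ((n : ℕ) : ZMod 2) = 1 := by
          rw [ZMod.natCast_eq_one_iff_odd]
          exact Nat.not_even_iff_odd.mp fun h => h2 h.two_dvd
        have hT : Matrix.SpecialLinearGroup.map (Int.castRingHom (ZMod 2)) T =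
            ⟨!![1, 1; 0, 1], by decide⟩ := by
          ext i j
          change (((!![1, (n : ℤ); 0, 1] : Matrix _ _ ℤ) i j : ℤ) : ZMod 2) = _
          fin_cases i <;> fin_cases j <;> simp [hn1]
        exact (congrArg (fun A => signTwo (Matrix.SpecialLinearGroup.toGL A)) hT).trans
          signTwo_transvection
      have := b.toGL_map_intCast_mem_map_rhoMod hH n (B := T * B) (by rw [map_mul, hT2, h]; rfl)
      rwa [map_mul, hT1, one_mul, hB] at this

end TorsionBasis

end WeierstrassCurve

end

/-! ### Transitivity of the Galois group on division points. -/

noncomputable section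

namespace WeierstrassCurve

set_option linter.unusedSectionVars false

open scoped Classical

variable {k : Type*} [Field k] [CharZero k] {W : WeierstrassCurve k} [W.IsElliptic]
  {Ω : Type*} [Field Ω] [Algebra k Ω]

/-- The action of the Galois group on the points. -/
instance : DistribMulAction Gal(Ω/k) (W⁄Ω).toAffine.Point where
  smul σ := W.galPoint σ
  one_smul x := by
    change W.galPoint 1 x = x
    cases x <;> rfl
  mul_smul σ τ x := by
    change W.galPoint (σ * τ) x = W.galPoint σ (W.galPoint τ x)
    cases x <;> rfl
  smul_zero σ := (W.galPoint σ).map_zero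
  smul_add σ := (W.galPoint σ).map_add

namespace TorsionBasis

variable (b : W.TorsionBasis Ω)

/-- The basis of the `n`-torsion. -/
def vec (n : ℕ+) (i : Fin 2) : (W⁄Ω).toAffine.Point := (b.coord n).symm (Pi.single i 1)

lemma coe_symm_intCast (n : ℕ+) (i j : ℤ) :
    (((b.coord n).symm ![(i : ZMod (n : ℕ)), (j : ZMod (n : ℕ))] : W.torsionPoints Ω n) :
      (W⁄Ω).toAffine.Point) = i • b.vec n 0 + j • b.vec n 1 := by
  have h : (b.coord n).symm ![(i : ZMod (n : ℕ)), (j : ZMod (n : ℕ))] =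
      i • (b.coord n).symm (Pi.single 0 1) + j • (b.coord n).symm (Pi.single 1 1) := by
    rw [← map_zsmul, ← map_zsmul, ← map_add]
    congr 1
    funext l
    fin_cases l <;> simp
  rw [h]
  rfl

lemma smul_vec (n : ℕ+) (σ : Gal(Ω/k)) (B : Matrix (Fin 2) (Fin 2) ℤ)
    (hB : ∀ i j, (b.rhoMod n σ : Matrix (Fin 2) (Fin 2) (ZMod (n : ℕ))) i j = (B i j : ZMod (n : ℕ)))
    (j : Fin 2) : σ • b.vec n j = B 0 j • b.vec n 0 + B 1 j • b.vec n 1 := by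
  rw [← coe_symm_intCast]
  have h := b.rhoMod_mulVec n σ ((b.coord n).symm (Pi.single j 1))
  rw [AddEquiv.apply_symm_apply, Matrix.mulVec_single_one, eq_comm, ← AddEquiv.eq_symm_apply] at h
  have h2 : (b.rhoMod n σ : Matrix (Fin 2) (Fin 2) (ZMod (n : ℕ))).col j =
      ![(B 0 j : ZMod (n : ℕ)), (B 1 j : ZMod (n : ℕ))] := by
    funext i
    rw [Matrix.col_apply, hB]
    fin_cases i <;> rfl
  rw [← h2]
  exact congrArg Subtype.val h

/-- If the image of a subgroup contains `SL₂⁺`, then the coordinates give a frame. -/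
def torsionFrame {H : Subgroup Gal(Ω/k)} (hH : SLPlusZHat ≤ H.map b.rho) (n : ℕ+) :
    TorsionFrame H (W⁄Ω).toAffine.Point n :=
  have key : ∀ B : Matrix.SpecialLinearGroup (Fin 2) ℤ,
      signMod (Int.castRingHom (ZMod 2)) B = 1 → ∃ g : H, ∀ j, g • b.vec n j =
        B 0 j • b.vec n 0 + B 1 j • b.vec n 1 := by
    intro B hB
    obtain ⟨σ, hσH, hσ⟩ := b.toGL_map_intCast_mem_map_rhoMod hH n hB
    refine ⟨⟨σ, hσH⟩, b.smul_vec _ σ B fun i j => ?_⟩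
    rw [hσ]
    rfl
  { fst := b.vec n 0
    snd := b.vec n 1
    rel := by
      intro i j
      rw [← coe_symm_intCast, ZeroMemClass.coe_eq_zero, AddEquiv.map_eq_zero_iff]
      rw [← ZMod.intCast_zmod_eq_zero_iff_dvd, ← ZMod.intCast_zmod_eq_zero_iff_dvd, funext_iff, Fin.forall_fin_two]
      rfl
    span := by
      intro t ht
      obtain ⟨i, hi⟩ := ZMod.intCast_surjective (b.coord n ⟨t, ht⟩ 0)
      obtain ⟨j, hj⟩ := ZMod.intCast_surjective (b.coord n ⟨t, ht⟩ 1)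
      refine ⟨i, j, ?_⟩
      rw [← coe_symm_intCast]
      have : b.coord n ⟨t, ht⟩ = ![(i : ZMod (n : ℕ)), (j : ZMod (n : ℕ))] := by
        funext l
        fin_cases l
        exacts [hi.symm, hj.symm]
      rw [← this, AddEquiv.symm_apply_apply]
    upper := by
      obtain ⟨g, hg⟩ := key ⟨!![1, 2; 0, 1], by decide⟩
        (signMod_eq_one_of_map_eq_one _ (by ext i j; fin_cases i <;> fin_cases j <;> rfl))
      exact ⟨g, (hg 0).trans (by simp), (hg 1).trans (by simp)⟩
    lower := by
      obtain ⟨g, hg⟩ := key ⟨!![1, 0; 2, 1], by decide⟩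
        (signMod_eq_one_of_map_eq_one _ (by ext i j; fin_cases i <;> fin_cases j <;> rfl))
      exact ⟨g, (hg 0).trans (by simp), (hg 1).trans (by simp)⟩
    rot := by
      -- The cube of this matrix is -1, which is trivial modulo 2.
      obtain ⟨g, hg⟩ := key ⟨!![1, 1; -1, 0], by decide⟩
        (signMod_eq_one_of_pow_three _ (by ext i j; fin_cases i <;> fin_cases j <;> rfl))
      exact ⟨g, (hg 0).trans (by simp [sub_eq_add_neg]), (hg 1).trans (by simp)⟩
    neg := by
      obtain ⟨g, hg⟩ := key ⟨!![-1, 0; 0, -1], by decide⟩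
        (signMod_eq_one_of_map_eq_one _ (by ext i j; fin_cases i <;> fin_cases j <;> rfl))
      exact ⟨g, (hg 0).trans (by simp), (hg 1).trans (by simp)⟩ }

end TorsionBasis

/-- The map `E(F) → E(Ω)` induced by a homomorphism `F → Ω`. -/
def mapPoint {F : Type*} [Field F] [Algebra k F] (W : WeierstrassCurve k) (f : F →ₐ[k] Ω) :
    (W⁄F).toAffine.Point →+ (W⁄Ω).toAffine.Point :=
  Affine.Point.map (W' := W.toAffine) f

lemma mapPoint_nsmul {F : Type*} [Field F] [Algebra k F] (W : WeierstrassCurve k) (f : F →ₐ[k] Ω)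
    (n : ℕ) (P : (W⁄F).toAffine.Point) : W.mapPoint f (n • P) = n • W.mapPoint f P :=
  map_nsmul _ _ _

lemma mapPoint_injective {F : Type*} [Field F] [Algebra k F] (W : WeierstrassCurve k)
    (f : F →ₐ[k] Ω) : Function.Injective (W.mapPoint f) :=
  Affine.Point.map_injective (W' := W.toAffine) f

lemma smul_mapPoint {K : IntermediateField k Ω} {σ : Gal(Ω/k)} (hσ : σ ∈ K.fixingSubgroup)
    (P : (W⁄K).toAffine.Point) : σ • W.mapPoint K.val P = W.mapPoint K.val P := by
  have h : ∀ x : K, σ x = x := fun x => hσ x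
  rcases P with _ | ⟨x, y, hP⟩
  · rfl
  · refine (Affine.Point.some.injEq ..).mpr ⟨h x, h y⟩

/-- Galois descent, one coordinate at a time: K is the fixed field of its fixing subgroup. -/
lemma exists_mapPoint_eq [IsGalois k Ω] {K : IntermediateField k Ω} {Q : (W⁄Ω).toAffine.Point}
    (hQ : ∀ σ ∈ K.fixingSubgroup, σ • Q = Q) : ∃ P, W.mapPoint K.val P = Q := by
  have hfix : ∀ x : Ω, (∀ σ ∈ K.fixingSubgroup, σ x = x) → x ∈ K := by
    intro x hx
    rw [← InfiniteGalois.fixedField_fixingSubgroup K, IntermediateField.mem_fixedField_iff]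
    exact hx
  rcases Q with _ | ⟨x, y, h⟩
  · exact ⟨0, map_zero _⟩
  · have hQ' : ∀ σ ∈ K.fixingSubgroup, σ x = x ∧ σ y = y := fun σ hσ =>
      (Affine.Point.some.injEq ..).mp (hQ σ hσ)
    let x' : K := ⟨x, hfix x fun σ hσ => (hQ' σ hσ).1⟩
    let y' : K := ⟨y, hfix y fun σ hσ => (hQ' σ hσ).2⟩
    have h' : (W⁄K).toAffine.Nonsingular x' y' :=
      (Affine.baseChange_nonsingular (W := W.toAffine) (f := K.val) (x := x') (y := y')
        K.val.injective).mp h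
    exact ⟨.some x' y' h', rfl⟩

/-- The Galois group of `K` permutes transitively the points of `E(Ω)` that are obtained by dividing
a point of `E(K)` that cannot be divided in `E(K)`. -/
theorem exists_smul_eq_of_nsmul_eq_mapPoint [IsGalois k Ω] (b : W.TorsionBasis Ω)
    {K : IntermediateField k Ω} (hK : SLPlusZHat ≤ K.fixingSubgroup.map b.rho)
    {P : (W⁄K).toAffine.Point} (hP : (W⁄K).IsIndivisible P) {n : ℕ} (hn : 0 < n)
    {Q₁ Q₂ : (W⁄Ω).toAffine.Point} (h₁ : n • Q₁ = W.mapPoint K.val P)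
    (h₂ : n • Q₂ = W.mapPoint K.val P) : ∃ σ ∈ K.fixingSubgroup, σ • Q₁ = Q₂ := by
  obtain ⟨g, hg⟩ := exists_smul_eq_of_nsmul_eq (G := K.fixingSubgroup)
    (fun n hn => b.torsionFrame hK ⟨n, hn⟩) (P := W.mapPoint K.val P)
    (fun g => smul_mapPoint g.2 P) (fun m hm R hR h => by
      obtain ⟨R', rfl⟩ := exists_mapPoint_eq (Q := R) fun σ hσ => hR ⟨σ, hσ⟩
      refine hP m hm R' (W.mapPoint_injective K.val (h.trans ?_))
      exact (W.mapPoint_nsmul K.val m R').symm) hn h₁ h₂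
  exact ⟨g, g.2, hg⟩

end WeierstrassCurve

end

/-! ### The invariant derivation and its behaviour under multiplication by n. -/

noncomputable section

namespace WeierstrassCurve

set_option linter.unusedSectionVars false

open scoped Classical
open Polynomial IsDedekindDomain

universe u

section LogDerivative

variable {F L : Type*} [Field F] [Field L] [Algebra F L] {E : WeierstrassCurve L}

/-- `R ∈ E(L)` has the logarithmic derivative `c` with respect to `D`: the derivation `D` is at `R`
the multiple by `c` of the invariant derivation of `E`. -/
def HasLogDeriv (D : Derivation F L L) : E.toAffine.Point → L → Prop
  | 0, c => c = 0
  | .some x y _, c => D x = c * (2 * y + E.a₁ * x + E.a₃) ∧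
      D y = c * (3 * x ^ 2 + 2 * E.a₂ * x + E.a₄ - E.a₁ * y)

variable {D : Derivation F L L}

lemma hasLogDeriv_some {x y c : L} {h : E.toAffine.Nonsingular x y} :
    HasLogDeriv D (.some x y h) c ↔ D x = c * (2 * y + E.a₁ * x + E.a₃) ∧
      D y = c * (3 * x ^ 2 + 2 * E.a₂ * x + E.a₄ - E.a₁ * y) := Iff.rfl

/-- Up to sign, the factors are the two partial derivatives of the equation, which do not both
vanish at a nonsingular point. -/
lemma eq_zero_of_mul_invariant {x y c : L} (h : E.toAffine.Nonsingular x y)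
    (h1 : c * (2 * y + E.a₁ * x + E.a₃) = 0)
    (h2 : c * (3 * x ^ 2 + 2 * E.a₂ * x + E.a₄ - E.a₁ * y) = 0) : c = 0 := by
  by_contra hc
  rw [mul_eq_zero, or_iff_right hc] at h1 h2
  have := ((Affine.nonsingular_iff' _ _).mp h).2
  rcases this with h3 | h3
  · exact h3 (by linear_combination -h2)
  · exact h3 h1

/-- The tangent to the curve at a point of a line, in terms of the three points of intersection. -/
lemma derivative_slope {x₁ x₂ y₁ y₂ : L} (h₁ : E.toAffine.Equation x₁ y₁)
    (h₂ : E.toAffine.Equation x₂ y₂) (hxy : ¬(x₁ = x₂ ∧ y₁ = E.toAffine.negY x₂ y₂)) {ℓ x₃ : L}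
    (hℓ : ℓ = E.toAffine.slope x₁ x₂ y₁ y₂) (hx₃ : x₃ = E.toAffine.addX x₁ x₂ ℓ) (t : L) :
    3 * t ^ 2 + 2 * E.a₂ * t + E.a₄ - E.a₁ * (ℓ * (t - x₁) + y₁) -
      ℓ * (2 * (ℓ * (t - x₁) + y₁) + E.a₁ * t + E.a₃) =
      (t - x₁) * (t - x₂) + (t - x₁) * (t - x₃) + (t - x₂) * (t - x₃) := by
  -- On the line, the Weierstrass polynomial is -(t - x₁)(t - x₂)(t - x₃); the identity is the
  -- derivative of this in t.
  have h := congrArg (Polynomial.eval t) (Affine.derivative_addPolynomial_slope h₁ h₂ hxy)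
  rw [← hℓ, ← hx₃, Affine.addPolynomial_eq] at h
  simp only [Cubic.toPoly, Polynomial.derivative_add, Polynomial.derivative_mul,
    Polynomial.derivative_C, Polynomial.derivative_X_pow, Polynomial.derivative_X,
    Polynomial.derivative_neg, Polynomial.eval_add, Polynomial.eval_mul, Polynomial.eval_sub,
    Polynomial.eval_neg, Polynomial.eval_X, Polynomial.eval_C, Polynomial.eval_pow,
    zero_mul, zero_add, mul_one, add_zero,
    map_natCast, Polynomial.eval_natCast] at h
  push_cast at h
  linear_combination -h

/-- The logarithmic derivative is additive. -/
theorem HasLogDeriv.add (h1 : D E.a₁ = 0) (h2 : D E.a₂ = 0) (h3 : D E.a₃ = 0) (h4 : D E.a₄ = 0)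
    {R S : E.toAffine.Point} {c d : L} (hR : HasLogDeriv D R c) (hS : HasLogDeriv D S d) :
    HasLogDeriv D (R + S) (c + d) := by
  rcases R with _ | ⟨x₁, y₁, e₁⟩
  · have hc : c = 0 := hR
    have e0 : (Affine.Point.zero : E.toAffine.Point) + S = S := zero_add S
    rwa [hc, zero_add, e0]
  rcases S with _ | ⟨x₂, y₂, e₂⟩
  · have hd : d = 0 := hS
    have e0 : Affine.Point.some x₁ y₁ e₁ + (Affine.Point.zero : E.toAffine.Point) =
      Affine.Point.some x₁ y₁ e₁ := add_zero _
    rwa [hd, add_zero, e0]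
  rw [hasLogDeriv_some] at hR hS
  -- Opposite points have sum 0, so c + d = 0 is to be shown; it holds because c + d annihilates
  -- both partial derivatives.
  by_cases hxy : x₁ = x₂ ∧ y₁ = E.toAffine.negY x₂ y₂
  · rw [Affine.Point.add_of_Y_eq hxy.1 hxy.2]
    obtain ⟨rfl, hy⟩ := hxy
    change c + d = 0
    rw [Affine.negY] at hy
    have hDy : D y₁ = -D y₂ - E.a₁ * D x₁ := by
      rw [hy, map_sub, map_sub, map_neg, Derivation.leibniz, h3, h1]
      simp
    refine eq_zero_of_mul_invariant e₁ ?_ ?_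
    · linear_combination -hR.1 + hS.1 + 2 * d * hy
    · linear_combination -hR.2 - hS.2 - E.a₁ * hS.1 - d * E.a₁ * hy + hDy
  · rw [Affine.Point.add_some hxy, hasLogDeriv_some]
    obtain ⟨ℓ, hℓ⟩ : ∃ ℓ, ℓ = E.toAffine.slope x₁ x₂ y₁ y₂ := ⟨_, rfl⟩
    obtain ⟨x₃, hx₃⟩ : ∃ x₃, x₃ = E.toAffine.addX x₁ x₂ ℓ := ⟨_, rfl⟩
    have key := derivative_slope e₁.1 e₂.1 hxy hℓ hx₃
    rw [← hℓ]
    have hx₃' : x₃ = ℓ ^ 2 + E.a₁ * ℓ - E.a₂ - x₁ - x₂ := hx₃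
    have hline : ℓ * (x₁ - x₂) = y₁ - y₂ := by
      by_cases hx : x₁ = x₂
      · have hy : y₁ = y₂ := by
          refine Affine.Y_eq_of_Y_ne e₁.1 e₂.1 hx fun h => hxy ⟨hx, h⟩
        rw [hx, hy, sub_self, sub_self, mul_zero]
      · rw [hℓ, Affine.slope_of_X_ne hx, div_mul_cancel₀ _ (sub_ne_zero.mpr hx)]
    -- Everything reduces to the derivative of the slope. For a chord it comes from differentiating
    -- ℓ(x₁ - x₂) = y₁ - y₂, for a tangent from differentiating ℓ(2y + a₁x + a₃) = 3x² + 2a₂x + a₄ -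
    -- a₁y.
    have hDℓ : D ℓ = c * (x₁ - x₃) + d * (x₂ - x₃) := by
      have hD := congrArg D hline
      rw [Derivation.leibniz, map_sub, map_sub, smul_eq_mul, smul_eq_mul] at hD
      by_cases hx : x₁ = x₂
      · have hy' : y₁ ≠ E.toAffine.negY x₂ y₂ := fun h => hxy ⟨hx, h⟩
        have hy : y₁ = y₂ := Affine.Y_eq_of_Y_ne e₁.1 e₂.1 hx hy'
        subst hx
        subst hy
        have hψ : 2 * y₁ + E.a₁ * x₁ + E.a₃ ≠ 0 := fun h => hy' (by
          rw [Affine.negY]; linear_combination h)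
        have hcd : c = d := by
          rw [hS.1] at hR
          exact (mul_right_cancel₀ hψ hR.1).symm
        subst hcd
        have hℓψ : ℓ * (2 * y₁ + E.a₁ * x₁ + E.a₃) =
            3 * x₁ ^ 2 + 2 * E.a₂ * x₁ + E.a₄ - E.a₁ * y₁ := by
          have := key x₁
          linear_combination -this
        have hD2 := congrArg D hℓψ
        simp only [Derivation.leibniz, map_add, map_sub, h1, h2, h3, h4, smul_eq_mul, mul_zero,
          add_zero, pow_two, hR.1, hR.2] at hD2
        have h3' : D (3 : L) = 0 := D.map_natCast 3
        have h2' : D (2 : L) = 0 := D.map_natCast 2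
        rw [h3', h2'] at hD2
        refine mul_right_cancel₀ hψ ?_
        linear_combination hD2 + c * (2 * y₁ + E.a₁ * x₁ + E.a₃) * 2 * hx₃' +
          c * (E.a₁ + 2 * ℓ) * hℓψ
      · refine mul_right_cancel₀ (sub_ne_zero.mpr hx) ?_
        have k1 := key x₁
        have k2 := key x₂
        rw [hR.1, hR.2, hS.1, hS.2] at hD
        linear_combination hD + c * k1 - d * k2 + d * (E.a₁ + 2 * ℓ) * hline
    have hDx₃ : D x₃ = (2 * ℓ + E.a₁) * D ℓ - D x₁ - D x₂ := by
      rw [hx₃']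
      simp only [Derivation.leibniz, map_add, map_sub, h1, h2, smul_eq_mul, mul_zero, add_zero,
        pow_two, sub_zero]
      ring
    have hy₃ : E.toAffine.addY x₁ x₂ y₁ ℓ = -(ℓ * (x₃ - x₁) + y₁) - E.a₁ * x₃ - E.a₃ := by
      rw [Affine.addY, Affine.negY, Affine.negAddY, ← hx₃]
    have hDy₃ : D (E.toAffine.addY x₁ x₂ y₁ ℓ) =
        -(D ℓ * (x₃ - x₁) + ℓ * (D x₃ - D x₁) + D y₁) - E.a₁ * D x₃ := by
      rw [hy₃]
      simp only [Derivation.leibniz, map_add, map_sub, map_neg, h1, h3, smul_eq_mul, mul_zero,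
        add_zero, sub_zero]
      ring
    have hDx₃' : D x₃ = (c + d) * (2 * E.toAffine.addY x₁ x₂ y₁ ℓ + E.a₁ * x₃ + E.a₃) := by
      rw [hDx₃, hDℓ, hR.1, hS.1, hy₃]
      linear_combination (-2) * d * hline
    rw [← hx₃]
    refine ⟨hDx₃', ?_⟩
    rw [hDy₃, hDx₃', hDℓ, hR.1, hR.2, hy₃]
    linear_combination (-(c + d)) * key x₃ - c * key x₁

lemma HasLogDeriv.nsmul (h1 : D E.a₁ = 0) (h2 : D E.a₂ = 0) (h3 : D E.a₃ = 0) (h4 : D E.a₄ = 0)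
    {R : E.toAffine.Point} {c : L} (hR : HasLogDeriv D R c) (n : ℕ) :
    HasLogDeriv D (n • R) (n * c) := by
  induction n with
  | zero => rw [zero_smul, Nat.cast_zero, zero_mul]; rfl
  | succ n ih =>
    rw [succ_nsmul, Nat.cast_succ, add_mul, one_mul]
    exact ih.add h1 h2 h3 h4 hR

end LogDerivative

section InvariantDerivation

variable {F : Type u} [Field F] (E : WeierstrassCurve F)

local notation "𝕃" => E.toAffine.FunctionField

/-- The function `2 y + a₁ x + a₃`, the value of the invariant derivation at `x`. -/
def invX : E.toAffine.CoordinateRing :=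
  2 * E.yCoord + algebraMap F _ E.a₁ * E.xCoord + algebraMap F _ E.a₃

/-- The function `3 x² + 2 a₂ x + a₄ - a₁ y`, the value of the invariant derivation at `y`. -/
def invY : E.toAffine.CoordinateRing :=
  3 * E.xCoord ^ 2 + 2 * algebraMap F _ E.a₂ * E.xCoord + algebraMap F _ E.a₄ -
    algebraMap F _ E.a₁ * E.yCoord

/-- The vector field with components `invX` and `invY` is tangent to the curve. A homomorphism to
the dual numbers that lifts the inclusion amounts to a derivation, so this point defines one. -/
lemma dual_equation : (E⁄(DualNumber 𝕃)).toAffine.Equation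
    (TrivSqZeroExt.inl (toFF E E.xCoord) + TrivSqZeroExt.inr (toFF E E.invX))
    (TrivSqZeroExt.inl (toFF E E.yCoord) + TrivSqZeroExt.inr (toFF E E.invY)) := by
  have h := congrArg (toFF E) E.yCoord_sq
  have e : ∀ c : F, algebraMap F (DualNumber 𝕃) c = TrivSqZeroExt.inl (algebraMap F 𝕃 c) :=
    fun c => rfl
  rw [Affine.equation_iff]
  simp only [baseChange, map_a₁, map_a₂, map_a₃, map_a₄, map_a₆, e]
  simp only [map_add, map_mul, map_pow, AlgHom.commutes] at h
  ext
  · simp only [TrivSqZeroExt.fst_add, TrivSqZeroExt.fst_mul, TrivSqZeroExt.fst_pow,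
      TrivSqZeroExt.fst_inl, TrivSqZeroExt.fst_inr, add_zero]
    linear_combination h
  · simp only [TrivSqZeroExt.snd_add, TrivSqZeroExt.snd_mul, TrivSqZeroExt.snd_pow,
      TrivSqZeroExt.fst_add, TrivSqZeroExt.fst_mul, TrivSqZeroExt.fst_pow,
      TrivSqZeroExt.fst_inl, TrivSqZeroExt.fst_inr, TrivSqZeroExt.snd_inl, TrivSqZeroExt.snd_inr,
      add_zero, zero_add, smul_eq_mul, MulOpposite.smul_eq_mul_unop, MulOpposite.unop_op,
      invX, invY, map_add, map_sub, map_mul, map_pow, AlgHom.commutes, map_ofNat,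
      nsmul_eq_mul, Nat.pred_succ, pow_one]
    push_cast
    ring

/-- The map `f ↦ f + ε D(f)` on the coordinate ring, for the invariant derivation `D`. -/
def dualCoord : E.toAffine.CoordinateRing →ₐ[F] DualNumber 𝕃 := E.evalCoord _ _ E.dual_equation

lemma fst_dualCoord (a : E.toAffine.CoordinateRing) : (E.dualCoord a).fst = toFF E a := by
  have : (TrivSqZeroExt.fstHom F 𝕃 𝕃).comp E.dualCoord = toFF E := by
    apply coordinateRing_algHom_ext
    · simp [dualCoord, evalCoord_xCoord]
    · simp [dualCoord, evalCoord_yCoord]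
  exact congrArg (fun f => f a) this

/-- The map `f ↦ f + ε D(f)` on the function field, for the invariant derivation `D`. -/
def dualFF : 𝕃 →+* DualNumber 𝕃 :=
  IsLocalization.lift (M := nonZeroDivisors E.toAffine.CoordinateRing) (g := E.dualCoord.toRingHom)
    (fun s => by
      rw [TrivSqZeroExt.isUnit_iff_isUnit_fst]
      change IsUnit (E.dualCoord s).fst
      rw [fst_dualCoord, isUnit_iff_ne_zero]
      exact (map_ne_zero_iff _ (IsFractionRing.injective _ 𝕃)).mpr (nonZeroDivisors.ne_zero s.2))

lemma dualFF_toFF (a : E.toAffine.CoordinateRing) : E.dualFF (toFF E a) = E.dualCoord a :=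
  IsLocalization.lift_eq _ a

lemma fst_dualFF (f : 𝕃) : (E.dualFF f).fst = f := by
  have : ((TrivSqZeroExt.fstHom F 𝕃 𝕃).toRingHom.comp E.dualFF) = RingHom.id 𝕃 := by
    refine IsLocalization.ringHom_ext (nonZeroDivisors E.toAffine.CoordinateRing) ?_
    refine RingHom.ext fun a => ?_
    change (E.dualFF (toFF E a)).fst = toFF E a
    rw [dualFF_toFF, fst_dualCoord]
  exact congrArg (fun g => g f) this

/-- The invariant derivation of the function field. -/
def invDerivation : Derivation F 𝕃 𝕃 :=
  Derivation.mk'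
    { toFun := fun f => (E.dualFF f).snd
      map_add' := fun f g => by rw [map_add, TrivSqZeroExt.snd_add]
      map_smul' := fun c f => by
        have h : E.dualFF (algebraMap F 𝕃 c) = algebraMap F _ c := by
          have := E.dualFF_toFF (algebraMap F _ c)
          rw [AlgHom.commutes, AlgHom.commutes] at this
          exact this
        rw [Algebra.smul_def, map_mul, h, ← Algebra.smul_def, TrivSqZeroExt.snd_smul]
        rfl }
    (fun f g => by
      change (E.dualFF (f * g)).snd = f • (E.dualFF g).snd + g • (E.dualFF f).snd
      rw [map_mul, TrivSqZeroExt.snd_mul, fst_dualFF, fst_dualFF, op_smul_eq_smul])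

lemma invDerivation_xCoord : E.invDerivation (toFF E E.xCoord) = toFF E E.invX := by
  change (E.dualFF _).snd = _
  rw [dualFF_toFF, dualCoord, evalCoord_xCoord, TrivSqZeroExt.snd_add, TrivSqZeroExt.snd_inl,
    TrivSqZeroExt.snd_inr, zero_add]

lemma invDerivation_yCoord : E.invDerivation (toFF E E.yCoord) = toFF E E.invY := by
  change (E.dualFF _).snd = _
  rw [dualFF_toFF, dualCoord, evalCoord_yCoord, TrivSqZeroExt.snd_add, TrivSqZeroExt.snd_inl,
    TrivSqZeroExt.snd_inr, zero_add]

/-- The invariant derivation preserves the coordinate ring. -/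
lemma exists_invDerivation_eq (a : E.toAffine.CoordinateRing) :
    ∃ b, E.invDerivation (toFF E a) = toFF E b := by
  have h : ∀ p : F[X], ∃ b, E.invDerivation (toFF E (aeval E.xCoord p)) = toFF E b := by
    intro p
    refine ⟨aeval E.xCoord (derivative p) * E.invX, ?_⟩
    rw [← aeval_algHom_apply, Derivation.map_aeval, invDerivation_xCoord, aeval_algHom_apply,
      map_mul, smul_eq_mul]
  obtain ⟨p, q, rfl⟩ := E.exists_eq_add_mul a
  obtain ⟨b, hb⟩ := h p
  obtain ⟨c, hc⟩ := h q
  refine ⟨b + (aeval E.xCoord q * E.invY + E.yCoord * c), ?_⟩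
  rw [map_add, map_add, map_mul, Derivation.leibniz, hb, hc, invDerivation_yCoord]
  simp only [map_add, map_mul, smul_eq_mul]

variable {E} [E.IsElliptic]

lemma hasLogDeriv_genericPt : HasLogDeriv E.invDerivation E.genericPt 1 := by
  rw [genericPt_eq]
  refine hasLogDeriv_some.mpr ⟨?_, ?_⟩
  · refine E.invDerivation_xCoord.trans ?_
    simp only [invX, map_add, map_mul, AlgHom.commutes, map_ofNat, one_mul]
    rfl
  · refine E.invDerivation_yCoord.trans ?_
    simp only [invY, map_add, map_sub, map_mul, map_pow, AlgHom.commutes, map_ofNat, one_mul]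
    rfl

/-- Multiplication by n multiplies the invariant differential by n. In characteristic zero this is
the source of three facts: the multiple is not 0, it is not constant, and [n] is unramified. -/
lemma hasLogDeriv_nsmul_genericPt (n : ℕ) :
    HasLogDeriv E.invDerivation (n • E.genericPt) (n : 𝕃) := by
  have := E.hasLogDeriv_genericPt.nsmul (E.invDerivation.map_algebraMap _)
    (E.invDerivation.map_algebraMap _) (E.invDerivation.map_algebraMap _)
    (E.invDerivation.map_algebraMap _) n
  rwa [mul_one] at this

variable [CharZero F]

instance : CharZero 𝕃 := charZero_of_injective_algebraMap (algebraMap F 𝕃).injective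

lemma nsmul_genericPt_ne_zero {n : ℕ} (hn : 0 < n) : n • E.genericPt ≠ 0 := by
  intro h
  have h1 := E.hasLogDeriv_nsmul_genericPt n
  rw [h] at h1
  exact hn.ne' (Nat.cast_eq_zero.mp h1)

/-- The multiples of the generic point are not constant. -/
lemma not_isAlgebraic_of_nsmul_genericPt {n : ℕ} (hn : 0 < n) {x y : 𝕃} {h}
    (hxy : n • E.genericPt = .some x y h) : ¬ IsAlgebraic F x := by
  intro hx
  have h1 := E.hasLogDeriv_nsmul_genericPt n
  rw [hxy, hasLogDeriv_some] at h1
  have hn' : (n : 𝕃) ≠ 0 := Nat.cast_ne_zero.mpr hn.ne'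
  -- An algebraic x has derivative 0, so 2y + a₁x + a₃ = 0. Differentiating this gives that y has
  -- derivative 0, so both partial derivatives vanish at a nonsingular point.
  have hDx : E.invDerivation x = 0 := by
    have h2 := E.invDerivation.map_aeval (minpoly F x) x
    rw [minpoly.aeval, map_zero, smul_eq_mul, eq_comm, mul_eq_zero] at h2
    exact h2.resolve_left
      ((minpoly.irreducible hx.isIntegral).separable.aeval_derivative_ne_zero (minpoly.aeval F x))
  have hψ := h1.1
  rw [hDx, eq_comm, mul_eq_zero, or_iff_right hn'] at hψ
  have hDψ := congrArg E.invDerivation hψ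
  have e1 : E.invDerivation (E⁄𝕃).a₁ = 0 := E.invDerivation.map_algebraMap _
  have e3 : E.invDerivation (E⁄𝕃).a₃ = 0 := E.invDerivation.map_algebraMap _
  have e2 : E.invDerivation (2 : 𝕃) = 0 := E.invDerivation.map_natCast 2
  rw [map_add, map_add, Derivation.leibniz, Derivation.leibniz, e1, e2, e3, hDx] at hDψ
  simp only [smul_eq_mul, mul_zero, add_zero, map_zero, mul_eq_zero, OfNat.ofNat_ne_zero,
    false_or] at hDψ
  refine hn' (eq_zero_of_mul_invariant h (by rw [hψ, mul_zero]) ?_)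
  rw [← h1.2, hDψ]

end InvariantDerivation

end WeierstrassCurve

end

/-! ### Fibres of multiplication by n in terms of primes. -/

noncomputable section

/-- A valuation on an extension that is centered at a prime of a Dedekind domain induces the
valuation of the prime. -/
theorem IsDedekindDomain.HeightOneSpectrum.valuation_lt_one_iff_of_center {A L L' Γ : Type*}
    [CommRing A] [IsDedekindDomain A] [Field L] [Algebra A L] [IsFractionRing A L] [Field L']
    [LinearOrderedCommGroupWithZero Γ] (v : HeightOneSpectrum A) (w : Valuation L' Γ) (i : L →+* L')
    (h1 : ∀ a, w (i (algebraMap A L a)) ≤ 1)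
    (h2 : ∀ a, w (i (algebraMap A L a)) < 1 ↔ a ∈ v.asIdeal) (f : L) :
    v.valuation L f < 1 ↔ w (i f) < 1 := by
  have hs : ∀ s : v.asIdeal.primeCompl, w (i (algebraMap A L s)) = 1 := fun s =>
    (h1 _).antisymm (not_lt.mp fun h => s.2 ((h2 _).mp h))
  have hle : ∀ g : L, v.valuation L g ≤ 1 → w (i g) ≤ 1 := by
    intro g hg
    obtain ⟨a, s, has⟩ := v.exists_primeCompl_mul_eq_of_integer g hg
    have ha := h1 a
    rwa [← has, map_mul, map_mul, hs, mul_one] at ha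
  constructor
  · intro hf
    obtain ⟨a, s, has⟩ := v.exists_primeCompl_mul_eq_of_integer f hf.le
    have h3 : v.valuation L (algebraMap A L a) < 1 := by
      rw [← has, map_mul]
      exact mul_lt_one_of_lt_of_le hf (v.valuation_le_one _)
    have h4 := (h2 a).mpr ((v.valuation_lt_one_iff_mem _).mp h3)
    rwa [← has, map_mul, map_mul, hs, mul_one] at h4
  · intro hf
    by_contra h
    rw [not_lt] at h
    have h5 := hle f⁻¹ (by rw [map_inv₀]; exact inv_le_one_of_one_le₀ h)
    rw [map_inv₀, map_inv₀] at h5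
    have h0 : w (i f) ≠ 0 := by
      rw [Valuation.ne_zero_iff, Ne, map_eq_zero]
      rintro rfl
      rw [map_zero] at h
      exact not_lt.mpr h zero_lt_one
    exact not_lt.mpr h5 ((one_lt_inv₀ (zero_lt_iff.mpr h0)).mpr hf)

namespace WeierstrassCurve

set_option linter.unusedSectionVars false

open scoped Classical WithZero
open Polynomial IsDedekindDomain

universe u

section Transcendental

variable {F L : Type*} [Field F] [Field L] [Algebra F L] {W : WeierstrassCurve F}

lemma injective_of_not_isAlgebraic (φ : W.toAffine.CoordinateRing →ₐ[F] L)
    (h : ¬ IsAlgebraic F (φ W.xCoord)) : Function.Injective φ := by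
  by_contra hφ
  rw [injective_iff_map_eq_zero] at hφ
  push Not at hφ
  obtain ⟨a, ha, ha0⟩ := hφ
  have h1 : algebraMap F[X] _ (Algebra.norm F[X] a) ∈ RingHom.ker φ := norm_mem_of_mem ha
  rw [RingHom.mem_ker, algebraMap_polynomial, ← aeval_algHom_apply] at h1
  exact h ⟨_, norm_ne_zero ha0, h1⟩

lemma aeval_xCoord_injective : Function.Injective (aeval (R := F) W.xCoord) := by
  have h := FaithfulSMul.algebraMap_injective F[X] W.toAffine.CoordinateRing
  intro p q hpq
  apply h
  rwa [algebraMap_polynomial, algebraMap_polynomial]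

lemma not_isAlgebraic_toFF_xCoord : ¬ IsAlgebraic F (W.toFF W.xCoord) := by
  rintro ⟨p, hp, h⟩
  rw [aeval_algHom_apply] at h
  have h1 := (map_eq_zero_iff _ (IsFractionRing.injective W.toAffine.CoordinateRing
    W.toAffine.FunctionField)).mp h
  exact hp (aeval_xCoord_injective (h1.trans (map_zero _).symm))

lemma ker_ne_bot_of_isAlgebraic (φ : W.toAffine.CoordinateRing →ₐ[F] L)
    (h : IsAlgebraic F (φ W.xCoord)) : RingHom.ker φ ≠ ⊥ := by
  obtain ⟨p, hp, h⟩ := h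
  rw [aeval_algHom_apply] at h
  intro h0
  have : aeval W.xCoord p ∈ RingHom.ker φ := h
  rw [h0, Ideal.mem_bot] at this
  exact hp (aeval_xCoord_injective (this.trans (map_zero _).symm))

end Transcendental

section BaseChange

variable {F : Type u} [Field F] (W : WeierstrassCurve F) (Ω : Type u) [Field Ω] [Algebra F Ω]

/-- The coordinate ring of a base change. -/
def baseCoord : W.toAffine.CoordinateRing →ₐ[F] (W⁄Ω).toAffine.CoordinateRing :=
  W.evalCoord (W⁄Ω).xCoord (W⁄Ω).yCoord (by
    rw [Affine.equation_iff]
    exact (W⁄Ω).yCoord_sq)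

lemma baseCoord_xCoord : W.baseCoord Ω W.xCoord = (W⁄Ω).xCoord := evalCoord_xCoord _

lemma baseCoord_yCoord : W.baseCoord Ω W.yCoord = (W⁄Ω).yCoord := evalCoord_yCoord _

lemma toFF_baseCoord_injective :
    Function.Injective (((W⁄Ω).toFF.restrictScalars F).comp (W.baseCoord Ω)) := by
  apply injective_of_not_isAlgebraic
  rw [AlgHom.comp_apply, baseCoord_xCoord]
  intro h
  exact not_isAlgebraic_toFF_xCoord (W := W⁄Ω) (h.tower_top Ω)

/-- The function field of a base change. -/
def baseFF : W.toAffine.FunctionField →ₐ[F] (W⁄Ω).toAffine.FunctionField :=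
  IsFractionRing.liftAlgHom (A := W.toAffine.CoordinateRing) (W.toFF_baseCoord_injective Ω)

lemma baseFF_toFF (a : W.toAffine.CoordinateRing) :
    W.baseFF Ω (W.toFF a) = (W⁄Ω).toFF (W.baseCoord Ω a) :=
  IsFractionRing.lift_algebraMap (A := W.toAffine.CoordinateRing)
    (g := (((W⁄Ω).toFF.restrictScalars F).comp (W.baseCoord Ω)).toRingHom)
    (W.toFF_baseCoord_injective Ω) a

variable [W.IsElliptic]

/-- The points over the function field as points over the function field of a base change. -/
def basePtFF : (W⁄W.toAffine.FunctionField).toAffine.Point →+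
    ((W⁄Ω)⁄(W⁄Ω).toAffine.FunctionField).toAffine.Point :=
  Affine.Point.map (W' := W.toAffine) (W.baseFF Ω)

lemma basePtFF_genericPt : W.basePtFF Ω W.genericPt = (W⁄Ω).genericPt := by
  rw [genericPt_eq, genericPt_eq]
  refine (Affine.Point.some.injEq ..).mpr ⟨?_, ?_⟩
  · exact (W.baseFF_toFF Ω W.xCoord).trans (congrArg (W⁄Ω).toFF (W.baseCoord_xCoord Ω))
  · exact (W.baseFF_toFF Ω W.yCoord).trans (congrArg (W⁄Ω).toFF (W.baseCoord_yCoord Ω))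

variable {W Ω}

lemma evalCoord_baseCoord {c d : Ω} (h : (W⁄Ω).toAffine.Equation c d)
    (h' : ((W⁄Ω)⁄Ω).toAffine.Equation c d) (a : W.toAffine.CoordinateRing) :
    (W⁄Ω).evalCoord c d h' (W.baseCoord Ω a) = W.evalCoord c d h a := by
  have : (((W⁄Ω).evalCoord c d h').restrictScalars F).comp (W.baseCoord Ω) =
      W.evalCoord c d h := by
    apply coordinateRing_algHom_ext
    · change (W⁄Ω).evalCoord c d h' (W.baseCoord Ω W.xCoord) = _
      rw [baseCoord_xCoord, evalCoord_xCoord, evalCoord_xCoord]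
    · change (W⁄Ω).evalCoord c d h' (W.baseCoord Ω W.yCoord) = _
      rw [baseCoord_yCoord, evalCoord_yCoord, evalCoord_yCoord]
  exact DFunLike.congr_fun this a

end BaseChange

section Fibre

variable {F : Type u} [Field F] [CharZero F] {W : WeierstrassCurve F} [W.IsElliptic]
  {Ω : Type u} [Field Ω] [Algebra F Ω] [IsAlgClosed Ω]

/-- The multiple `n Q` of a point `Q ∈ E(Ω)` is `P`, if and only if the functions `x(P)` and `y(P)`
are the values of the coordinates of the multiple of the generic point at the corresponding prime. -/
lemma nsmul_eq_iff_valuation_lt_one {n : ℕ} {x y : W.toAffine.FunctionField} {hxy}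
    (hn : n • W.genericPt = .some x y hxy) {c d : Ω} (h : (W⁄Ω).toAffine.Nonsingular c d)
    {v : HeightOneSpectrum W.toAffine.CoordinateRing}
    (hv : v.asIdeal = RingHom.ker (W.evalCoord c d h.1)) {s t : F}
    (hst : (W⁄Ω).toAffine.Nonsingular (algebraMap F Ω s) (algebraMap F Ω t)) :
    n • (Affine.Point.some c d h) = .some _ _ hst ↔
      v.valuation W.toAffine.FunctionField (x - algebraMap F _ s) < 1 ∧
        v.valuation W.toAffine.FunctionField (y - algebraMap F _ t) < 1 := by
  have : CharZero Ω := charZero_of_injective_algebraMap (algebraMap F Ω).injective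
  have h' : ((W⁄Ω)⁄Ω).toAffine.Equation c d := h.1
  -- The place over Ω at Q = (c, d) restricts to one centred at v. Specialization is a homomorphism,
  -- so it carries n times the generic point to nQ.
  obtain ⟨κ, _, _, p, h1, h2, h3⟩ := (W⁄Ω).exists_place_pointPrime h'
  have hw : ∀ f, v.valuation W.toAffine.FunctionField f < 1 ↔ p.rel (W.baseFF Ω f) 0 := by
    intro f
    rw [h2]
    refine v.valuation_lt_one_iff_of_center _ (W.baseFF Ω).toRingHom (fun a => ?_) (fun a => ?_) f
    · change (pointPrime h').valuation _ (W.baseFF Ω (W.toFF a)) ≤ 1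
      rw [baseFF_toFF]
      exact HeightOneSpectrum.valuation_le_one _ _
    · change (pointPrime h').valuation _ (W.baseFF Ω (W.toFF a)) < 1 ↔ _
      rw [baseFF_toFF]
      refine (HeightOneSpectrum.valuation_lt_one_iff_mem _ _).trans ?_
      rw [mem_pointPrime, evalCoord_baseCoord h.1, hv, RingHom.mem_ker]
  have hrel : ∀ (f : W.toAffine.FunctionField) (s : F),
      p.rel (W.baseFF Ω (f - algebraMap F _ s)) 0 ↔
        p.rel (W.baseFF Ω f) (algebraMap Ω κ (algebraMap F Ω s)) := by
    intro f s
    have hc : p.rel (W.baseFF Ω (algebraMap F _ s)) (algebraMap Ω κ (algebraMap F Ω s)) := by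
      rw [AlgHom.commutes]
      exact p.const _
    rw [map_sub]
    constructor
    · intro h
      have := p.add h hc
      rwa [sub_add_cancel, zero_add] at this
    · intro h
      have := FieldPlace.sub h hc
      rwa [sub_self] at this
  rw [hw, hw, hrel, hrel]
  have hspec : (W⁄Ω).spec p (W.basePtFF Ω (n • W.genericPt)) =
      (W⁄Ω).constPt (F := Ω) (L := κ) (n • (Affine.Point.some c d h)) := by
    rw [map_nsmul, basePtFF_genericPt, map_nsmul, h3]
    exact (map_nsmul _ _ _).symm
  have hn' : W.basePtFF Ω (n • W.genericPt) =
      .some _ _ ((W⁄Ω).nonsingular_of_equation (L := (W⁄Ω).toAffine.FunctionField)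
        (x := W.baseFF Ω x) (y := W.baseFF Ω y) (by
          have := (Affine.baseChange_equation (W := W.toAffine) (f := W.baseFF Ω)
            (W.baseFF Ω).injective x y).mpr hxy.1
          exact this)) := by
    rw [hn]; rfl
  rw [hn'] at hspec
  constructor
  · intro hQ
    rw [hQ, spec_apply] at hspec
    have hc : (W⁄Ω).constPt (F := Ω) (L := κ) (.some _ _ hst) =
        .some _ _ ((W⁄Ω).nonsingular_of_equation (L := κ) (x := algebraMap Ω κ (algebraMap F Ω s))
          (y := algebraMap Ω κ (algebraMap F Ω t))
          ((Affine.baseChange_equation (W := (W⁄Ω).toAffine) (f := Algebra.ofId Ω κ)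
            (Algebra.ofId Ω κ).injective _ _).mpr hst.1)) := rfl
    obtain ⟨x', y', k, hk, hx', hy'⟩ :=
      exists_of_sp_eq_some (W := W⁄Ω) (p := p) (hspec.trans hc)
    rw [Affine.Point.some.injEq] at hk
    rw [hk.1, hk.2]
    exact ⟨hx', hy'⟩
  · rintro ⟨hx, hy⟩
    rw [spec_apply, sp_some _ hx hy] at hspec
    refine Affine.Point.map_injective (W' := (W⁄Ω).toAffine) (Algebra.ofId Ω κ) (hspec.symm.trans ?_)
    rfl

/-- The points of `E(Ω)` are divisible. -/
lemma exists_nsmul_eq {E : WeierstrassCurve Ω} [E.IsElliptic] [CharZero Ω] {n : ℕ} (hn : 0 < n)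
    {P : (E⁄Ω).toAffine.Point} (hP : P ≠ 0) : ∃ Q, n • Q = P := by
  rcases hη : n • E.genericPt with _ | ⟨x, y, hxy⟩
  · exact absurd hη (nsmul_genericPt_ne_zero hn)
  rcases P with _ | ⟨s, t, hst⟩
  · exact absurd rfl hP
  obtain ⟨φ, hφ⟩ : ∃ φ, φ = E.evalCoord x y hxy.1 := ⟨_, rfl⟩
  have hφx : φ E.xCoord = x := by rw [hφ, evalCoord_xCoord]
  have hφy : φ E.yCoord = y := by rw [hφ, evalCoord_yCoord]
  have hinj : Function.Injective φ := injective_of_not_isAlgebraic _ (by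
    rw [hφx]; exact not_isAlgebraic_of_nsmul_genericPt hn hη)
  -- The prime of P, transported by φ = [n]*, is dominated by a valuation ring V of the function
  -- field. At its place n times the generic point specializes to P, so the generic point
  -- specializes to a division point of P, possibly over a larger field κ.
  let J := (RingHom.ker (E.evalCoord s t hst.1)).map φ.toRingHom.rangeRestrict
  have hJ : J ≠ ⊤ := by
    intro h
    have h1 := congrArg (Ideal.comap φ.toRingHom.rangeRestrict) h
    rw [Ideal.comap_map_of_bijective _ ⟨fun a b hab => hinj (congrArg Subtype.val hab),
      φ.toRingHom.rangeRestrict_surjective⟩, Ideal.comap_top] at h1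
    exact (isMaximal_ker_evalPt hst.1).ne_top h1
  obtain ⟨V, hV1, hV2⟩ := Ideal.image_subset_nonunits_valuationSubring J hJ
  have hmem : ∀ a, E.evalCoord s t hst.1 a = 0 → φ a ∈ V.nonunits := fun a ha =>
    hV2 ⟨φ.toRingHom.rangeRestrict a, Ideal.mem_map_of_mem _ ha, rfl⟩
  obtain ⟨κ, _, _, p, h1, h2⟩ := exists_fieldPlace (F := Ω) V fun c => by
    rw [← φ.commutes]
    exact hV1 ⟨_, rfl⟩
  have hval : ∀ a, p.rel (φ a) (algebraMap Ω κ (E.evalCoord s t hst.1 a)) := by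
    intro a
    have h3 := p.add ((h2 _).mpr (hmem (a - algebraMap Ω _ (E.evalCoord s t hst.1 a)) (by
      rw [map_sub, AlgHom.commutes]; exact sub_self _)))
      (p.const (E.evalCoord s t hst.1 a))
    rwa [map_sub, AlgHom.commutes, sub_add_cancel, zero_add] at h3
  have hx := hval E.xCoord
  have hy := hval E.yCoord
  rw [hφx, evalCoord_xCoord] at hx
  rw [hφy, evalCoord_yCoord] at hy
  have hspec : n • E.spec p E.genericPt = E.constPt (F := Ω) (L := κ) (.some s t hst) := by
    rw [← map_nsmul, hη, spec_apply, sp_some _ hx hy, Affine.Point.map_some]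
    rfl
  have hne : E.spec p E.genericPt ≠ 0 := by
    intro h0
    rw [h0, smul_zero] at hspec
    exact Affine.Point.some_ne_zero _ hspec.symm
  obtain ⟨x₀, y₀, k₀, a, b, k, e₀, hxa, hyb, hsp⟩ := exists_of_sp_ne_zero
    (W := E) (p := p) (P := E.genericPt) (by rwa [spec_apply] at hne)
  rw [genericPt_eq, Affine.Point.some.injEq] at e₀
  obtain ⟨rfl, rfl⟩ := e₀
  obtain ⟨ψ, hψ⟩ : ∃ ψ, ψ = E.evalCoord a b k.1 := ⟨_, rfl⟩
  have hrel : ∀ f : E.toAffine.CoordinateRing, p.rel (E.toFF f) (ψ f) := by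
    have hpoly : ∀ q : Polynomial Ω, p.rel (E.toFF (aeval E.xCoord q)) (ψ (aeval E.xCoord q)) := by
      intro q
      induction q using Polynomial.induction_on' with
      | add q r hq hr => simp only [map_add]; exact p.add hq hr
      | monomial m c =>
        simp only [aeval_monomial, map_mul, map_pow, AlgHom.commutes]
        refine p.mul (p.const c) (FieldPlace.pow ?_ m)
        rwa [hψ, evalCoord_xCoord]
    intro f
    obtain ⟨q, r, rfl⟩ := E.exists_eq_add_mul f
    rw [map_add, map_add, map_mul, map_mul]
    refine p.add (hpoly q) (p.mul (hpoly r) ?_)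
    rwa [hψ, evalCoord_yCoord]
  -- If ψ is injective, only 0 has the value 0 at the place, but φ(x - s) ≠ 0 has this value. If ψ
  -- is not injective, the division point has coordinates in Ω.
  by_cases hψi : Function.Injective ψ
  · exfalso
    have hall : ∀ f : E.toAffine.FunctionField, p.rel f 0 → f = 0 := by
      intro f hf
      obtain ⟨u, v, hv, rfl⟩ := IsFractionRing.div_surjective (A := E.toAffine.CoordinateRing) f
      have hv0 : ψ v ≠ 0 := (map_ne_zero_iff ψ hψi).mpr (nonZeroDivisors.ne_zero hv)
      have h3 := p.unique (FieldPlace.div (hrel u) (hrel v) hv0) hf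
      rw [div_eq_zero_iff, or_iff_left hv0, map_eq_zero_iff ψ hψi] at h3
      rw [h3, map_zero, zero_div]
    have h4 := hall _ ((h2 _).mpr (hmem (E.xCoord - algebraMap Ω _ s) (by
      rw [map_sub, AlgHom.commutes, evalCoord_xCoord]; exact sub_self _)))
    rw [map_eq_zero_iff φ hinj] at h4
    exact xCoord_sub_ne_zero s h4
  · obtain ⟨c, d, hc, hd⟩ := exists_algebraMap_of_not_injective ψ hψi
    rw [hψ, evalCoord_xCoord] at hc
    rw [hψ, evalCoord_yCoord] at hd
    subst hc hd
    refine ⟨.some c d (E.nonsingular_of_equation (equation_of_algebraMap k.1)), ?_⟩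
    refine Affine.Point.map_injective (W' := E.toAffine) (Algebra.ofId Ω κ) ?_
    refine (map_nsmul (E.constPt (F := Ω) (L := κ)) n _).trans ?_
    rw [spec_apply, hsp] at hspec
    exact hspec

/-- If the points of `E(Ω)` whose multiple by `n` is `P` are conjugate, then there is a unique prime
of the coordinate ring at which the multiple of the generic point has the value `P`. -/
theorem existsUnique_prime [Algebra.IsAlgebraic F Ω] {n : ℕ} (hn : 0 < n)
    {x y : W.toAffine.FunctionField} {hxy} (hη : n • W.genericPt = .some x y hxy) {s t : F}
    (hst : (W⁄Ω).toAffine.Nonsingular (algebraMap F Ω s) (algebraMap F Ω t))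
    (htrans : ∀ (Q₁ Q₂ : (W⁄Ω).toAffine.Point), n • Q₁ = .some _ _ hst → n • Q₂ = .some _ _ hst →
      ∃ σ : Ω →ₐ[F] Ω, Affine.Point.map (W' := W.toAffine) σ Q₁ = Q₂) :
    ∃! v : HeightOneSpectrum W.toAffine.CoordinateRing,
      v.valuation W.toAffine.FunctionField (x - algebraMap F _ s) < 1 ∧
        v.valuation W.toAffine.FunctionField (y - algebraMap F _ t) < 1 := by
  have : CharZero Ω := charZero_of_injective_algebraMap (algebraMap F Ω).injective
  obtain ⟨Q, hQ⟩ : ∃ Q : (W⁄Ω).toAffine.Point, n • Q = .some _ _ hst :=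
    exists_nsmul_eq (E := W⁄Ω) hn (P := .some _ _ hst) (Affine.Point.some_ne_zero _)
  rcases Q with _ | ⟨c, d, h⟩
  · exfalso
    have h0 : n • (0 : (W⁄Ω).toAffine.Point) = .some _ _ hst := hQ
    rw [smul_zero] at h0
    exact Affine.Point.some_ne_zero _ h0.symm
  -- Existence: the kernel of evaluation at a division point.
  let v : HeightOneSpectrum W.toAffine.CoordinateRing :=
    ⟨RingHom.ker (W.evalCoord c d h.1), RingHom.ker_isPrime _,
      ker_ne_bot_of_isAlgebraic _ (Algebra.IsAlgebraic.isAlgebraic _)⟩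
  refine ⟨v, (nsmul_eq_iff_valuation_lt_one hη h rfl hst).mp hQ, fun v' hv' => ?_⟩
  have hmax := v'.isMaximal
  let := Ideal.Quotient.field v'.asIdeal
  have hfin : Module.Finite F (W.toAffine.CoordinateRing ⧸ v'.asIdeal) :=
    have : Algebra.FiniteType F (W.toAffine.CoordinateRing ⧸ v'.asIdeal) :=
      Algebra.FiniteType.of_surjective (Ideal.Quotient.mkₐ F v'.asIdeal)
        Ideal.Quotient.mk_surjective
    finite_of_finite_type_of_isJacobsonRing F _
  -- Uniqueness: the residue field of another such prime is finite over F, so it embeds in Ω and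
  -- yields a division point. Conjugate points have the same evaluation kernel.
  let l := IsAlgClosed.lift (R := F) (S := W.toAffine.CoordinateRing ⧸ v'.asIdeal) (M := Ω)
  let ψ : W.toAffine.CoordinateRing →ₐ[F] Ω := l.comp (Ideal.Quotient.mkₐ F v'.asIdeal)
  have hψ : RingHom.ker ψ = v'.asIdeal := by
    ext a
    rw [RingHom.mem_ker, ← Ideal.Quotient.eq_zero_iff_mem]
    exact map_eq_zero_iff l l.injective
  have h' : (W⁄Ω).toAffine.Nonsingular (ψ W.xCoord) (ψ W.yCoord) :=
    W.nonsingular_of_equation (equation_of_algHom ψ)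
  have hev : W.evalCoord _ _ h'.1 = ψ := evalCoord_unique _ ψ rfl rfl
  have hQ' := (nsmul_eq_iff_valuation_lt_one hη h' (v := v') (by rw [hev, hψ]) hst).mpr hv'
  obtain ⟨σ, hσ⟩ := htrans _ _ hQ hQ'
  have hσ' := (Affine.Point.some.injEq ..).mp hσ
  have hcomp : σ.comp (W.evalCoord c d h.1) = ψ := by
    apply coordinateRing_algHom_ext
    · rw [AlgHom.comp_apply, evalCoord_xCoord]; exact hσ'.1
    · rw [AlgHom.comp_apply, evalCoord_yCoord]; exact hσ'.2
  apply HeightOneSpectrum.ext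
  change v'.asIdeal = RingHom.ker (W.evalCoord c d h.1)
  rw [← hψ, ← hcomp]
  ext a
  rw [RingHom.mem_ker, RingHom.mem_ker]
  exact map_eq_zero_iff _ σ.injective

end Fibre

section Unramified

variable {F : Type u} [Field F] [CharZero F] {W : WeierstrassCurve F} [W.IsElliptic]
  (v : HeightOneSpectrum W.toAffine.CoordinateRing)

lemma valuation_algebraMap_base_le_one (c : F) :
    v.valuation W.toAffine.FunctionField (algebraMap F _ c) ≤ 1 := by
  rw [IsScalarTower.algebraMap_apply F W.toAffine.CoordinateRing]
  exact v.valuation_le_one _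

/-- The derivation preserves the coordinate ring, hence by the quotient rule also its localization
at v. -/
lemma valuation_invDerivation_le_one {f : W.toAffine.FunctionField}
    (hf : v.valuation W.toAffine.FunctionField f ≤ 1) :
    v.valuation W.toAffine.FunctionField (W.invDerivation f) ≤ 1 := by
  obtain ⟨a, s, has⟩ := v.exists_primeCompl_mul_eq_of_integer f hf
  obtain ⟨b, hb⟩ := W.exists_invDerivation_eq a
  obtain ⟨c, hc⟩ := W.exists_invDerivation_eq s
  have h := congrArg W.invDerivation has
  rw [Derivation.leibniz] at h
  change f * W.invDerivation (W.toFF s) + W.toFF s * W.invDerivation f =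
    W.invDerivation (W.toFF a) at h
  have h1 : W.invDerivation f * W.toFF s = W.toFF b - f * W.toFF c := by
    rw [← hb, ← hc]
    linear_combination h
  have hs : v.valuation W.toAffine.FunctionField (W.toFF s) = 1 := by
    refine (v.valuation_le_one _).antisymm (not_lt.mp fun h => s.2 ?_)
    exact (v.valuation_lt_one_iff_mem _).mp h
  have h2 := congrArg (v.valuation W.toAffine.FunctionField) h1
  rw [map_mul, hs, mul_one] at h2
  rw [h2]
  refine (Valuation.map_sub _ _ _).trans (max_le (v.valuation_le_one _) ?_)
  rw [map_mul]
  exact mul_le_one' hf (v.valuation_le_one _)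

lemma algebraMap_eq_zero_of_valuation_lt_one {c : F}
    (hc : v.valuation W.toAffine.FunctionField (algebraMap F _ c) < 1) : c = 0 := by
  by_contra h
  have h1 := mul_lt_one_of_lt_of_le hc (valuation_algebraMap_base_le_one v c⁻¹)
  rw [← map_mul, ← map_mul, mul_inv_cancel₀ h, map_one, map_one] at h1
  exact lt_irrefl _ h1

/-- Multiplication by `n` is unramified. -/
theorem not_valuation_invDerivation_lt_one {n : ℕ} (hn : 0 < n)
    {x y : W.toAffine.FunctionField} {hxy} (hη : n • W.genericPt = .some x y hxy) {s t : F}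
    (hst : W.toAffine.Nonsingular s t)
    (hx : v.valuation W.toAffine.FunctionField (x - algebraMap F _ s) < 1)
    (hy : v.valuation W.toAffine.FunctionField (y - algebraMap F _ t) < 1)
    (hDx : v.valuation W.toAffine.FunctionField (W.invDerivation x) < 1)
    (hDy : v.valuation W.toAffine.FunctionField (W.invDerivation y) < 1) : False := by
  have h1 := W.hasLogDeriv_nsmul_genericPt n
  rw [hη, hasLogDeriv_some] at h1
  have hmul : ∀ f g : W.toAffine.FunctionField, v.valuation W.toAffine.FunctionField f ≤ 1 →
      v.valuation W.toAffine.FunctionField g < 1 →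
      v.valuation W.toAffine.FunctionField (f * g) < 1 := fun f g hf hg => by
    rw [map_mul, mul_comm]; exact mul_lt_one_of_lt_of_le hg hf
  have hc : ∀ c : F, v.valuation W.toAffine.FunctionField (algebraMap F _ c) ≤ 1 :=
    valuation_algebraMap_base_le_one v
  have hx1 : v.valuation W.toAffine.FunctionField x ≤ 1 := by
    rw [← sub_add_cancel x (algebraMap F _ s)]
    exact (Valuation.map_add _ _ _).trans (max_le hx.le (hc s))
  -- By the logarithmic derivative, the derivatives of x and y are n times the values of the
  -- invariant vector field. Reduction at v gives n times its values at the nonsingular point (s,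
  -- t), so these vanish and n = 0.
  have hn0 : (n : F) = 0 := by
    refine eq_zero_of_mul_invariant hst (algebraMap_eq_zero_of_valuation_lt_one v ?_)
      (algebraMap_eq_zero_of_valuation_lt_one v ?_)
    · have e : algebraMap F W.toAffine.FunctionField (n * (2 * t + W.a₁ * s + W.a₃)) =
          W.invDerivation x - algebraMap F _ (2 * n) * (y - algebraMap F _ t) -
            algebraMap F _ (n * W.a₁) * (x - algebraMap F _ s) := by
        rw [h1.1]
        simp only [map_add, map_mul, map_natCast, map_ofNat, baseChange, map_a₁, map_a₃]
        ring
      rw [e]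
      exact Valuation.map_sub_lt _ (Valuation.map_sub_lt _ hDx (hmul _ _ (hc _) hy))
        (hmul _ _ (hc _) hx)
    · have e : algebraMap F W.toAffine.FunctionField
          (n * (3 * s ^ 2 + 2 * W.a₂ * s + W.a₄ - W.a₁ * t)) =
          W.invDerivation y - (algebraMap F _ (3 * n) * x +
            algebraMap F _ (3 * n * s + 2 * W.a₂ * n)) * (x - algebraMap F _ s) -
            algebraMap F _ (-(n * W.a₁)) * (y - algebraMap F _ t) := by
        rw [h1.2]
        simp only [map_add, map_sub, map_neg, map_mul, map_pow, map_natCast, map_ofNat, baseChange,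
          map_a₁, map_a₂, map_a₄]
        ring
      rw [e]
      refine Valuation.map_sub_lt _ (Valuation.map_sub_lt _ hDy (hmul _ _ ?_ hx))
        (hmul _ _ (hc _) hy)
      refine (Valuation.map_add _ _ _).trans (max_le ?_ (hc _))
      rw [map_mul]
      exact mul_le_one' (hc _) hx1
  exact hn.ne' (Nat.cast_eq_zero.mp hn0)

end Unramified

end WeierstrassCurve

end

/-! ### The ideal of the fibre is prime. -/

noncomputable section

namespace WeierstrassCurve

set_option linter.unusedSectionVars false

open scoped Classical WithZero
open Polynomial IsDedekindDomain

universe u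

section Localization

variable {A L B : Type*} [CommRing A] [IsDedekindDomain A] [Field L] [Algebra A L]
  [IsFractionRing A L] [CommRing B] [Algebra A B] {c : A} [IsLocalization.Away c B]
  {i : B →+* L} (hi : ∀ a, i (algebraMap A B a) = algebraMap A L a)

include c hi

lemma injective_of_away : Function.Injective i := by
  rw [injective_iff_map_eq_zero]
  intro b hb
  obtain ⟨⟨a, m⟩, h⟩ := IsLocalization.surj (Submonoid.powers c) b
  have ha : algebraMap A L a = 0 := by rw [← hi, ← h, map_mul, hb, zero_mul]
  rw [map_eq_zero_iff _ (IsFractionRing.injective A L)] at ha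
  dsimp only at h
  rw [ha, map_zero] at h
  exact (IsLocalization.map_units B m).mul_left_eq_zero.mp h

variable (v : HeightOneSpectrum A)

lemma valuation_algebraMap_eq_one_of_mem_powers (hv : c ∉ v.asIdeal) {m : A}
    (hm : m ∈ Submonoid.powers c) : v.valuation L (algebraMap A L m) = 1 := by
  obtain ⟨k, rfl⟩ := hm
  refine (v.valuation_le_one _).antisymm (not_lt.mp fun h => hv ?_)
  exact v.isPrime.mem_of_pow_mem k ((v.valuation_lt_one_iff_mem _).mp h)

lemma exists_valuation_eq_of_away (hv : c ∉ v.asIdeal) (b : B) : ∃ a : A,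
    v.valuation L (i b) = v.valuation L (algebraMap A L a) ∧
      Associated b (algebraMap A B a) := by
  obtain ⟨⟨a, m⟩, h⟩ := IsLocalization.surj (Submonoid.powers c) b
  refine ⟨a, ?_, (IsLocalization.map_units B m).unit, h⟩
  rw [← hi, ← h, map_mul, map_mul, hi,
    valuation_algebraMap_eq_one_of_mem_powers (B := B) hi v hv m.2, mul_one]

lemma valuation_lt_one_of_away (hv : c ∉ v.asIdeal) (b : B) : v.valuation L (i b) < 1 ↔
    b ∈ v.asIdeal.map (algebraMap A B) := by
  obtain ⟨a, ha, hb⟩ := exists_valuation_eq_of_away (B := B) hi v hv b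
  rw [ha, v.valuation_lt_one_iff_mem]
  have hd : Disjoint (Submonoid.powers c : Set A) v.asIdeal := by
    rw [Set.disjoint_left]
    rintro _ ⟨k, rfl⟩ h
    exact hv (v.isPrime.mem_of_pow_mem k h)
  have h1 := IsLocalization.under_map_of_isPrime_disjoint (Submonoid.powers c) B v.isPrime hd
  rw [← Ideal.mem_iff_of_associated hb.symm]
  conv_lhs => rw [← h1]
  rfl

end Localization

section Ramification

variable {A : Type*} [CommRing A] [IsDedekindDomain A]

/-- An ideal of a Dedekind domain is prime if it is contained in a unique maximal ideal and not in
its square. -/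
theorem _root_.IsDedekindDomain.isPrime_of_not_le_sq {I p : Ideal A} [p.IsPrime] (hI : I ≤ p)
    (huniq : ∀ m : Ideal A, m.IsMaximal → I ≤ m → m = p) (hsq : ¬ I ≤ p ^ 2) : I.IsPrime := by
  -- Write I = pJ. If J were proper, a maximal ideal above it would contain I, hence equal p, and I
  -- would lie in p².
  obtain ⟨J, rfl⟩ := Ideal.dvd_iff_le.mpr hI
  by_cases hJ : J = ⊤
  · rw [hJ, Ideal.mul_top]
    infer_instance
  · obtain ⟨m, hm, hJm⟩ := Ideal.exists_le_maximal J hJ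
    have hmp := huniq m hm (Ideal.mul_le_right.trans hJm)
    refine absurd ?_ hsq
    rw [pow_two, ← hmp]
    exact Ideal.mul_mono_right hJm

end Ramification

section Fibre

variable {F : Type u} [Field F] {W : WeierstrassCurve F}

/-- The kernel of the evaluation at a point is generated by the differences of coordinates. -/
lemma ker_evalCoord_eq_span {s t : F} (h : (W⁄F).toAffine.Equation s t) :
    RingHom.ker (W.evalCoord s t h) = Ideal.span {W.xCoord - algebraMap F _ s,
      W.yCoord - algebraMap F _ t} := by
  set J := Ideal.span {W.xCoord - algebraMap F W.toAffine.CoordinateRing s,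
      W.yCoord - algebraMap F _ t} with hJ
  have hx : W.xCoord - algebraMap F _ s ∈ J := Ideal.subset_span (by simp)
  have hy : W.yCoord - algebraMap F _ t ∈ J := Ideal.subset_span (by simp)
  apply le_antisymm
  · intro a ha
    have h1 : Ideal.Quotient.mkₐ F J = (Algebra.ofId F _).comp (W.evalCoord s t h) := by
      apply coordinateRing_algHom_ext
      · rw [AlgHom.comp_apply, evalCoord_xCoord]
        exact Ideal.Quotient.eq.mpr hx
      · rw [AlgHom.comp_apply, evalCoord_yCoord]
        exact Ideal.Quotient.eq.mpr hy
    have h2 := DFunLike.congr_fun h1 a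
    rw [AlgHom.comp_apply, RingHom.mem_ker.mp ha, map_zero] at h2
    exact Ideal.Quotient.eq_zero_iff_mem.mp h2
  · rw [hJ, Ideal.span_le]
    rintro _ (rfl | rfl)
    · rw [SetLike.mem_coe, RingHom.mem_ker, map_sub, evalCoord_xCoord, AlgHom.commutes]
      exact sub_self _
    · rw [SetLike.mem_coe, RingHom.mem_ker, map_sub, evalCoord_yCoord, AlgHom.commutes]
      exact sub_self _

variable [CharZero F] [W.IsElliptic] {B : Type*} [CommRing B]
  [Algebra W.toAffine.CoordinateRing B] {c : W.toAffine.CoordinateRing}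
  [IsLocalization.Away c B] {i : B →+* W.toAffine.FunctionField}
  (hi : ∀ a, i (algebraMap _ B a) = W.toFF a) {n : ℕ} (hn : 0 < n)
  {x y : W.toAffine.FunctionField} {hxy} (hη : n • W.genericPt = .some x y hxy)
  {ψ : W.toAffine.CoordinateRing →+* B} (hψ : ∀ a, i (ψ a) = W.evalCoord x y hxy.1 a)
  {s t : F}

include c hi hψ

/-- A prime of a localization of the coordinate ring at which the multiple of the generic point has
a given value lies over a prime at which it has this value. -/
lemma exists_prime_of_map_ker_le (hn : 0 < n) (hη : n • W.genericPt = .some x y hxy)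
    (h : (W⁄F).toAffine.Equation s t) {w : Ideal B} [w.IsPrime]
    (hw : RingHom.ker (W.evalCoord s t h) ≤ w.comap ψ) :
    ∃ v : HeightOneSpectrum W.toAffine.CoordinateRing,
      v.asIdeal = w.comap (algebraMap W.toAffine.CoordinateRing B) ∧
      v.valuation W.toAffine.FunctionField (x - algebraMap F _ s) < 1 ∧
        v.valuation W.toAffine.FunctionField (y - algebraMap F _ t) < 1 := by
  have hcw : c ∉ w.comap (algebraMap W.toAffine.CoordinateRing B) := fun hc =>
    ‹w.IsPrime›.ne_top (Ideal.eq_top_of_isUnit_mem _ hc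
      (IsLocalization.Away.algebraMap_isUnit (S := B) c))
  have hx : ψ (W.xCoord - algebraMap F _ s) ∈ w := hw (by
    rw [ker_evalCoord_eq_span]; exact Ideal.subset_span (by simp))
  have hy : ψ (W.yCoord - algebraMap F _ t) ∈ w := hw (by
    rw [ker_evalCoord_eq_span]; exact Ideal.subset_span (by simp))
  have hix : i (ψ (W.xCoord - algebraMap F _ s)) = x - algebraMap F _ s := by
    rw [hψ, map_sub, evalCoord_xCoord, AlgHom.commutes]
  have hiy : i (ψ (W.yCoord - algebraMap F _ t)) = y - algebraMap F _ t := by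
    rw [hψ, map_sub, evalCoord_yCoord, AlgHom.commutes]
  have hinj := injective_of_not_isAlgebraic (W.evalCoord x y hxy.1) (by
    rw [evalCoord_xCoord]; exact not_isAlgebraic_of_nsmul_genericPt hn hη)
  -- If w contracted to 0, then ψ(x - s) ∈ w would be 0; but n times the generic point is not
  -- constant.
  have hbot : w.comap (algebraMap W.toAffine.CoordinateRing B) ≠ ⊥ := by
    intro h0
    obtain ⟨⟨a, m⟩, ham⟩ := IsLocalization.surj (Submonoid.powers c)
      (ψ (W.xCoord - algebraMap F _ s))
    have ha : a ∈ w.comap (algebraMap W.toAffine.CoordinateRing B) := by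
      rw [Ideal.mem_comap]
      dsimp only at ham
      rw [← ham]
      exact w.mul_mem_right _ hx
    rw [h0, Ideal.mem_bot] at ha
    dsimp only at ham
    rw [ha, map_zero] at ham
    have h1 := (IsLocalization.map_units B m).mul_left_eq_zero.mp ham
    have h2 := hψ (W.xCoord - algebraMap F _ s)
    rw [h1, map_zero] at h2
    exact xCoord_sub_ne_zero s ((map_eq_zero_iff _ hinj).mp h2.symm)
  let v : HeightOneSpectrum W.toAffine.CoordinateRing := ⟨_, w.comap_isPrime _, hbot⟩
  have hw' : v.asIdeal.map (algebraMap _ B) = w :=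
    IsLocalization.map_under (Submonoid.powers c) B w
  refine ⟨v, rfl, ?_, ?_⟩
  · rw [← hix, valuation_lt_one_of_away hi v hcw, hw']
    exact hx
  · rw [← hiy, valuation_lt_one_of_away hi v hcw, hw']
    exact hy

/-- If there is a unique prime at which the multiple of the generic point has a given value, then
the fibre over this value is given by a prime ideal. -/
theorem isPrime_map_ker (hn : 0 < n) (hη : n • W.genericPt = .some x y hxy)
    (h : (W⁄F).toAffine.Equation s t) {v : HeightOneSpectrum W.toAffine.CoordinateRing}
    (hcv : c ∉ v.asIdeal)
    (hvx : v.valuation W.toAffine.FunctionField (x - algebraMap F _ s) < 1)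
    (hvy : v.valuation W.toAffine.FunctionField (y - algebraMap F _ t) < 1)
    (huniq : ∀ v' : HeightOneSpectrum W.toAffine.CoordinateRing,
      v'.valuation W.toAffine.FunctionField (x - algebraMap F _ s) < 1 →
      v'.valuation W.toAffine.FunctionField (y - algebraMap F _ t) < 1 → v' = v) :
    ((RingHom.ker (W.evalCoord s t h)).map ψ).IsPrime := by
  have hst : W.toAffine.Nonsingular s t := Affine.equation_iff_nonsingular.mp h
  have hd : Disjoint (Submonoid.powers c : Set W.toAffine.CoordinateRing) v.asIdeal := by
    rw [Set.disjoint_left]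
    rintro _ ⟨k, rfl⟩ h
    exact hcv (v.isPrime.mem_of_pow_mem k h)
  have hp := IsLocalization.isPrime_of_isPrime_disjoint (Submonoid.powers c) B _ v.isPrime hd
  have hix : i (ψ (W.xCoord - algebraMap F _ s)) = x - algebraMap F _ s := by
    rw [hψ, map_sub, evalCoord_xCoord, AlgHom.commutes]
  have hiy : i (ψ (W.yCoord - algebraMap F _ t)) = y - algebraMap F _ t := by
    rw [hψ, map_sub, evalCoord_yCoord, AlgHom.commutes]
  have hc0 : c ≠ 0 := fun h0 => hcv (h0 ▸ v.asIdeal.zero_mem)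
  have hM : Submonoid.powers c ≤ nonZeroDivisors W.toAffine.CoordinateRing :=
    powers_le_nonZeroDivisors_of_noZeroDivisors hc0
  have : IsDomain B := IsLocalization.isDomain_of_le_nonZeroDivisors _ hM
  have : IsDedekindDomain B := IsLocalization.isDedekindDomain _ hM B
  refine IsDedekindDomain.isPrime_of_not_le_sq (p := v.asIdeal.map (algebraMap _ B)) ?_ ?_ ?_
  · rw [ker_evalCoord_eq_span, Ideal.map_span, Ideal.span_le]
    rintro _ ⟨_, (rfl | rfl), rfl⟩
    · rw [SetLike.mem_coe, ← valuation_lt_one_of_away hi v hcv, hix]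
      exact hvx
    · rw [SetLike.mem_coe, ← valuation_lt_one_of_away hi v hcv, hiy]
      exact hvy
  · intro m hm hle
    have := hm.isPrime
    obtain ⟨v', hv', hx', hy'⟩ := exists_prime_of_map_ker_le (c := c) hi hψ hn hη h (w := m)
      (Ideal.map_le_iff_le_comap.mp hle)
    rw [← huniq v' hx' hy', hv']
    exact (IsLocalization.map_under (Submonoid.powers c) B m).symm
  · intro hle
    -- By the Leibniz rule the derivation maps the square of the prime into functions that vanish at
    -- v. As [n] is unramified, it cannot do so for both generators of the fibre ideal.
    have hD : ∀ z ∈ (v.asIdeal.map (algebraMap _ B)) ^ 2,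
        v.valuation W.toAffine.FunctionField (W.invDerivation (i z)) < 1 := by
      intro z hz
      rw [pow_two] at hz
      refine Submodule.mul_induction_on hz (fun f hf g hg => ?_) (fun f g hf hg => ?_)
      · rw [← valuation_lt_one_of_away hi v hcv] at hf hg
        rw [map_mul, Derivation.leibniz, smul_eq_mul, smul_eq_mul]
        refine Valuation.map_add_lt _ ?_ ?_
        · rw [map_mul]
          exact mul_lt_one_of_lt_of_le hf (valuation_invDerivation_le_one v hg.le)
        · rw [map_mul]
          exact mul_lt_one_of_lt_of_le hg (valuation_invDerivation_le_one v hf.le)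
      · rw [map_add, map_add]
        exact Valuation.map_add_lt _ hf hg
    have hker : ∀ a ∈ RingHom.ker (W.evalCoord s t h),
        v.valuation W.toAffine.FunctionField (W.invDerivation (i (ψ a))) < 1 := fun a ha =>
      hD _ (hle (Ideal.mem_map_of_mem _ ha))
    have h1 := hker (W.xCoord - algebraMap F _ s) (by
      rw [ker_evalCoord_eq_span]; exact Ideal.subset_span (by simp))
    have h2 := hker (W.yCoord - algebraMap F _ t) (by
      rw [ker_evalCoord_eq_span]; exact Ideal.subset_span (by simp))
    rw [hix, map_sub, Derivation.map_algebraMap, sub_zero] at h1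
    rw [hiy, map_sub, Derivation.map_algebraMap, sub_zero] at h2
    exact not_valuation_invDerivation_lt_one v hn hη hst hvx hvy h1 h2

omit c hi hψ in
/-- A point over the function field with integral coordinates at a prime is defined over a
localization of the coordinate ring away from an element outside this prime. -/
theorem exists_away_of_valuation_le_one {v : HeightOneSpectrum W.toAffine.CoordinateRing}
    (hxy : (W⁄W.toAffine.FunctionField).toAffine.Equation x y)
    (hvx : v.valuation W.toAffine.FunctionField x ≤ 1)
    (hvy : v.valuation W.toAffine.FunctionField y ≤ 1) :
    ∃ c ∉ v.asIdeal, ∃ ψ : W.toAffine.CoordinateRing →+* Localization.Away c,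
      ∀ i : Localization.Away c →+* W.toAffine.FunctionField,
        (∀ a, i (algebraMap _ _ a) = W.toFF a) → ∀ a, i (ψ a) = W.evalCoord x y hxy a := by
  obtain ⟨a₁, s₁, h₁⟩ := v.exists_primeCompl_mul_eq_of_integer x hvx
  obtain ⟨a₂, s₂, h₂⟩ := v.exists_primeCompl_mul_eq_of_integer y hvy
  change x * W.toFF s₁ = W.toFF a₁ at h₁
  change y * W.toFF s₂ = W.toFF a₂ at h₂
  -- A common denominator of x and y that does not vanish at v.
  set c := (s₁ * s₂ : W.toAffine.CoordinateRing) with hc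
  refine ⟨c, fun h => (v.isPrime.mem_or_mem h).elim s₁.2 s₂.2, ?_⟩
  have hc0 : c ≠ 0 := mul_ne_zero (fun h0 => s₁.2 (h0 ▸ v.asIdeal.zero_mem))
    (fun h0 => s₂.2 (h0 ▸ v.asIdeal.zero_mem))
  have hs : ∀ i : Localization.Away c →+* W.toAffine.FunctionField,
      (∀ a, i (algebraMap _ _ a) = W.toFF a) →
        i (IsLocalization.mk' _ (a₁ * s₂) ⟨c, Submonoid.mem_powers c⟩) = x ∧
        i (IsLocalization.mk' _ (a₂ * s₁) ⟨c, Submonoid.mem_powers c⟩) = y := by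
    intro i hi
    have hne : W.toFF c ≠ 0 := (map_ne_zero_iff _ (IsFractionRing.injective _ _)).mpr hc0
    constructor
    · apply mul_right_cancel₀ hne
      rw [← hi, ← map_mul]
      have := IsLocalization.mk'_spec (Localization.Away c) (a₁ * s₂)
        (⟨c, Submonoid.mem_powers c⟩ : Submonoid.powers c)
      dsimp only at this
      rw [this, hi, hi, hc, map_mul, map_mul]
      linear_combination (-W.toFF s₂) * h₁
    · apply mul_right_cancel₀ hne
      rw [← hi, ← map_mul]
      have := IsLocalization.mk'_spec (Localization.Away c) (a₂ * s₁)
        (⟨c, Submonoid.mem_powers c⟩ : Submonoid.powers c)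
      dsimp only at this
      rw [this, hi, hi, hc, map_mul, map_mul]
      linear_combination (-W.toFF s₁) * h₂
  have key : ∀ i : Localization.Away c →+* W.toAffine.FunctionField,
      (∀ a, i (algebraMap _ _ a) = W.toFF a) → ∃ j : Localization.Away c →ₐ[F]
        W.toAffine.FunctionField, (j : Localization.Away c →+* W.toAffine.FunctionField) = i := by
    intro i hi
    exact ⟨⟨i, fun r => (hi (algebraMap F _ r))⟩, rfl⟩
  let i₀ : Localization.Away c →+* W.toAffine.FunctionField :=
    IsLocalization.Away.lift (g := (W.toFF : W.toAffine.CoordinateRing →+* _)) c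
      (((map_ne_zero_iff _ (IsFractionRing.injective _ _)).mpr hc0).isUnit)
  have hi₀ : ∀ a, i₀ (algebraMap _ _ a) = W.toFF a := fun a => IsLocalization.Away.lift_eq _ _ a
  obtain ⟨j₀, hj₀⟩ := key i₀ hi₀
  have heq : (W⁄(Localization.Away c)).toAffine.Equation
      (IsLocalization.mk' _ (a₁ * s₂) ⟨c, Submonoid.mem_powers c⟩)
      (IsLocalization.mk' _ (a₂ * s₁) ⟨c, Submonoid.mem_powers c⟩) := by
    refine (W.toAffine.baseChange_equation (f := j₀) ?_ _ _).mp ?_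
    · have := injective_of_away (L := W.toAffine.FunctionField) (c := c) hi₀
      rw [← hj₀] at this
      exact this
    · have h1 : j₀ _ = x := (DFunLike.congr_fun hj₀ _).trans (hs i₀ hi₀).1
      have h2 : j₀ _ = y := (DFunLike.congr_fun hj₀ _).trans (hs i₀ hi₀).2
      rw [h1, h2]
      exact hxy
  refine ⟨W.evalCoord _ _ heq, fun i hi a => ?_⟩
  obtain ⟨j, rfl⟩ := key i hi
  have h3 : W.evalCoord x y hxy = j.comp (W.evalCoord _ _ heq) := by
    refine evalCoord_unique _ _ ?_ ?_
    · rw [AlgHom.comp_apply, evalCoord_xCoord]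
      exact (hs _ hi).1
    · rw [AlgHom.comp_apply, evalCoord_yCoord]
      exact (hs _ hi).2
  rw [h3]
  rfl

end Fibre

end WeierstrassCurve

end

/-! ### Fibres and partial maps of affine schemes. -/

noncomputable section

namespace AlgebraicGeometry

universe u

/-- The fibre of a morphism of affine schemes over a closed subscheme is integral if it is defined
by a prime ideal. -/
theorem isIntegral_pullback_specMap {A B F : Type u} [CommRing A] [CommRing B] [CommRing F]
    (f : A →+* B) (g : A →+* F) (hg : Function.Surjective g)
    (h : ((RingHom.ker g).map f).IsPrime) :
    IsIntegral (pullback (Spec.map (CommRingCat.ofHom f)) (Spec.map (CommRingCat.ofHom g))) := by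
  algebraize [f, g]
  -- The fibre is the spectrum of B ⊗ F, and as g is surjective this tensor product is the quotient
  -- of B by the ideal that the kernel of g generates.
  let e : (B ⧸ (RingHom.ker g).map f) ≃+* TensorProduct A B F :=
    (Algebra.TensorProduct.quotIdealMapEquivTensorQuot B (RingHom.ker g)).toRingEquiv.trans
      (Algebra.TensorProduct.congr (AlgEquiv.refl (R := A))
        (Ideal.quotientKerAlgEquivOfSurjective (f := Algebra.ofId A F) hg)).toRingEquiv
  have : IsDomain (TensorProduct A B F) := e.symm.toMulEquiv.isDomain _
  have : IsIntegral (Spec (.of (TensorProduct A B F))) := inferInstance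
  exact IsIntegral.of_isIso (pullbackSpecIso A B F).inv

section PartialMap

variable {A A' : Type u} [CommRing A] [IsDomain A] [CommRing A']

/-- A partial map between affine schemes is given by a ring homomorphism on each basic open set in
its domain. -/
theorem Scheme.PartialMap.exists_hom_away
    (f : (Spec (.of A)).PartialMap (Spec (.of A'))) {c : A}
    (hc : PrimeSpectrum.basicOpen c ≤ f.domain)
    {j : Localization.Away c →+* (Spec (.of A)).functionField}
    (hj : ∀ a, j (algebraMap A _ a) =
      (StructureSheaf.toStalk (CommRingCat.of A) (genericPoint (Spec (.of A)))).hom a) :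
    ∃ (k : Spec (.of (Localization.Away c)) ⟶ f.domain) (ψ : A' →+* Localization.Away c),
      k ≫ f.domain.ι = Spec.map (CommRingCat.ofHom (algebraMap A _)) ∧
      k ≫ f.hom = Spec.map (CommRingCat.ofHom ψ) ∧
      f.fromFunctionField = Spec.map (CommRingCat.ofHom (j.comp ψ)) := by
  have hr : Set.range (Spec.map (CommRingCat.ofHom (algebraMap A (Localization.Away c)))) ⊆
      Set.range f.domain.ι := by
    rw [Scheme.Opens.range_ι]
    refine subset_trans ?_ hc
    exact (PrimeSpectrum.localization_away_comap_range (Localization.Away c) c).le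
  let k := IsOpenImmersion.lift f.domain.ι
    (Spec.map (CommRingCat.ofHom (algebraMap A (Localization.Away c)))) hr
  have hk : k ≫ f.domain.ι = Spec.map (CommRingCat.ofHom (algebraMap A _)) :=
    IsOpenImmersion.lift_fac _ _ _
  obtain ⟨ψ, hψ⟩ := Spec.map_surjective (k ≫ f.hom)
  refine ⟨k, ψ.hom, hk, hψ.symm, ?_⟩
  have h1 : f.domain.fromSpecStalkOfMem _ ((genericPoint_specializes _).mem_open f.domain.2
      f.dense_domain.nonempty.choose_spec) = Spec.map (CommRingCat.ofHom j) ≫ k := by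
    rw [← cancel_mono f.domain.ι, Scheme.Opens.fromSpecStalkOfMem_ι, Category.assoc, hk,
      Spec.fromSpecStalk_eq', ← Spec.map_comp]
    congr 1
    ext a
    exact (hj a).symm
  rw [Scheme.PartialMap.fromFunctionField, Scheme.PartialMap.fromSpecStalkOfMem, h1,
    Category.assoc, ← hψ, ← Spec.map_comp]
  rfl

/-- A rational map that is given by a ring homomorphism on a basic open set is defined there. -/
theorem Scheme.RationalMap.basicOpen_le_domain
    (r : (Spec (.of A)) ⤏ (Spec (.of A'))) {c : A} (hc0 : c ≠ 0)
    {j : Localization.Away c →+* (Spec (.of A)).functionField}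
    (hj : ∀ a, j (algebraMap A _ a) =
      (StructureSheaf.toStalk (CommRingCat.of A) (genericPoint (Spec (.of A)))).hom a)
    (ψ : A' →+* Localization.Away c)
    (hr : r.fromFunctionField = Spec.map (CommRingCat.ofHom (j.comp ψ))) :
    PrimeSpectrum.basicOpen c ≤ r.domain := by
  let l := Spec.map (CommRingCat.ofHom (algebraMap A (Localization.Away c)))
  have hl : l.opensRange = PrimeSpectrum.basicOpen c := TopologicalSpace.Opens.ext <|
    PrimeSpectrum.localization_away_comap_range (Localization.Away c) c
  have hne : (l.opensRange : Set (Spec (.of A))).Nonempty := by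
    rw [hl]
    exact ⟨⟨⊥, Ideal.isPrime_bot⟩, hc0⟩
  -- The partial map given by ψ on the basic open set agrees with r at the generic point. So it
  -- represents r, whose domain then contains the set.
  let g : (Spec (.of A)).PartialMap (Spec (.of A')) :=
    ⟨l.opensRange, l.opensRange.2.dense hne,
      l.isoOpensRange.inv ≫ Spec.map (CommRingCat.ofHom ψ)⟩
  have hg : g.toRationalMap = r := by
    apply Scheme.RationalMap.eq_of_fromFunctionField_eq
    obtain ⟨k, ψ', h1, h2, h3⟩ := g.exists_hom_away hl.ge hj
    have hk : k = l.isoOpensRange.hom := by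
      rw [← cancel_mono l.opensRange.ι]
      exact h1.trans (Scheme.Hom.isoOpensRange_hom_ι l).symm
    have h4 : ψ' = ψ := by
      rw [hk] at h2
      have h5 := Spec.map_injective (h2.symm.trans (Iso.hom_inv_id_assoc _ _))
      exact congrArg CommRingCat.Hom.hom h5
    rw [Scheme.RationalMap.fromFunctionField_toRationalMap, h3, hr, h4]
  rw [← hg]
  exact le_trans hl.ge g.le_domain_toRationalMap

end PartialMap

end AlgebraicGeometry

end

/-! ### Integrality of the fibre as a scheme. -/

noncomputable section

namespace WeierstrassCurve

set_option linter.unusedSectionVars false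

open scoped Classical WithZero
open Polynomial IsDedekindDomain

universe u

section Fibre

variable {F : Type u} [Field F] {W : WeierstrassCurve F}

/-- The embedding of a localization of the coordinate ring into the function field. -/
def awayToFF {c : W.toAffine.CoordinateRing} (hc : c ≠ 0) :
    Localization.Away c →+* W.toAffine.FunctionField :=
  IsLocalization.Away.lift (g := (W.toFF : W.toAffine.CoordinateRing →+* _)) c
    (((map_ne_zero_iff _ (IsFractionRing.injective _ _)).mpr hc).isUnit)

lemma awayToFF_algebraMap {c : W.toAffine.CoordinateRing} (hc : c ≠ 0)
    (a : W.toAffine.CoordinateRing) : awayToFF hc (algebraMap _ _ a) = W.toFF a :=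
  IsLocalization.Away.lift_eq _ _ a

variable [CharZero F] [W.IsElliptic]

lemma mulRational_fromFunctionField {n : ℕ} {x y : W.toAffine.FunctionField} {hxy}
    (hη : n • W.genericPt = .some x y hxy) :
    (W.mulRational n).fromFunctionField = Spec.map (CommRingCat.ofHom
      (W.functionFieldEquiv.toRingHom.comp (W.evalCoord x y hxy.1).toRingHom)) := by
  have h2 : ∀ (R : (W⁄W.toAffine.FunctionField).toAffine.Point) (hR : R ≠ 0),
      R = .some x y hxy → (W.rationalMapOfPoint R hR).fromFunctionField = Spec.map (CommRingCat.ofHom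
      (W.functionFieldEquiv.toRingHom.comp (W.evalCoord x y hxy.1).toRingHom)) := by
    rintro R hR rfl
    exact Scheme.RationalMap.fromFunctionField_ofFunctionField _ _ _ _
  unfold mulRational
  split_ifs with h
  · refine absurd ?_ (Affine.Point.some_ne_zero hxy)
    rw [← hη]
    convert h
  · refine h2 _ h ?_
    rw [← hη]
    congr!

/-- If there is a unique prime of the coordinate ring at which the multiple of the generic point by
`n` has the value `P`, then the fibre of the multiplication by `n` over `P` is integral. -/
theorem isIntegral_mulFibre {n : ℕ} (hn : 0 < n) {x y : W.toAffine.FunctionField} {hxy}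
    (hη : n • W.genericPt = .some x y hxy) {s t : F} (hst : W.toAffine.Nonsingular s t)
    (hP : Affine.Point.some s t hst ≠ 0)
    (hex : ∃! v : HeightOneSpectrum W.toAffine.CoordinateRing,
      v.valuation W.toAffine.FunctionField (x - algebraMap F _ s) < 1 ∧
        v.valuation W.toAffine.FunctionField (y - algebraMap F _ t) < 1) :
    AlgebraicGeometry.IsIntegral (W.mulFibre n (.some s t hst) hP) := by
  obtain ⟨v, ⟨hvx, hvy⟩, huniq⟩ := hex
  have hst' : (W⁄F).toAffine.Equation s t := by
    rw [show W⁄F = W from W.map_id]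
    exact hst.1
  have hle : ∀ (z : W.toAffine.FunctionField) (c : F),
      v.valuation W.toAffine.FunctionField (z - algebraMap F _ c) < 1 →
        v.valuation W.toAffine.FunctionField z ≤ 1 := fun z c h => by
    rw [← sub_add_cancel z (algebraMap F _ c)]
    exact (Valuation.map_add _ _ _).trans (max_le h.le (valuation_algebraMap_base_le_one v c))
  set f := (W.mulRational n).toPartialMap with hf
  have hff : f.fromFunctionField = Spec.map (CommRingCat.ofHom
      (W.functionFieldEquiv.toRingHom.comp (W.evalCoord x y hxy.1).toRingHom)) := by
    rw [← Scheme.RationalMap.fromFunctionField_toRationalMap, hf,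
      Scheme.RationalMap.toRationalMap_toPartialMap, mulRational_fromFunctionField hη]
  have haway : ∀ {c : W.toAffine.CoordinateRing} (hc0 : c ≠ 0),
      PrimeSpectrum.basicOpen c ≤ f.domain → ∃ (k : Spec (.of (Localization.Away c)) ⟶ f.domain)
        (ψ : W.toAffine.CoordinateRing →+* Localization.Away c),
        k ≫ f.domain.ι = Spec.map (CommRingCat.ofHom (algebraMap _ _)) ∧
        k ≫ f.hom = Spec.map (CommRingCat.ofHom ψ) ∧
        ∀ a, awayToFF hc0 (ψ a) = W.evalCoord x y hxy.1 a := by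
    intro c hc0 hc
    obtain ⟨k, ψ, h1, h2, h3⟩ := f.exists_hom_away hc
      (j := W.functionFieldEquiv.toRingHom.comp (awayToFF hc0)) (fun a => by
        rw [RingHom.comp_apply, awayToFF_algebraMap]
        exact W.functionFieldEquiv_algebraMap a)
    refine ⟨k, ψ, h1, h2, fun a => W.functionFieldEquiv.injective ?_⟩
    have h4 := congrArg CommRingCat.Hom.hom (Spec.map_injective (h3.symm.trans hff))
    exact DFunLike.congr_fun h4 a
  -- Since n times the generic point is integral at v, the rational map [n] is defined on a basic
  -- open neighbourhood of v.
  obtain ⟨c, hcv, ψ₀, hψ₀⟩ := exists_away_of_valuation_le_one hxy.1 (hle x s hvx) (hle y t hvy)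
  have hc0 : c ≠ 0 := fun h0 => hcv (h0 ▸ v.asIdeal.zero_mem)
  have hcd : PrimeSpectrum.basicOpen c ≤ f.domain := by
    refine Scheme.RationalMap.basicOpen_le_domain (W.mulRational n) hc0
      (j := W.functionFieldEquiv.toRingHom.comp (awayToFF hc0)) (fun a => by
        rw [RingHom.comp_apply, awayToFF_algebraMap]
        exact W.functionFieldEquiv_algebraMap a) ψ₀ ?_
    rw [mulRational_fromFunctionField hη]
    refine congrArg (fun g => Spec.map (CommRingCat.ofHom g)) (RingHom.ext fun a => ?_)
    exact congrArg W.functionFieldEquiv (hψ₀ _ (awayToFF_algebraMap hc0) a).symm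
  obtain ⟨k, ψ, hkι, hkf, hψ⟩ := haway hc0 hcd
  have hprime := isPrime_map_ker (awayToFF_algebraMap hc0) hψ hn hη hst' hcv hvx hvy
    (fun v' h1 h2 => huniq v' ⟨h1, h2⟩)
  have hint := isIntegral_pullback_specMap ψ (W.evalCoord s t hst').toRingHom
    (fun a => ⟨algebraMap F _ a, (W.evalCoord s t hst').commutes a⟩) hprime
  have hopen : IsOpenImmersion k := by
    have : IsOpenImmersion (k ≫ f.domain.ι) := by
      rw [hkι]
      infer_instance
    exact IsOpenImmersion.of_comp k f.domain.ι
  let p := Spec.map (CommRingCat.ofHom (W.evalCoord s t hst').toRingHom)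
  change AlgebraicGeometry.IsIntegral (pullback f.hom p)
  let m : pullback (Spec.map (CommRingCat.ofHom ψ)) p ⟶ pullback f.hom p :=
    pullback.map _ _ _ _ k (𝟙 _) (𝟙 _) (by rw [Category.comp_id, hkf])
      (by rw [Category.comp_id, Category.id_comp])
  have hm : IsOpenImmersion m := inferInstance
  -- The whole fibre lies over this neighbourhood: a point u of the fibre, seen in a basic open set
  -- in the domain of [n], gives a prime at which n times the generic point has the value P. By
  -- uniqueness this prime is v, and c does not vanish there.
  have hsurj : m.opensRange = ⊤ := by
    rw [eq_top_iff]
    intro z _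
    change z ∈ Set.range m
    rw [Scheme.Pullback.range_map]
    refine ⟨?_, ⟨_, rfl⟩⟩
    change pullback.fst f.hom p z ∈ Set.range k
    set u := pullback.fst f.hom p z with hu
    have hfu : f.hom u = p (pullback.snd f.hom p z) := by
      rw [hu, ← Scheme.Hom.comp_apply, pullback.condition, Scheme.Hom.comp_apply]
    obtain ⟨_, ⟨d, rfl⟩, hud, hd⟩ :=
      PrimeSpectrum.isTopologicalBasis_basic_opens.exists_subset_of_mem_open u.2 f.domain.2
    have hd0 : d ≠ 0 := fun h0 => hud (h0 ▸ Ideal.zero_mem _)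
    obtain ⟨k', ψ', hkι', hkf', hψ'⟩ := haway hd0 hd
    obtain ⟨w, hw⟩ := (PrimeSpectrum.localization_away_comap_range (Localization.Away d) d).ge hud
    have hkw : k' w = u := Subtype.ext ((congrArg (fun g => g.base w) hkι').trans hw)
    have hker : RingHom.ker (W.evalCoord s t hst') ≤ w.asIdeal.comap ψ' := by
      intro a ha
      have h1 := congrArg PrimeSpectrum.asIdeal ((congrArg (fun g => g.base w) hkf').symm.trans
        ((congrArg f.hom hkw).trans hfu))
      change w.asIdeal.comap ψ' = Ideal.comap (W.evalCoord s t hst').toRingHom _ at h1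
      rw [h1, Ideal.mem_comap]
      have h2 : (W.evalCoord s t hst').toRingHom a = 0 := ha
      rw [h2]
      exact Ideal.zero_mem _
    have hwp := w.isPrime
    obtain ⟨v', hv', hx', hy'⟩ := exists_prime_of_map_ker_le (c := d) (awayToFF_algebraMap hd0) hψ' hn hη
      hst' hker
    have hvv := huniq v' ⟨hx', hy'⟩
    have huc : u.1 ∈ PrimeSpectrum.basicOpen c := by
      intro hcu
      apply hcv
      rw [← hvv, hv']
      rw [← hw] at hcu
      exact hcu
    obtain ⟨w', hw'⟩ := (PrimeSpectrum.localization_away_comap_range (Localization.Away c) c).ge huc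
    exact ⟨w', Subtype.ext ((congrArg (fun g => g.base w') hkι).trans hw')⟩
  have := isIso_of_isOpenImmersion_of_opensRange_eq_top m hsurj
  exact AlgebraicGeometry.IsIntegral.of_isIso m

/-- If the points of `E(Ω)` whose multiple by `n` is `P` are conjugate, then the fibre of the
multiplication by `n` over `P` is integral. -/
theorem isIntegral_mulFibre_of_conjugate {Ω : Type u} [Field Ω] [Algebra F Ω] [IsAlgClosed Ω]
    [Algebra.IsAlgebraic F Ω] {n : ℕ} (hn : 0 < n) {s t : F} (hst : W.toAffine.Nonsingular s t)
    (hP : Affine.Point.some s t hst ≠ 0)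
    (hst' : (W⁄Ω).toAffine.Nonsingular (algebraMap F Ω s) (algebraMap F Ω t))
    (hconj : ∀ (Q₁ Q₂ : (W⁄Ω).toAffine.Point), n • Q₁ = .some _ _ hst' →
      n • Q₂ = .some _ _ hst' → ∃ σ : Ω →ₐ[F] Ω, Affine.Point.map (W' := W.toAffine) σ Q₁ = Q₂) :
    AlgebraicGeometry.IsIntegral (W.mulFibre n (.some s t hst) hP) := by
  obtain ⟨x, y, hxy, hη⟩ : ∃ x y hxy, n • W.genericPt = .some x y hxy := by
    have h0 := W.nsmul_genericPt_ne_zero hn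
    generalize n • W.genericPt = R at h0 ⊢
    rcases R with _ | ⟨x, y, hxy⟩
    · exact absurd rfl h0
    · exact ⟨x, y, hxy, rfl⟩
  exact isIntegral_mulFibre hn hη hst hP (existsUnique_prime hn hη hst' hconj)

end Fibre

end WeierstrassCurve

end

/-! ### The proposition. -/

theorem proposition4p9 {k : Type*} [Field k] [CharZero k]
    (W : WeierstrassCurve k) [W.IsElliptic]
    {Ω : Type*} [Field Ω] [Algebra k Ω] [IsAlgClosure k Ω]
    (b : W.TorsionBasis Ω) (hρ : SLPlusZHat ≤ b.rho.range)
    (K : IntermediateField k Ω) (hK : K ≤ cyclotomicExtension k Ω) :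
    (SLPlusZHat ≤ K.fixingSubgroup.map b.rho ∧
      ∀ n : ℕ+, SLPlusZMod n ≤ K.fixingSubgroup.map (b.rhoMod n)) ∧
    ∀ (P : (W.baseChange K).toAffine.Point) (hP : (W.baseChange K).IsIndivisible P)
      (n : ℕ), 0 < n → IsIntegral ((W.baseChange K).mulFibre n P hP.ne_zero) := by
  have : IsAlgClosed Ω := IsAlgClosure.isAlgClosed k
  have : Algebra.IsAlgebraic k Ω := IsAlgClosure.isAlgebraic
  have : CharZero Ω := charZero_of_injective_algebraMap (algebraMap k Ω).injective
  have : Normal k Ω := IsAlgClosure.normal k Ω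
  have : IsGalois k Ω := {}
  have h := b.SLPlusZHat_le_map_rho hρ hK
  refine ⟨⟨h, b.SLPlusZMod_le_map_rhoMod h⟩, fun P hP n hn => ?_⟩
  rcases P with _ | ⟨s, t, hst⟩
  · exact absurd rfl hP.ne_zero
  have : CharZero K := charZero_of_injective_algebraMap (algebraMap k K).injective
  have : Algebra.IsAlgebraic K Ω := Algebra.IsAlgebraic.tower_top (K := k) K
  have hst' : (W.baseChange Ω).toAffine.Nonsingular (algebraMap K Ω s) (algebraMap K Ω t) :=
    (WeierstrassCurve.Affine.baseChange_nonsingular (W := W.toAffine) (f := K.val)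
      K.val.injective s t).mpr hst
  refine WeierstrassCurve.isIntegral_mulFibre_of_conjugate (W := W.baseChange K) (Ω := Ω) hn hst hP.ne_zero
    hst' fun Q₁ Q₂ h₁ h₂ => ?_
  -- Part (i) for K is what makes the transitivity theorem applicable over K.
  obtain ⟨σ, hσ, h⟩ := WeierstrassCurve.exists_smul_eq_of_nsmul_eq_mapPoint b h hP hn
    (Q₁ := Q₁) (Q₂ := Q₂) h₁ h₂
  refine ⟨{ (σ : Ω →ₐ[k] Ω).toRingHom with commutes' := fun x => hσ x }, Eq.trans ?_ h⟩
  cases Q₁ <;> rfl
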